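/- For $n,\ell\ge 0$ let $R_n$ be the ring of symmetric polynomials in $x_1,\dots,x_n$ over $\mathbb{C}$ and $H^{(n)}=\bigoplus_{j=0}^{n-1}R_nX^j$. Identify $\wedge^\ell H^{(n)}$ with the space of polynomials $P(X_1,\dots,X_\ell\,|\,x_1,\dots,x_n)$ that are anti-symmetric in the $X_a$, of degree less than $n$ in each $X_a$, and symmetric in the $x_j$, via $X^{i_1}\wedge\cdots\wedge X^{i_\ell}\mapsto\sum_{\sigma\in S_\ell}\operatorname{sgn}\sigma\,X_{\sigma(1)}^{i_1}\cdots X_{\sigma(\ell)}^{i_\ell}$. Let $U_{n,\ell}$ be the space of all $P\in\wedge^\ell H^{(n)}$ with $$P(X_1,\dots,X_{\ell-1},\pm x^{-1}\,|\,x_1,\dots,x_{n-2},x,-x)=0\quad\text{for both signs}$$ (no condition if $\ell=0$ or $n\le 1$), and $U_{n,\ell}=0$ for $\ell<0$. Put $\Theta_\pm(X)=\prod_{j=1}^n(1\pm Xx_j)$, $$2\,\Xi_1(X)=\Theta_+(X)+(-1)^{n-1}\Theta_-(X),$$ $$2\,\Xi_2(X_1,X_2)=\bigl(\Theta_+(X_1)\Theta_+(X_2)-\Theta_-(X_1)\Theta_-(X_2)\bigr)\frac{X_1-X_2}{X_1+X_2}+(-1)^n\bigl(\Theta_+(X_1)\Theta_-(X_2)-\Theta_+(X_2)\Theta_-(X_1)\bigr),$$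 and $$M_{n,\ell}=\frac{U_{n,\ell}}{U_{n,\ell-1}\wedge\Xi_1+U_{n,\ell-2}\wedge\Xi_2},\qquad M^{(i)}_\lambda=\bigoplus_{n\equiv i\bmod 2,\ n-2\ell=\lambda}M_{n,\ell}$$ for $i\in\{0,1\}$ and integers $\lambda\ge 0$. Grade $M_{n,\ell}$, and hence $M^{(i)}_\lambda$, by $\deg_2=\frac{n^2}{4}+\deg_1$, where $\deg_1X_a=-1$ and $\deg_1x_j=1$. Theorem. The space $M^{(i)}_\lambda$ is the direct sum of its homogeneous subspaces $M^{(i)}_\lambda(k)$, which are finite dimensional and vanish unless $k\in\frac14\mathbb{Z}_{\ge 0}$, and its character $\operatorname{ch}M^{(i)}_\lambda=\sum_kq^k\dim M^{(i)}_\lambda(k)$ is, as a formal power series in $q^{1/4}$, $$\operatorname{ch}M^{(i)}_\lambda=\sum_{n-2\ell=\lambda,\ n\equiv i\bmod 2}\frac{q^{n^2/4}}{(q)_n}\left(\begin{bmatrix}n\\ \ell\end{bmatrix}_q-\begin{bmatrix}n\\ \ell-1\end{bmatrix}_q\right),$$ where $(q)_n=\prod_{j=1}^n(1-q^j)$, $\begin{bmatrix}n\\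 \ell\end{bmatrix}_q=\frac{(q)_n}{(q)_\ell(q)_{n-\ell}}$ for $0\le\ell\le n$, and $\begin{bmatrix}n\\ -1\end{bmatrix}_q=0$. Moreover, with the $sl_2$ characters $\chi_{\lambda/2}(z)=\frac{z^{\lambda+1}-z^{-(\lambda+1)}}{z-z^{-1}}$, $$\sum_{\lambda\ge 0,\ \lambda\equiv i\bmod 2}\chi_{\lambda/2}(z)\operatorname{ch}M^{(i)}_\lambda=\sum_{n\ge 0,\ n\equiv i\bmod 2}\ \sum_{\ell=0}^n\frac{z^{n-2\ell}q^{n^2/4}}{(q)_\ell(q)_{n-\ell}}$$ as formal power series in $q^{1/4}$ with coefficients in $\mathbb{Q}[z,z^{-1}]$; the right-hand side is the expression known as the fermionic form of the character of the level-one integrable highest weight module $V(\Lambda_i)$ of $\widehat{sl_2}$. -/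

import Mathlib

namespace QKZ

open MvPolynomial

/-- The polynomials `P(X_1, …, X_ℓ | x_1, …, x_n)` with complex coefficients: `Sum.inl a` indexes
the variable `X_{a+1}` and `Sum.inr j` indexes the variable `x_{j+1}`. -/
abbrev Poly (n ℓ : ℕ) : Type := MvPolynomial (Fin ℓ ⊕ Fin n) ℂ

/-- The exterior power `∧^ℓ H^{(n)}` of `H^{(n)} = ⨁_{j < n} R_n X^j` over the ring `R_n` of
symmetric polynomials in `x_1, …, x_n`, identified with the polynomials which have degree less
than `n` in each `X_a`, are anti-symmetric in the `X_a`, and symmetric in the `x_j`. -/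
def wedgePower (n ℓ : ℕ) : Submodule ℂ (Poly n ℓ) where
  carrier := {P | (∀ m ∈ P.support, ∀ a : Fin ℓ, m (Sum.inl a) < n) ∧
    (∀ σ : Equiv.Perm (Fin ℓ),
      rename (Sum.map σ id) P = (Equiv.Perm.sign σ : ℤ) • P) ∧
    (∀ τ : Equiv.Perm (Fin n), rename (Sum.map id τ) P = P)}
  zero_mem' := by simp
  add_mem' := by
    rintro P Q ⟨hP, hP', hP''⟩ ⟨hQ, hQ', hQ''⟩
    refine ⟨fun m hm a => ?_, fun σ => ?_, fun τ => ?_⟩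
    · classical
      rcases Finset.mem_union.1 (support_add hm) with h | h
      · exact hP m h a
      · exact hQ m h a
    · rw [map_add, hP', hQ', smul_add]
    · rw [map_add, hP'', hQ'']
  smul_mem' := by
    rintro c P ⟨hP, hP', hP''⟩
    refine ⟨fun m hm a => hP m (support_smul hm) a, fun σ => ?_, fun τ => ?_⟩
    · rw [map_smul, hP', smul_comm]
    · rw [map_smul, hP'']

/-- For `ε = ±1`, the substitution
`P ↦ P(X_1, …, X_{ℓ-1}, ε x⁻¹ | x_1, …, x_{n-2}, x, -x)` with `x = x_{n-1}`, for `ℓ = k + 1` and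
`n = m + 2`. The result is a rational function of `X_1, …, X_{ℓ-1}, x_1, …, x_{n-1}`. -/
noncomputable def rho {m k : ℕ} (ε : ℂ) :
    Poly (m + 2) (k + 1) →ₐ[ℂ] FractionRing (Poly (m + 1) k) :=
  let K := FractionRing (Poly (m + 1) k)
  let x : K := algebraMap (Poly (m + 1) k) K (X (Sum.inr (Fin.last m)))
  aeval (Sum.elim
    (Fin.snoc (α := fun _ => K)
      (fun a => algebraMap (Poly (m + 1) k) K (X (Sum.inl a))) (algebraMap ℂ K ε * x⁻¹))
    (Fin.snoc (α := fun _ => K)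
      (fun j => algebraMap (Poly (m + 1) k) K (X (Sum.inr j))) (-x)))

/-- The equations `ρ_+(P) = ρ_-(P) = 0`. There is no equation if there is no variable `X_ℓ` to
substitute, or no pair `x_{n-1}, x_n`. -/
def NullResidue : {n ℓ : ℕ} → Poly n ℓ → Prop
  | _ + 2, _ + 1, P => rho 1 P = 0 ∧ rho (-1) P = 0
  | _, _, _ => True

/-- The space `U_{n,ℓ}` of all `P ∈ ∧^ℓ H^{(n)}` with `ρ_+(P) = ρ_-(P) = 0`; in particular
`U_{n,0} = R_n`. -/
def U (n ℓ : ℕ) : Submodule ℂ (Poly n ℓ) where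
  carrier := {P | P ∈ wedgePower n ℓ ∧ NullResidue P}
  zero_mem' := by
    refine ⟨zero_mem _, ?_⟩
    rcases n with _ | _ | n <;> rcases ℓ with _ | ℓ <;> simp [NullResidue]
  add_mem' := by
    rintro P Q ⟨hP, hP'⟩ ⟨hQ, hQ'⟩
    refine ⟨add_mem hP hQ, ?_⟩
    rcases n with _ | _ | n <;> rcases ℓ with _ | ℓ <;> simp_all [NullResidue]
  smul_mem' := by
    rintro c P ⟨hP, hP'⟩
    refine ⟨Submodule.smul_mem _ c hP, ?_⟩
    rcases n with _ | _ | n <;> rcases ℓ with _ | ℓ <;> simp_all [NullResidue]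

/-- The exterior product of `p ∈ ∧^a H^{(n)}` and `r ∈ ∧^b H^{(n)}` in terms of anti-symmetric
polynomials:
`∑_σ sgn σ · p(X_{σ 1}, …, X_{σ a}) r(X_{σ (a+1)}, …, X_{σ (a+b)})`, with the normalization
`1 / (a! b!)` under which `X^{i_1} ∧ ⋯ ∧ X^{i_ℓ}` is
`∑_σ sgn σ · X_{σ 1}^{i_1} ⋯ X_{σ ℓ}^{i_ℓ}`. -/
noncomputable def wedge {n a b : ℕ} (p : Poly n a) (r : Poly n b) : Poly n (a + b) :=
  ((a.factorial * b.factorial : ℕ) : ℂ)⁻¹ •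
    ∑ σ : Equiv.Perm (Fin (a + b)), (Equiv.Perm.sign σ : ℤ) •
      rename (Sum.map σ id)
        (rename (Sum.map (Fin.castAdd b) id) p * rename (Sum.map (Fin.natAdd a) id) r)

/-- The linear map `p ↦ p ∧ r`. -/
noncomputable def wedgeRight {n b : ℕ} (a : ℕ) (r : Poly n b) :
    Poly n a →ₗ[ℂ] Poly n (a + b) where
  toFun p := wedge p r
  map_add' p p' := by
    simp only [wedge, map_add, add_mul, smul_add, Finset.sum_add_distrib]
  map_smul' c p := by
    simp only [wedge, map_smul, smul_mul_assoc, RingHom.id_apply, Finset.smul_sum]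
    exact Finset.sum_congr rfl fun σ _ => by
      rw [smul_comm _ c, smul_comm _ c]

/-- `Θ_ε(X_a) = ∏_j (1 + ε X_a x_j)`, for `ε = ±1`. -/
noncomputable def theta {n ℓ : ℕ} (ε : ℂ) (a : Fin ℓ) : Poly n ℓ :=
  ∏ j : Fin n, (1 + C ε * X (Sum.inl a) * X (Sum.inr j))

/-- `2 Ξ_1(X) = Θ_+(X) + (-1)^{n-1} Θ_-(X)`; the exponent is written `n + 1`, of the same parity. -/
noncomputable def Xi1 (n : ℕ) : Poly n 1 :=
  C (1 / 2) * (theta 1 0 + (-1) ^ (n + 1) * theta (-1) 0)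

theorem theta_divisible (n : ℕ) :
    (X (Sum.inl 0) + X (Sum.inl 1) : Poly n 2) ∣
      theta 1 0 * theta 1 1 - theta (-1) 0 * theta (-1) 1 := by
  let T : Polynomial (Poly n 2) :=
    ∏ j : Fin n, (1 + Polynomial.X * Polynomial.C (X (Sum.inr j)))
  have h1 : ∀ a : Fin 2, (theta 1 a : Poly n 2) = T.eval (X (Sum.inl a)) := fun a => by
    simp only [theta, T, Polynomial.eval_prod]
    exact Finset.prod_congr rfl fun j _ => by simp; ring
  have h2 : ∀ a : Fin 2, (theta (-1) a : Poly n 2) = T.eval (-X (Sum.inl a)) := fun a => by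
    simp only [theta, T, Polynomial.eval_prod]
    exact Finset.prod_congr rfl fun j _ => by simp; ring
  rw [h1, h1, h2, h2]
  have e1 := Polynomial.sub_dvd_eval_sub (X (Sum.inl 1) : Poly n 2) (-X (Sum.inl 0)) T
  have e2 := Polynomial.sub_dvd_eval_sub (X (Sum.inl 0) : Poly n 2) (-X (Sum.inl 1)) T
  rw [sub_neg_eq_add, add_comm] at e1
  rw [sub_neg_eq_add] at e2
  have := dvd_add (Dvd.dvd.mul_left e1 (T.eval (X (Sum.inl 0))))
    (Dvd.dvd.mul_left e2 (T.eval (-X (Sum.inl 0))))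
  convert this using 1
  ring

/-- The polynomial `(Θ_+(X_1) Θ_+(X_2) - Θ_-(X_1) Θ_-(X_2)) / (X_1 + X_2)`. -/
noncomputable def thetaQuotient (n : ℕ) : Poly n 2 := (theta_divisible n).choose

theorem thetaQuotient_spec (n : ℕ) :
    (X (Sum.inl 0) + X (Sum.inl 1)) * thetaQuotient n =
      theta 1 0 * theta 1 1 - theta (-1) 0 * theta (-1) 1 :=
  (theta_divisible n).choose_spec.symm

/-- `2 Ξ_2(X_1, X_2) = (Θ_+(X_1) Θ_+(X_2) - Θ_-(X_1) Θ_-(X_2)) (X_1 - X_2) / (X_1 + X_2)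
+ (-1)^n (Θ_+(X_1) Θ_-(X_2) - Θ_+(X_2) Θ_-(X_1))`. -/
noncomputable def Xi2 (n : ℕ) : Poly n 2 :=
  C (1 / 2) * (thetaQuotient n * (X (Sum.inl 0) - X (Sum.inl 1)) +
    (-1) ^ n * (theta 1 0 * theta (-1) 1 - theta 1 1 * theta (-1) 0))

/-- The space `U_{n,ℓ-1} ∧ Ξ_1 + U_{n,ℓ-2} ∧ Ξ_2`, where `U_{n,ℓ} = 0` for `ℓ < 0`. -/
noncomputable def trivialPart (n : ℕ) : (ℓ : ℕ) → Submodule ℂ (Poly n ℓ)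
  | 0 => ⊥
  | 1 => (U n 0).map (wedgeRight 0 (Xi1 n))
  | ℓ + 2 => (U n (ℓ + 1)).map (wedgeRight (ℓ + 1) (Xi1 n)) ⊔
      (U n ℓ).map (wedgeRight ℓ (Xi2 n))

/-- `M_{n,ℓ} = U_{n,ℓ} / (U_{n,ℓ-1} ∧ Ξ_1 + U_{n,ℓ-2} ∧ Ξ_2)`. The denominator lies in `U_{n,ℓ}`,
since exterior products of solutions are solutions; `submoduleOf` regards it as a subspace. -/
abbrev M (n ℓ : ℕ) : Type := ↥(U n ℓ) ⧸ (trivialPart n ℓ).submoduleOf (U n ℓ)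

/-- The weights of the variables for the degree `deg₁`: `deg₁ X_a = -1` and `deg₁ x_j = 1`. -/
def deg1 {n ℓ : ℕ} : Fin ℓ ⊕ Fin n → ℚ := Sum.elim (fun _ => -1) (fun _ => 1)

/-- The subspace of `M_{n,ℓ}` of degree `k` for `deg₂ = n² / 4 + deg₁`. -/
noncomputable def gradedPiece (n ℓ : ℕ) (k : ℚ) : Submodule ℂ (M n ℓ) :=
  ((weightedHomogeneousSubmodule ℂ deg1 (k - (n : ℚ) ^ 2 / 4)).comap (U n ℓ).subtype).map
    ((trivialPart n ℓ).submoduleOf (U n ℓ)).mkQ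

/-- The pairs `(n, ℓ)` with `n ≡ i mod 2` and `n - 2ℓ = lam`. -/
abbrev Index (i lam : ℕ) : Type :=
  {p : ℕ × ℕ // p.1 ≡ i [MOD 2] ∧ (p.1 : ℤ) - 2 * p.2 = lam}

/-- `M^{(i)}_λ`, the direct sum of `M_{n,ℓ}` over `n ≡ i mod 2`, `n - 2ℓ = λ`. -/
abbrev MTotal (i lam : ℕ) : Type := DirectSum (Index i lam) fun p => M p.1.1 p.1.2

/-- The subspace of `M^{(i)}_λ` of degree `k` for `deg₂`. -/
noncomputable def totalPiece (i lam : ℕ) (k : ℚ) : Submodule ℂ (MTotal i lam) :=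
  ⨅ p : Index i lam, (gradedPiece p.1.1 p.1.2 k).comap
    (DirectSum.component ℂ (Index i lam) (fun p => M p.1.1 p.1.2) p)

/-- The character `∑_k q^k dim W(k)` of a vector space graded by `k ∈ {0, 1/4, 2/4, …}`, as a
formal power series in the variable `q^{1/4}`. -/
noncomputable def ch {V : Type*} [AddCommMonoid V] [Module ℂ V] (W : ℚ → Submodule ℂ V) :
    PowerSeries ℚ :=
  PowerSeries.mk fun m => (Module.finrank ℂ (W ((m : ℚ) / 4)) : ℚ)

/-- `f` is the sum of the family `F` of formal power series: each coefficient is nonzero in only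
finitely many members of the family, and the coefficients add up to the one of `f`. -/
def IsFormalSum {ι R : Type*} [Semiring R] (F : ι → PowerSeries R) (f : PowerSeries R) : Prop :=
  ∀ m : ℕ, {s | PowerSeries.coeff m (F s) ≠ 0}.Finite ∧
    PowerSeries.coeff m f = ∑ᶠ s, PowerSeries.coeff m (F s)

/-- `q`, as the fourth power of the variable `q^{1/4}`. -/
noncomputable def q : PowerSeries ℚ := PowerSeries.X ^ 4

/-- `q^{n²/4}`. -/
noncomputable def qSquare (n : ℕ) : PowerSeries ℚ := PowerSeries.X ^ n ^ 2

/-- `(q)_n = ∏_{j=1}^n (1 - q^j)`. -/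
noncomputable def qPoch (n : ℕ) : PowerSeries ℚ := ∏ j ∈ Finset.Icc 1 n, (1 - q ^ j)

/-- The `q`-binomial coefficient `(q)_n / ((q)_k (q)_{n-k})`, which is zero unless `0 ≤ k ≤ n`. -/
noncomputable def qBinom (n : ℕ) (k : ℤ) : PowerSeries ℚ :=
  if 0 ≤ k ∧ k ≤ n then qPoch n * (qPoch k.toNat * qPoch (n - k.toNat))⁻¹ else 0

/-- The character of the irreducible representation of `sl₂` of dimension `lam + 1`, as a Laurent
polynomial in `z`. -/
noncomputable def chi (lam : ℕ) : LaurentPolynomial ℚ :=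
  ∑ j ∈ Finset.range (lam + 1), LaurentPolynomial.T ((lam : ℤ) - 2 * j)

/-- `chi lam = (z^{lam+1} - z^{-(lam+1)}) / (z - z^{-1})`. -/
theorem chi_mul (lam : ℕ) :
    chi lam * (LaurentPolynomial.T 1 - LaurentPolynomial.T (-1)) =
      LaurentPolynomial.T ((lam : ℤ) + 1) - LaurentPolynomial.T (-((lam : ℤ) + 1)) := by
  have h : ∀ N : ℕ, (∑ j ∈ Finset.range N,
      (LaurentPolynomial.T ((lam : ℤ) - 2 * j) : LaurentPolynomial ℚ)) *
        (LaurentPolynomial.T 1 - LaurentPolynomial.T (-1)) =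
      LaurentPolynomial.T ((lam : ℤ) + 1) - LaurentPolynomial.T ((lam : ℤ) + 1 - 2 * N) := by
    intro N
    induction N with
    | zero => simp
    | succ N ih =>
      rw [Finset.sum_range_succ, add_mul, ih, mul_sub, ← LaurentPolynomial.T_add,
        ← LaurentPolynomial.T_add]
      have e1 : (lam : ℤ) - 2 * N + 1 = lam + 1 - 2 * N := by ring
      have e2 : (lam : ℤ) - 2 * N + -1 = lam + 1 - 2 * (N + 1 : ℕ) := by push_cast; ring
      rw [e1, e2]
      ring
  rw [chi, h]
  congr 2
  push_cast
  ring

/-- The product of a Laurent polynomial in `z` and a power series in `q^{1/4}`. -/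
noncomputable def zq (a : LaurentPolynomial ℚ) (f : PowerSeries ℚ) :
    PowerSeries (LaurentPolynomial ℚ) :=
  PowerSeries.C a * PowerSeries.map LaurentPolynomial.C f

end QKZ

open QKZ

set_option linter.unusedSectionVars false
set_option linter.unusedSimpArgs false

namespace QKZ

/-! ### Fermionic creation and annihilation operators on functions of finite subsets. -/

section Fock

variable {L ι : Type*} [Field L] [DecidableEq ι]

/-! An element P of the exterior power has degree less than n in each X_a, so it is determined by
its values at X_a = -1/x_{s(a)}, where s runs through the injections of {1,…,ℓ} into {1,…,n}
(`eq_zero_of_evalPoint`). If P lies in U_{n,ℓ}, such a value is, after clearing denominators,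
divisible by the differences x_{s(a)} - x_{s(b)} (anti-symmetry) and by the sums x_{s(a)} + x_j
(null residue). Hence it is `baseValue s` times a polynomial g_I depending only on the image I of s.
Conversely, Lagrange interpolation turns every S_n-equivariant family (g_I) with |I| = ℓ into a
solution: the apparent poles along x_i = x_j are simple and cancel by symmetry. Since `baseValue` is
homogeneous of degree 0, this identifies U_{n,ℓ} with the sum over d of the spaces E_ℓ = `EqFam n ℓ
d`, with deg₁ corresponding to d (`exists_hasValues`, `exists_homogeneous`). Such a family amounts
to one polynomial symmetric under S_ℓ × S_{n-ℓ}, whence the Hilbert series 1/((q)_ℓ (q)_{n-ℓ})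
(`eqDim_succ`, `dimSeries_mul`).

On families, the exterior products with Ξ_1 and Ξ_2 become, up to nonzero constants, the operators ψ
= `crVec y 1` and Q = `crPair y` (`exists_wedge_single`, `exists_wedge_pair`). Both are built from
the operators `cr`, which together with `an` satisfy the Clifford relations. In particular ψ² = 0
and Q commutes with ψ. What remains is the rank of E_{ℓ-1} ⊕ E_{ℓ-2} → E_ℓ, (v, u) ↦ ψv + Qu, for 2ℓ
≤ n and in each degree d. Two facts give it:

(1) The complex (E, ψ) is exact except at the top place ℓ = n (`exactCr`). For odd n there is a
contracting homotopy, because a Lagrange interpolation identity evaluates the relevant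
anticommutator to 1. For even n that number is 0. There one compares ψ with the creation operator of
the vector (x_i): setting one variable equal to zero relates the two complexes to each other and to
those for n - 1, and an induction on n and on the degree applies.

(2) If u ∈ E_{ℓ-2} and ψQu = 0, then ψu = 0. This is a Lefschetz type property
(`crVec_eq_zero_of_crPair_pow`), reduced by annihilation operators to the fact that ψQ^M does not
kill the vacuum when 2M + 1 ≤ n.

By (2) and (1), the kernel of (v, u) ↦ ψv + Qu projects onto ker ψ in E_{ℓ-2}, and the kernel of
this projection is ker ψ in E_{ℓ-1}. By (1) these two dimensions add up to dim E_{ℓ-2}, so the rank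
is dim E_{ℓ-1} (`range_coprod_finrank`). Thus M_{n,ℓ} has dimension dim E_ℓ - dim E_{ℓ-1} in each
degree, which is the first character formula. The second follows by summation by parts, using the
symmetry ℓ ↔ n - ℓ (`sum_chi_mul_sub`). -/

/-- The factor `∏_{b ∈ I} (y_a + y_b) / (y_a - y_b)`. -/
def wt (y : ι → L) (a : ι) (I : Finset ι) : L := ∏ b ∈ I, (y a + y b) / (y a - y b)

theorem wt_insert (y : ι → L) {a b : ι} {I : Finset ι} (h : b ∉ I) :
    wt y a (insert b I) = (y a + y b) / (y a - y b) * wt y a I := Finset.prod_insert h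

theorem wt_erase (y : ι → L) {a b : ι} {I : Finset ι} (h : b ∈ I) :
    wt y a I = (y a + y b) / (y a - y b) * wt y a (I.erase b) :=
  (Finset.mul_prod_erase _ _ h).symm

/-- Creation operators on functions of finite subsets. -/
def cr (y : ι → L) (a : ι) : Module.End L (Finset ι → L) where
  toFun g I := if a ∈ I then wt y a (I.erase a) * g (I.erase a) else 0
  map_add' f g := by ext I; by_cases h : a ∈ I <;> simp [h, mul_add]
  map_smul' c g := by ext I; by_cases h : a ∈ I <;> simp [h, mul_left_comm]

/-- Annihilation operators on functions of finite subsets. -/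
def an (y : ι → L) (a : ι) : Module.End L (Finset ι → L) where
  toFun g I := if a ∈ I then 0 else (wt y a I)⁻¹ * g (insert a I)
  map_add' f g := by ext I; by_cases h : a ∈ I <;> simp [h, mul_add]
  map_smul' c g := by ext I; by_cases h : a ∈ I <;> simp [h, mul_left_comm]

theorem cr_apply (y : ι → L) (a : ι) (g : Finset ι → L) (I : Finset ι) :
    cr y a g I = if a ∈ I then wt y a (I.erase a) * g (I.erase a) else 0 := rfl

theorem an_apply (y : ι → L) (a : ι) (g : Finset ι → L) (I : Finset ι) :
    an y a g I = if a ∈ I then 0 else (wt y a I)⁻¹ * g (insert a I) := rfl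

/-- The points `y_a` are distinct and no two of them add up to zero. -/
structure Generic (y : ι → L) : Prop where
  sub_ne : ∀ a b, a ≠ b → y a - y b ≠ 0
  add_ne : ∀ a b, a ≠ b → y a + y b ≠ 0

theorem Generic.wt_ne {y : ι → L} (hy : Generic y) {a : ι} {I : Finset ι} (h : a ∉ I) :
    wt y a I ≠ 0 := by
  refine Finset.prod_ne_zero_iff.2 fun b hb => ?_
  have : a ≠ b := fun e => h (e ▸ hb)
  exact div_ne_zero (hy.add_ne _ _ this) (hy.sub_ne _ _ this)

theorem cr_mul_self (y : ι → L) (a : ι) : cr y a * cr y a = 0 := by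
  ext g I
  simp [cr_apply]

theorem an_mul_self (y : ι → L) (a : ι) : an y a * an y a = 0 := by
  ext g I
  simp [an_apply]

/-- The two orders of creation give weights that differ only in the factor of the pair {a, b}, and
(y_a + y_b)/(y_a - y_b) is odd under exchange of a and b. -/
theorem cr_mul_cr (y : ι → L) (a b : ι) : cr y a * cr y b + cr y b * cr y a = 0 := by
  rcases eq_or_ne a b with rfl | hab
  · simp [cr_mul_self]
  ext g I
  simp only [Module.End.mul_apply, cr_apply, LinearMap.add_apply, Pi.add_apply, Finset.mem_erase,
    LinearMap.zero_apply, Pi.zero_apply]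
  by_cases ha : a ∈ I <;> by_cases hb : b ∈ I <;> simp only [ha, hb, hab, hab.symm, ne_eq,
    not_false_eq_true, and_self, if_true, if_false, mul_zero, add_zero, and_false, true_and]
  rw [wt_erase y (a := a) (b := b) (I := I.erase a) (by simp [hb, hab.symm]),
    wt_erase y (a := b) (b := a) (I := I.erase b) (by simp [ha, hab]),
    Finset.erase_right_comm, add_comm (y b), ← neg_sub (y a) (y b), div_neg]
  ring

/-- The inverse weight in `an` makes it undo `cr` for equal indices. For a ≠ b the two orders differ
by the quotient of the pair factor by its transpose, which is -1. -/
theorem an_mul_cr {y : ι → L} (hy : Generic y) (a b : ι) :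
    an y a * cr y b + cr y b * an y a = if a = b then 1 else 0 := by
  ext g I
  rcases eq_or_ne a b with rfl | hab
  · simp only [LinearMap.add_apply, Module.End.mul_apply, Pi.add_apply, cr_apply, an_apply]
    by_cases ha : a ∈ I
    · have := hy.wt_ne (Finset.notMem_erase a I)
      simp [ha, Finset.insert_erase ha, mul_inv_cancel_left₀ this]
    · have := hy.wt_ne ha
      simp [ha, Finset.erase_insert ha, inv_mul_cancel_left₀ this]
  · simp only [LinearMap.add_apply, Module.End.mul_apply, Pi.add_apply, cr_apply, an_apply,
      if_neg hab, LinearMap.zero_apply, Pi.zero_apply, Finset.mem_insert, Finset.mem_erase]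
    by_cases ha : a ∈ I
    · simp [ha, hab]
    by_cases hb : b ∈ I
    · have h1 : (insert a I).erase b = insert a (I.erase b) :=
        Finset.erase_insert_of_ne hab
      simp only [ha, hb, if_false, or_true, if_true, and_false, h1]
      rw [wt_insert y (a := b) (b := a) (by simp [ha]), wt_erase y (a := a) hb]
      have n1 := hy.wt_ne (a := a) (I := I.erase b) (by simp [ha])
      have n2 := hy.sub_ne _ _ hab
      have n3 := hy.add_ne _ _ hab
      have n4 := hy.sub_ne _ _ hab.symm
      rw [add_comm (y b) (y a), ← neg_sub (y a) (y b)]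
      field_simp
      ring
    · simp [hb, hab.symm]

end Fock

/-! ### The operators ψ and Q, the Lefschetz property, and the contraction. -/

section FockSums

variable {L ι : Type*} [Field L] [CharZero L] [DecidableEq ι] [Fintype ι]

/-- The creation operator `∑_a ξ_a cr_a` of a vector `ξ`. -/
def crVec (y ξ : ι → L) : Module.End L (Finset ι → L) := ∑ a, ξ a • cr y a

/-- The creation operator of pairs. -/
def crPair (y : ι → L) : Module.End L (Finset ι → L) :=
  (1 / 2 : L) • ∑ a, ∑ b, ((y a - y b) / (y a + y b)) • (cr y a * cr y b)

theorem crVec_apply (y ξ : ι → L) (g : Finset ι → L) (I : Finset ι) :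
    crVec y ξ g I = ∑ a ∈ I, ξ a * wt y a (I.erase a) * g (I.erase a) := by
  simp only [crVec, LinearMap.sum_apply, LinearMap.smul_apply, Finset.sum_apply, Pi.smul_apply,
    cr_apply, smul_eq_mul, mul_ite, mul_zero, mul_assoc]
  rw [← Finset.sum_filter]
  simp

theorem crVec_mul_crVec (y ξ η : ι → L) :
    crVec y ξ * crVec y η + crVec y η * crVec y ξ = 0 := by
  simp only [crVec, Finset.sum_mul_sum, smul_mul_assoc, mul_smul_comm]
  rw [Finset.sum_comm, ← Finset.sum_add_distrib]
  refine Finset.sum_eq_zero fun a _ => ?_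
  rw [← Finset.sum_add_distrib]
  refine Finset.sum_eq_zero fun b _ => ?_
  rw [smul_comm (ξ b), ← smul_add, ← smul_add, cr_mul_cr, smul_zero, smul_zero]

theorem crVec_mul_self (y ξ : ι → L) : crVec y ξ * crVec y ξ = 0 := by
  have h := crVec_mul_crVec y ξ ξ
  rw [← two_smul L] at h
  exact (smul_eq_zero.1 h).resolve_left two_ne_zero

theorem an_mul_crVec {y : ι → L} (hy : Generic y) (i : ι) (ξ : ι → L) :
    an y i * crVec y ξ + crVec y ξ * an y i = ξ i • 1 := by
  simp only [crVec, Finset.mul_sum, Finset.sum_mul, ← Finset.sum_add_distrib, mul_smul_comm,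
    smul_mul_assoc, ← smul_add, an_mul_cr hy]
  simp

/-- A product of two creation operators is even: moving it past a third one changes the sign twice.
-/
theorem cr_mul_cr_mul_crVec (y ξ : ι → L) (a b : ι) :
    cr y a * cr y b * crVec y ξ = crVec y ξ * (cr y a * cr y b) := by
  simp only [crVec, Finset.mul_sum, Finset.sum_mul, mul_smul_comm, smul_mul_assoc]
  refine Finset.sum_congr rfl fun c _ => ?_
  have h1 := congrArg (cr y a * ·) (cr_mul_cr y b c)
  have h2 := congrArg (· * cr y b) (cr_mul_cr y a c)
  simp only [mul_add, add_mul, mul_zero, zero_mul, ← mul_assoc] at h1 h2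
  rw [add_comm] at h2
  rw [← mul_assoc, add_right_cancel (h1.trans h2.symm)]

theorem crPair_mul_crVec (y ξ : ι → L) :
    crPair y * crVec y ξ = crVec y ξ * crPair y := by
  simp only [crPair, smul_mul_assoc, mul_smul_comm, Finset.sum_mul, Finset.mul_sum,
    cr_mul_cr_mul_crVec]

/-- The pair operator is quadratic, so its commutator with an annihilation operator is linear. The
coefficient (y_a - y_b)/(y_a + y_b) is odd, hence both contractions contribute equally and absorb
the factor 1/2. -/
theorem an_mul_crPair {y : ι → L} (hy : Generic y) (i : ι) :
    an y i * crPair y = crPair y * an y i + crVec y fun b => (y i - y b) / (y i + y b) := by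
  have key : ∀ a b, an y i * (cr y a * cr y b) =
      cr y a * cr y b * an y i + ((if i = a then cr y b else 0) - if i = b then cr y a else 0) := by
    intro a b
    have h1 := an_mul_cr hy i a
    have h2 := an_mul_cr hy i b
    rw [← eq_sub_iff_add_eq] at h1 h2
    rw [← mul_assoc, h1, sub_mul, mul_assoc (cr y a), h2, mul_sub, mul_assoc]
    split_ifs <;> simp <;> abel
  simp only [crPair, mul_smul_comm, smul_mul_assoc, Finset.mul_sum, Finset.sum_mul, key,
    smul_add, Finset.sum_add_distrib]
  congr 1
  have : (∑ a, ∑ b, ((y a - y b) / (y a + y b)) •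
      ((if i = a then cr y b else 0) - if i = b then cr y a else 0)) =
      (2 : L) • crVec y fun b => (y i - y b) / (y i + y b) := by
    simp only [smul_sub, Finset.sum_sub_distrib, smul_ite, smul_zero]
    rw [Finset.sum_comm]
    simp only [Finset.sum_ite_eq, Finset.mem_univ, if_true, crVec, two_smul, sub_eq_add_neg,
      ← Finset.sum_neg_distrib]
    congr 1
    refine Finset.sum_congr rfl fun a _ => ?_
    rw [← neg_smul, ← neg_div, neg_add, neg_neg, add_comm (y a) (y i), add_comm (-y a)]
  rw [this, smul_smul]
  norm_num

theorem commute_crPair_crVec (y ξ : ι → L) : Commute (crPair y) (crVec y ξ) :=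
  crPair_mul_crVec y ξ

theorem an_mul_crPair_pow {y : ι → L} (hy : Generic y) (i : ι) (r : ℕ) :
    an y i * crPair y ^ (r + 1) = crPair y ^ (r + 1) * an y i +
      ((r + 1 : ℕ) : L) • (crVec y (fun b => (y i - y b) / (y i + y b)) * crPair y ^ r) := by
  induction r with
  | zero => simp [an_mul_crPair hy]
  | succ r ih =>
    have h := (commute_crPair_crVec y fun b => (y i - y b) / (y i + y b)).pow_left (r + 1)
    rw [pow_succ (crPair y) (r + 1), ← mul_assoc, ih, add_mul, mul_assoc _ (an y i),
      an_mul_crPair hy, mul_add, ← mul_assoc, add_assoc, h.eq, smul_mul_assoc, mul_assoc _ _ (crPair y),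
      ← pow_succ, ← pow_succ, Nat.cast_succ (r + 1), add_smul, one_smul, add_comm (_ • _)]

/-- If ψQ^r u = 0, then ψQ^{r+1}(an_i u) = Q^{r+1} u, whatever i is: the correction from commuting
an_i past Q^{r+1} contains ψ applied to another creation operator times Q^r u, and anticommuting the
two produces ψQ^r u = 0. -/
theorem crVec_crPair_pow_an {y : ι → L} (hy : Generic y) (i j : ι) (r : ℕ) (u : Finset ι → L)
    (hu : crVec y 1 ((crPair y ^ r) u) = 0) :
    crVec y 1 ((crPair y ^ (r + 1)) (an y i u - an y j u)) = 0 := by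
  have key : ∀ i, crVec y 1 ((crPair y ^ (r + 1)) (an y i u)) = (crPair y ^ (r + 1)) u := by
    intro i
    have h1 := an_mul_crVec hy i (1 : ι → L)
    have h2 := an_mul_crPair_pow hy i r
    have h3 := crVec_mul_crVec y 1 fun b => (y i - y b) / (y i + y b)
    have h4 := (commute_crPair_crVec y 1).pow_left (r + 1)
    have hu' : crVec y 1 ((crPair y ^ (r + 1)) u) = 0 := by
      rw [pow_succ', Module.End.mul_apply, ← Module.End.mul_apply, ← crPair_mul_crVec,
        Module.End.mul_apply, hu, map_zero]
    have e1 := congrArg (fun f => f ((crPair y ^ (r + 1)) u)) h1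
    simp only [LinearMap.add_apply, Module.End.mul_apply, hu', map_zero, zero_add,
      Pi.one_apply, one_smul, Module.End.one_apply] at e1
    have e2 := congrArg (fun f => f u) h2
    simp only [LinearMap.add_apply, Module.End.mul_apply, LinearMap.smul_apply] at e2
    have e3 := congrArg (fun f => f ((crPair y ^ r) u)) h3
    simp only [LinearMap.add_apply, Module.End.mul_apply, LinearMap.zero_apply, hu, map_zero,
      add_zero] at e3
    rw [e2, map_add, map_smul, e3, smul_zero, add_zero] at e1
    exact e1
  rw [map_sub, map_sub, key, key, sub_self]

/-- The functions supported on the subsets with `k` elements. -/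
def cardSupp (L ι : Type*) [Field L] (k : ℕ) : Submodule L (Finset ι → L) where
  carrier := {g | ∀ I, I.card ≠ k → g I = 0}
  zero_mem' _ _ := rfl
  add_mem' h h' I hI := by simp [h I hI, h' I hI]
  smul_mem' c _ h I hI := by simp [h I hI]

theorem mem_cardSupp {k : ℕ} {g : Finset ι → L} :
    g ∈ cardSupp L ι k ↔ ∀ I, I.card ≠ k → g I = 0 := Iff.rfl

theorem an_mem_cardSupp (y : ι → L) (i : ι) {k : ℕ} {g : Finset ι → L}
    (h : g ∈ cardSupp L ι (k + 1)) : an y i g ∈ cardSupp L ι k := by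
  intro I hI
  rw [an_apply]
  split_ifs with hi
  · rfl
  · rw [h _ (by rw [Finset.card_insert_of_notMem hi]; omega), mul_zero]

theorem crVec_mem_cardSupp (y ξ : ι → L) {k : ℕ} {g : Finset ι → L}
    (h : g ∈ cardSupp L ι k) : crVec y ξ g ∈ cardSupp L ι (k + 1) := by
  intro I hI
  rw [crVec_apply]
  refine Finset.sum_eq_zero fun a ha => ?_
  rw [h _ (by rw [Finset.card_erase_of_mem ha]; have := Finset.card_pos.2 ⟨a, ha⟩; omega), mul_zero]

theorem eq_zero_of_an_eq_zero {y : ι → L} (hy : Generic y) {k : ℕ} {g : Finset ι → L}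
    (h : g ∈ cardSupp L ι (k + 1)) (h' : ∀ i, an y i g = 0) : g = 0 := by
  ext I
  by_cases hI : I.card = k + 1
  · obtain ⟨i, hi⟩ : I.Nonempty := Finset.card_pos.1 (by omega)
    have := congrFun (h' i) (I.erase i)
    rw [an_apply, if_neg (Finset.notMem_erase _ _), Finset.insert_erase hi] at this
    exact (mul_eq_zero.1 this).resolve_left (inv_ne_zero (hy.wt_ne (Finset.notMem_erase _ _)))
  · exact h I hI

/-- If an_i g does not depend on i, then an_j an_i g = an_j an_j g = 0. As g is supported on sets
with at least two elements, two annihilations detect it. -/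
theorem eq_zero_of_an_eq {y : ι → L} (hy : Generic y) {k : ℕ} {g : Finset ι → L}
    (h : g ∈ cardSupp L ι (k + 2)) (h' : ∀ i j, an y i g = an y j g) : g = 0 := by
  refine eq_zero_of_an_eq_zero hy h fun i => eq_zero_of_an_eq_zero hy (an_mem_cardSupp y i h)
    fun j => ?_
  rw [h' i j, ← Module.End.mul_apply, an_mul_self, LinearMap.zero_apply]

/-- The function which is one on the subsets with `k` elements. -/
def oneOn (L ι : Type*) [Field L] (k : ℕ) : Finset ι → L := fun I => if I.card = k then 1 else 0

/-- A Lefschetz property of the pair creation operator modulo `crVec y 1`. -/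
theorem crVec_eq_zero_of_crPair_pow {y : ι → L} (hy : Generic y) {M : ℕ}
    (hM : crVec y 1 ((crPair y ^ M) (oneOn L ι 0)) ≠ 0) (k r : ℕ) (hkr : k + r = M)
    (u : Finset ι → L) (hu : u ∈ cardSupp L ι k) (h : crVec y 1 ((crPair y ^ r) u) = 0) :
    crVec y 1 u = 0 := by
  induction k generalizing r u with
  | zero =>
    -- In particle number 0 everything is a multiple of the vacuum, which is covered by `hM`.
    have e : u = u ∅ • oneOn L ι 0 := by
      ext I
      by_cases hI : I = ∅
      · simp [hI, oneOn]
      · have : I.card ≠ 0 := by simpa using hI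
        simp [hu I this, oneOn, hI]
    rw [zero_add] at hkr
    rw [e, map_smul, map_smul, hkr, smul_eq_zero] at h
    rw [e, h.resolve_right hM, zero_smul, map_zero]
  | succ k ih =>
    -- It suffices that an_i ψu = u - ψ(an_i u) does not depend on i. The induction hypothesis, with
    -- r + 1 in place of r, is applied to an_i u - an_j u.
    refine eq_zero_of_an_eq hy (crVec_mem_cardSupp y 1 hu) fun i j => ?_
    have h0 := ih (r + 1) (by omega) (an y i u - an y j u)
      (sub_mem (an_mem_cardSupp y i hu) (an_mem_cardSupp y j hu)) (crVec_crPair_pow_an hy i j r u h)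
    have key : ∀ i, an y i (crVec y 1 u) = u - crVec y 1 (an y i u) := fun i => by
      have := congrArg (fun f => f u) (an_mul_crVec hy i (1 : ι → L))
      simp only [LinearMap.add_apply, Module.End.mul_apply, Pi.one_apply, one_smul,
        Module.End.one_apply] at this
      exact eq_sub_of_add_eq this
    rw [map_sub, sub_eq_zero] at h0
    rw [key, key, h0]

theorem crPair_apply (y : ι → L) (g : Finset ι → L) (I : Finset ι) :
    crPair y g I = 1 / 2 * ∑ a ∈ I, ∑ b ∈ I.erase a, (y a - y b) / (y a + y b) *
      (wt y a (I.erase a) * wt y b ((I.erase a).erase b)) * g ((I.erase a).erase b) := by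
  simp only [crPair, LinearMap.sum_apply, LinearMap.smul_apply, Finset.sum_apply, Pi.smul_apply,
    Module.End.mul_apply, cr_apply, smul_eq_mul, mul_ite, mul_zero]
  congr 1
  rw [← Finset.sum_filter_add_sum_filter_not Finset.univ (· ∈ I), Finset.filter_univ_mem]
  rw [Finset.sum_eq_zero (s := Finset.filter (fun x => x ∉ I) Finset.univ), add_zero]
  · refine Finset.sum_congr rfl fun a ha => ?_
    simp only [ha, if_true]
    rw [← Finset.sum_filter, Finset.filter_univ_mem]
    exact Finset.sum_congr rfl fun b _ => by ring
  · intro a ha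
    simp [(Finset.mem_filter.1 ha).2]

/-- The value at zero of the Lagrange interpolation of `∏ (X + y_b) - ∏ (X - y_b)`. -/
theorem sum_wt_erase {y : ι → L} (I : Finset ι) (hy : ∀ a ∈ I, ∀ b ∈ I, a ≠ b → y a ≠ y b)
    (h0 : ∀ a ∈ I, y a ≠ 0) :
    ∑ a ∈ I, wt y a (I.erase a) = if Odd I.card then 1 else 0 := by
  classical
  let p : Polynomial L := ∏ b ∈ I, (Polynomial.X + Polynomial.C (y b)) -
    ∏ b ∈ I, (Polynomial.X - Polynomial.C (y b))
  have hinj : Set.InjOn y I := fun a ha b hb h => by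
    by_contra hab
    exact hy a ha b hb hab h
  have hdeg : p.degree < I.card := by
    rcases I.eq_empty_or_nonempty with rfl | hne
    · simp [p]
    have m1 : (∏ b ∈ I, (Polynomial.X + Polynomial.C (y b))).Monic :=
      Polynomial.monic_prod_of_monic _ _ fun b _ => Polynomial.monic_X_add_C _
    have m2 : (∏ b ∈ I, (Polynomial.X - Polynomial.C (y b))).Monic :=
      Polynomial.monic_prod_of_monic _ _ fun b _ => Polynomial.monic_X_sub_C _
    have d1 : (∏ b ∈ I, (Polynomial.X + Polynomial.C (y b))).degree = (I.card : WithBot ℕ) := by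
      rw [Polynomial.degree_prod]; simp
    have d2 : (∏ b ∈ I, (Polynomial.X - Polynomial.C (y b))).degree = (I.card : WithBot ℕ) := by
      rw [Polynomial.degree_prod]; simp
    -- Both products are monic of degree |I|, so their leading terms cancel and |I| nodes determine
    -- p.
    calc p.degree < (∏ b ∈ I, (Polynomial.X + Polynomial.C (y b))).degree :=
          Polynomial.degree_sub_lt_left (d1.trans d2.symm) m1.ne_zero (by rw [m1, m2])
      _ = I.card := d1
  have hL := Lagrange.eq_interpolate hinj hdeg
  have e0 := congrArg (Polynomial.eval 0) hL
  rw [Lagrange.interpolate_apply, Polynomial.eval_finsetSum] at e0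
  have hP : ∏ b ∈ I, y b ≠ 0 := Finset.prod_ne_zero_iff.2 h0
  have lhs : p.eval 0 = (1 - (-1) ^ I.card) * ∏ b ∈ I, y b := by
    simp only [p, Polynomial.eval_sub, Polynomial.eval_prod, Polynomial.eval_add,
      Polynomial.eval_X, Polynomial.eval_C, zero_add, zero_sub]
    rw [Finset.prod_neg]
    ring
  -- At a node y_a the second product vanishes and the first contains the factor 2 y_a.
  have rhs : ∀ a ∈ I, ((Polynomial.C (p.eval (y a)) * Lagrange.basis I y a).eval 0) =
      2 * (-1) ^ (I.card - 1) * (∏ b ∈ I, y b) * wt y a (I.erase a) := by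
    intro a ha
    have hpa : p.eval (y a) = 2 * y a * ∏ b ∈ I.erase a, (y a + y b) := by
      simp only [p, Polynomial.eval_sub, Polynomial.eval_prod, Polynomial.eval_add,
        Polynomial.eval_X, Polynomial.eval_C]
      rw [Finset.prod_eq_zero ha (f := fun b => y a - y b) (sub_self _), sub_zero,
        ← Finset.mul_prod_erase _ _ ha]
      ring
    rw [Polynomial.eval_mul, Polynomial.eval_C, hpa, Lagrange.basis, Polynomial.eval_prod]
    have hb : ∀ b ∈ I.erase a, (Lagrange.basisDivisor (y a) (y b)).eval 0 =
        (-1) * y b * (y a - y b)⁻¹ := by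
      intro b _
      simp [Lagrange.basisDivisor]
      ring
    rw [Finset.prod_congr rfl hb, Finset.prod_mul_distrib, Finset.prod_mul_distrib,
      Finset.prod_const, Finset.card_erase_of_mem ha, ← Finset.mul_prod_erase I y ha, wt,
      Finset.prod_div_distrib, Finset.prod_inv_distrib]
    ring
  rw [Finset.sum_congr rfl rhs, ← Finset.mul_sum, lhs] at e0
  have hc : (2 * (-1) ^ (I.card - 1) * ∏ b ∈ I, y b : L) ≠ 0 :=
    mul_ne_zero (mul_ne_zero two_ne_zero (pow_ne_zero _ (neg_ne_zero.2 one_ne_zero))) hP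
  refine mul_left_cancel₀ hc ?_
  rw [← e0]
  rcases Nat.even_or_odd I.card with h | h
  · rw [if_neg (Nat.not_odd_iff_even.2 h), h.neg_one_pow]
    ring
  · rw [if_pos h, h.neg_one_pow, (Nat.Odd.sub_odd h odd_one).neg_one_pow]
    ring

/-- Adjoin -y_a to the points of J. Their number becomes even, so the sum of all weights vanishes by
`sum_wt_erase`. The weight of the new point is (wt y a J)⁻¹, and the weight of b acquires the factor
-(y_a - y_b)/(y_a + y_b). -/
theorem sum_pair_wt {y : ι → L} (hy : Generic y) (h0 : ∀ a, y a ≠ 0) (a : ι) (J : Finset ι)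
    (ha : a ∉ J) (hJ : Odd J.card) :
    ∑ b ∈ J, (y a - y b) / (y a + y b) * wt y b (J.erase b) = (wt y a J)⁻¹ := by
  let y' : Option ι → L := fun o => o.elim (-y a) y
  have hne : ∀ b ∈ J, a ≠ b := fun b hb e => ha (e ▸ hb)
  have h := sum_wt_erase (y := y') (Finset.insertNone J) ?_ ?_
  · rw [Finset.card_insertNone, if_neg (by simpa using hJ.add_one)] at h
    have hins : Finset.insertNone J = insert none (J.map Function.Embedding.some) := by
      ext o; cases o <;> simp
    have hnone : none ∉ J.map Function.Embedding.some := by simp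
    rw [hins, Finset.sum_insert hnone, Finset.erase_insert hnone, Finset.sum_map] at h
    have e1 : wt y' none (J.map Function.Embedding.some) = (wt y a J)⁻¹ := by
      rw [wt, Finset.prod_map, wt, ← Finset.prod_inv_distrib]
      refine Finset.prod_congr rfl fun b hb => ?_
      simp only [y', Function.Embedding.some_apply, Option.elim, inv_div]
      rw [← neg_div_neg_eq]
      congr 1 <;> ring
    have e2 : ∀ b ∈ J, wt y' (Function.Embedding.some b)
        ((insert none (J.map Function.Embedding.some)).erase (Function.Embedding.some b)) =
        - ((y a - y b) / (y a + y b) * wt y b (J.erase b)) := by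
      intro b hb
      have : (insert none (J.map Function.Embedding.some)).erase (Function.Embedding.some b) =
          insert none ((J.erase b).map Function.Embedding.some) := by
        ext o; cases o <;> simp
      rw [this, wt_insert y' (by simp), wt, Finset.prod_map, wt]
      simp only [y', Function.Embedding.some_apply, Option.elim]
      rw [← neg_mul, ← neg_div]
      congr 2 <;> ring
    rw [Finset.sum_congr rfl e2, e1, Finset.sum_neg_distrib, ← sub_eq_add_neg, sub_eq_zero] at h
    exact h.symm
  · rintro (_ | b) hb (_ | c) hc hbc
    · exact absurd rfl hbc
    · have hc' : c ∈ J := by simpa using hc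
      exact fun e => hy.add_ne a c (hne c hc') (by simp only [y', Option.elim] at e; rw [← e]; ring)
    · have hb' : b ∈ J := by simpa using hb
      exact fun e => hy.add_ne a b (hne b hb') (by simp only [y', Option.elim] at e; rw [e]; ring)
    · have : b ≠ c := fun e => hbc (e ▸ rfl)
      exact sub_ne_zero.1 (hy.sub_ne b c this)
  · rintro (_ | b) hb
    · simpa [y'] using h0 a
    · simpa [y'] using h0 b

/-- By `sum_pair_wt` the inner sum over b cancels the weight of a, so each a ∈ I contributes 1. The
factor is therefore half of |I| = 2(M + 1). -/
theorem crPair_oneOn {y : ι → L} (hy : Generic y) (h0 : ∀ a, y a ≠ 0) (M : ℕ) :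
    crPair y (oneOn L ι (2 * M)) = ((M + 1 : ℕ) : L) • oneOn L ι (2 * (M + 1)) := by
  ext I
  rw [crPair_apply, Pi.smul_apply, oneOn, smul_eq_mul]
  by_cases hI : I.card = 2 * (M + 1)
  · have h1 : ∀ a ∈ I, ∑ b ∈ I.erase a, (y a - y b) / (y a + y b) *
        (wt y a (I.erase a) * wt y b ((I.erase a).erase b)) *
          oneOn L ι (2 * M) ((I.erase a).erase b) = 1 := by
      intro a ha
      have hc : (I.erase a).card = 2 * M + 1 := by rw [Finset.card_erase_of_mem ha]; omega
      have h2 : ∀ b ∈ I.erase a, (y a - y b) / (y a + y b) *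
          (wt y a (I.erase a) * wt y b ((I.erase a).erase b)) *
          oneOn L ι (2 * M) ((I.erase a).erase b) = wt y a (I.erase a) *
            ((y a - y b) / (y a + y b) * wt y b ((I.erase a).erase b)) := by
        intro b hb
        rw [oneOn, if_pos (by rw [Finset.card_erase_of_mem hb]; omega)]
        ring
      rw [Finset.sum_congr rfl h2, ← Finset.mul_sum,
        sum_pair_wt hy h0 a _ (Finset.notMem_erase a I) (by rw [hc]; exact ⟨M, rfl⟩),
        mul_inv_cancel₀ (hy.wt_ne (Finset.notMem_erase a I))]
    rw [Finset.sum_congr rfl h1, Finset.sum_const, hI, if_pos rfl, nsmul_eq_mul]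
    push_cast
    ring
  · rw [if_neg hI, mul_zero, Finset.sum_eq_zero, mul_zero]
    refine fun a ha => Finset.sum_eq_zero fun b hb => ?_
    rw [oneOn, if_neg, mul_zero]
    rw [Finset.card_erase_of_mem hb, Finset.card_erase_of_mem ha]
    have h1 := Finset.card_pos.2 ⟨b, hb⟩
    rw [Finset.card_erase_of_mem ha] at h1
    omega

theorem crPair_pow_oneOn {y : ι → L} (hy : Generic y) (h0 : ∀ a, y a ≠ 0) (M : ℕ) :
    (crPair y ^ M) (oneOn L ι 0) = (M.factorial : L) • oneOn L ι (2 * M) := by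
  induction M with
  | zero => simp
  | succ M ih =>
    rw [pow_succ', Module.End.mul_apply, ih, map_smul, crPair_oneOn hy h0, smul_smul,
      Nat.factorial_succ, mul_comm, Nat.cast_mul]

theorem crVec_oneOn {y : ι → L} (hy : Generic y) (h0 : ∀ a, y a ≠ 0) (M : ℕ) :
    crVec y 1 (oneOn L ι (2 * M)) = oneOn L ι (2 * M + 1) := by
  ext I
  rw [crVec_apply, oneOn]
  have h : ∀ a ∈ I, (1 : ι → L) a * wt y a (I.erase a) * oneOn L ι (2 * M) (I.erase a) =
      if I.card = 2 * M + 1 then wt y a (I.erase a) else 0 := by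
    intro a ha
    have := Finset.card_pos.2 ⟨a, ha⟩
    have e : I.card - 1 = 2 * M ↔ I.card = 2 * M + 1 := by omega
    rw [oneOn, Finset.card_erase_of_mem ha]
    simp [e]
  rw [Finset.sum_congr rfl h]
  split_ifs with hI
  · rw [sum_wt_erase I (fun a _ b _ hab => sub_ne_zero.1 (hy.sub_ne a b hab)) fun a _ => h0 a,
      hI, if_pos ⟨M, rfl⟩]
  · simp

theorem crVec_crPair_pow_oneOn_ne {y : ι → L} (hy : Generic y) (h0 : ∀ a, y a ≠ 0) {M : ℕ}
    (hM : 2 * M + 1 ≤ Fintype.card ι) : crVec y 1 ((crPair y ^ M) (oneOn L ι 0)) ≠ 0 := by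
  obtain ⟨I, -, hI⟩ := Finset.exists_subset_card_eq (s := (Finset.univ : Finset ι)) hM
  intro h
  have := congrFun h I
  rw [crPair_pow_oneOn hy h0, map_smul, crVec_oneOn hy h0] at this
  simp [oneOn, hI, Nat.factorial_ne_zero] at this

/-- The contraction with `crVec y 1` dual to the constant function. -/
def contr (y : ι → L) : Module.End L (Finset ι → L) :=
  ∑ i, wt y i (Finset.univ.erase i) • an y i

/-- The anticommutator is the scalar ∑_i wt_i, which `sum_wt_erase` evaluates to 1 for an odd number
of points. -/
theorem contr_mul_crVec {y : ι → L} (hy : Generic y) (h0 : ∀ a, y a ≠ 0)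
    (h : Odd (Fintype.card ι)) : contr y * crVec y 1 + crVec y 1 * contr y = 1 := by
  simp only [contr, Finset.sum_mul, Finset.mul_sum, ← Finset.sum_add_distrib, smul_mul_assoc,
    mul_smul_comm, ← smul_add, an_mul_crVec hy, Pi.one_apply, one_smul]
  rw [← Finset.sum_smul,
    sum_wt_erase _ (fun a _ b _ hab => sub_ne_zero.1 (hy.sub_ne a b hab)) fun a _ => h0 a,
    Finset.card_univ, if_pos h, one_smul]

/-- The factors over I cancel against the inverse weight in `an`. Only poles along differences of
points outside I remain, so the pole cancellation can be applied to the complement of I. -/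
theorem contr_apply {y : ι → L} (hy : Generic y) (g : Finset ι → L) (I : Finset ι) :
    contr y g I = ∑ b ∈ Iᶜ, wt y b (Iᶜ.erase b) * g (insert b I) := by
  simp only [contr, LinearMap.sum_apply, LinearMap.smul_apply, Finset.sum_apply, Pi.smul_apply,
    smul_eq_mul, an_apply, mul_ite, mul_zero]
  rw [← Finset.sum_filter_add_sum_filter_not Finset.univ (· ∈ I),
    Finset.sum_eq_zero (fun b hb => if_pos (Finset.mem_filter.1 hb).2), zero_add,
    Finset.filter_not, Finset.filter_univ_mem, ← Finset.compl_eq_univ_sdiff]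
  refine Finset.sum_congr rfl fun b hb => ?_
  have hb' := Finset.mem_compl.1 hb
  rw [if_neg hb', ← mul_assoc]
  congr 1
  have hu : Finset.univ.erase b = Iᶜ.erase b ∪ I := by
    ext c
    simp only [Finset.mem_erase, Finset.mem_univ, and_true, Finset.mem_union, Finset.mem_compl]
    by_cases hc : c ∈ I
    · simp only [hc, not_true_eq_false, and_false, or_true, iff_true]
      exact fun e => hb' (e ▸ hc)
    · simp [hc]
  have hd : Disjoint (Iᶜ.erase b) I :=
    Finset.disjoint_left.2 fun c hc => Finset.mem_compl.1 (Finset.mem_of_mem_erase hc)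
  rw [hu, wt, Finset.prod_union hd]
  exact mul_inv_cancel_right₀ (hy.wt_ne hb') _

end FockSums

open MvPolynomial

/-! ### Cancellation of simple poles by symmetry. -/

section Poles

variable {σ : Type*} [DecidableEq σ]

/-- The substitution `X_b ↦ c X_a`. -/
noncomputable def substVar (a b : σ) (c : ℂ) : MvPolynomial σ ℂ →ₐ[ℂ] MvPolynomial σ ℂ :=
  aeval (Function.update X b (C c * X a))

theorem substVar_X_self (a b : σ) (c : ℂ) : substVar a b c (X b) = C c * X a := by
  simp [substVar]

theorem substVar_X_of_ne {a b d : σ} (c : ℂ) (h : d ≠ b) : substVar a b c (X d) = X d := by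
  simp [substVar, h]

theorem X_sub_dvd_iff {a b : σ} (hab : a ≠ b) (c : ℂ) (p : MvPolynomial σ ℂ) :
    X b - C c * X a ∣ p ↔ substVar a b c p = 0 := by
  constructor
  · rintro ⟨r, rfl⟩
    simp [substVar_X_self, substVar_X_of_ne c hab, substVar, hab]
  · intro h
    let J : Ideal (MvPolynomial σ ℂ) := Ideal.span {X b - C c * X a}
    have e : (Ideal.Quotient.mkₐ ℂ J).comp (substVar a b c) = Ideal.Quotient.mkₐ ℂ J := by
      refine MvPolynomial.algHom_ext fun d => ?_
      rw [AlgHom.comp_apply]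
      rcases eq_or_ne d b with rfl | hd
      · rw [substVar_X_self]
        refine Eq.symm (Ideal.Quotient.eq.2 (Ideal.subset_span rfl))
      · rw [substVar_X_of_ne c hd]
    have := congrArg (fun f => f p) e
    simp only [AlgHom.comp_apply, h, map_zero] at this
    exact Ideal.mem_span_singleton.1 (Ideal.Quotient.eq_zero_iff_mem.1 this.symm)

theorem X_sub_ne_zero {a b : σ} (hab : a ≠ b) (c : ℂ) :
    (X b - C c * X a : MvPolynomial σ ℂ) ≠ 0 := by
  intro h
  have := congrArg (eval (Function.update 0 b (1 : ℂ))) h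
  simp [hab] at this

theorem X_sub_prime {a b : σ} (hab : a ≠ b) (c : ℂ) :
    Prime (X b - C c * X a : MvPolynomial σ ℂ) := by
  refine ⟨X_sub_ne_zero hab c, fun h => ?_, fun p r h => ?_⟩
  · have := (h.map (eval (0 : σ → ℂ))).ne_zero
    simp at this
  · simp only [X_sub_dvd_iff hab] at h ⊢
    rw [map_mul] at h
    exact mul_eq_zero.1 h

theorem X_sub_X_prime {a b : σ} (hab : a ≠ b) : Prime (X a - X b : MvPolynomial σ ℂ) := by
  simpa using X_sub_prime hab.symm 1

theorem X_sub_X_dvd_of_swap {a b : σ} (hab : a ≠ b) {p : MvPolynomial σ ℂ}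
    (h : rename (Equiv.swap a b) p = -p) : X a - X b ∣ p := by
  have e : (substVar b a 1).comp (rename (Equiv.swap a b)) = substVar b a 1 := by
    refine MvPolynomial.algHom_ext fun d => ?_
    rw [AlgHom.comp_apply, rename_X]
    rcases eq_or_ne d a with rfl | hda
    · rw [Equiv.swap_apply_left, substVar_X_self, substVar_X_of_ne _ hab.symm]; simp
    rcases eq_or_ne d b with rfl | hdb
    · rw [Equiv.swap_apply_right, substVar_X_self, substVar_X_of_ne _ hab.symm]; simp
    · rw [Equiv.swap_apply_of_ne_of_ne hda hdb]
  have := congrArg (fun f => f p) e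
  simp only [AlgHom.comp_apply, h, map_neg] at this
  have h0 : substVar b a 1 p = 0 := neg_eq_self.1 this
  simpa using (X_sub_dvd_iff hab.symm 1 p).2 h0

theorem X_sub_X_not_dvd {a b c d : σ} (hab : a ≠ b) (hcd : c ≠ d)
    (h : ¬ (c = a ∧ d = b)) (h' : ¬ (c = b ∧ d = a)) :
    ¬ (X a - X b : MvPolynomial σ ℂ) ∣ X c - X d := by
  intro hd
  have h0 := (X_sub_dvd_iff hab.symm 1 (X c - X d)).1 (by simpa using hd)
  by_cases hc : c = a
  · subst hc
    by_cases hda : d = c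
    · exact hcd hda.symm
    · rw [map_sub, substVar_X_self, substVar_X_of_ne _ hda, C_1, one_mul, sub_eq_zero] at h0
      exact h ⟨rfl, (MvPolynomial.X_injective h0).symm⟩
  · rw [map_sub, substVar_X_of_ne _ hc] at h0
    by_cases hda : d = a
    · subst hda
      rw [substVar_X_self, C_1, one_mul, sub_eq_zero] at h0
      exact h' ⟨MvPolynomial.X_injective h0, rfl⟩
    · rw [substVar_X_of_ne _ hda, sub_eq_zero] at h0
      exact hcd (MvPolynomial.X_injective h0)

/-- The field of rational functions. -/
abbrev RatFun (σ : Type*) : Type _ := FractionRing (MvPolynomial σ ℂ)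

/-- A polynomial as a rational function. -/
noncomputable abbrev toRat (σ : Type*) : MvPolynomial σ ℂ →+* RatFun σ :=
  algebraMap (MvPolynomial σ ℂ) (RatFun σ)

theorem toRat_injective : Function.Injective (toRat σ) := IsFractionRing.injective _ _

/-- The endomorphism of the field of rational functions induced by an injective endomorphism of
the ring of polynomials. -/
noncomputable def ratMap (f : MvPolynomial σ ℂ →ₐ[ℂ] MvPolynomial σ ℂ)
    (hf : Function.Injective f) : RatFun σ →+* RatFun σ :=
  IsFractionRing.lift (g := (toRat σ).comp (f : MvPolynomial σ ℂ →+* MvPolynomial σ ℂ))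
    (toRat_injective.comp hf)

theorem ratMap_toRat (f : MvPolynomial σ ℂ →ₐ[ℂ] MvPolynomial σ ℂ)
    (hf : Function.Injective f) (p : MvPolynomial σ ℂ) :
    ratMap f hf (toRat σ p) = toRat σ (f p) := IsFractionRing.lift_algebraMap _ _

/-- The action of permutations on rational functions. -/
noncomputable def permRat (τ : Equiv.Perm σ) : RatFun σ →+* RatFun σ :=
  ratMap (rename τ) (rename_injective _ τ.injective)

theorem permRat_toRat (τ : Equiv.Perm σ) (p : MvPolynomial σ ℂ) :
    permRat τ (toRat σ p) = toRat σ (rename τ p) := ratMap_toRat _ _ _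

/-- The product of the differences of variables in a set of pairs. -/
noncomputable def diffProd (T : Finset (σ × σ)) : MvPolynomial σ ℂ :=
  ∏ p ∈ T, (X p.1 - X p.2)

/-- A rational function has a denominator which is a product of distinct differences of variables
with indices in `I`, not containing a difference together with its negative. -/
def SimplePoles (I : Finset σ) (z : RatFun σ) : Prop :=
  ∃ T ⊆ I.offDiag, (∀ a b, (a, b) ∈ T → (b, a) ∉ T) ∧ ∃ p, z * toRat σ (diffProd T) = toRat σ p

theorem mul_diffProd_of_subset {z : RatFun σ} {S T : Finset (σ × σ)} (h : T ⊆ S)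
    (hz : ∃ p, z * toRat σ (diffProd T) = toRat σ p) :
    ∃ p, z * toRat σ (diffProd S) = toRat σ p := by
  obtain ⟨p, hp⟩ := hz
  refine ⟨p * diffProd (S \ T), ?_⟩
  rw [map_mul, ← hp, mul_assoc, ← map_mul]
  congr 2
  rw [diffProd, diffProd, diffProd, mul_comm, Finset.prod_sdiff h]

/-- `offDiag` contains each pair in both orders. Dropping (b, a) leaves x_a - x_b to the first
power, enough for a simple pole. The multiplicity of the other differences does not matter, as each
pair is treated separately. -/
theorem SimplePoles.mul_diffProd {I : Finset σ} {z : RatFun σ} (h : SimplePoles I z) {a b : σ}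
    (hab : (a, b) ∈ I.offDiag) :
    ∃ p, z * toRat σ (diffProd (I.offDiag.erase (b, a))) = toRat σ p := by
  obtain ⟨T, hT, hT', hz⟩ := h
  have hab' := Finset.mem_offDiag.1 hab
  by_cases hb : (b, a) ∈ T
  · have hsub : T ⊆ I.offDiag.erase (a, b) := fun p hp =>
      Finset.mem_erase.2 ⟨fun e => hT' _ _ hb (e ▸ hp), hT hp⟩
    obtain ⟨p, hp⟩ := mul_diffProd_of_subset hsub hz
    refine ⟨-p, ?_⟩
    rw [map_neg, ← hp, ← mul_neg, ← map_neg]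
    congr 2
    have m1 : (a, b) ∈ I.offDiag.erase (b, a) :=
      Finset.mem_erase.2 ⟨fun e => hab'.2.2 (Prod.ext_iff.1 e).1, hab⟩
    have m2 : (b, a) ∈ I.offDiag.erase (a, b) :=
      Finset.mem_erase.2 ⟨fun e => hab'.2.2 (Prod.ext_iff.1 e).2,
        Finset.mem_offDiag.2 ⟨hab'.2.1, hab'.1, hab'.2.2.symm⟩⟩
    rw [diffProd, diffProd, ← Finset.mul_prod_erase _ _ m1, ← Finset.mul_prod_erase _ _ m2,
      Finset.erase_right_comm]
    ring
  · exact mul_diffProd_of_subset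
      (fun p hp => Finset.mem_erase.2 ⟨fun e => hb (e ▸ hp), hT hp⟩) hz

theorem exists_sum_mul {κ : Type*} (s : Finset κ) (z : κ → RatFun σ) (w : MvPolynomial σ ℂ)
    (h : ∀ j ∈ s, ∃ p, z j * toRat σ w = toRat σ p) :
    ∃ p, (∑ j ∈ s, z j) * toRat σ w = toRat σ p := by
  choose! p hp using h
  exact ⟨∑ j ∈ s, p j, by rw [Finset.sum_mul, map_sum, Finset.sum_congr rfl hp]⟩

/-- A sum of rational functions with simple poles which is invariant under the transpositions is a
polynomial. -/
theorem exists_polynomial_of_simplePoles {κ : Type*} (I : Finset σ) (s : Finset κ)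
    (z : κ → RatFun σ) (h : ∀ j ∈ s, SimplePoles I (z j))
    (hs : ∀ a ∈ I, ∀ b ∈ I, a ≠ b → permRat (Equiv.swap a b) (∑ j ∈ s, z j) = ∑ j ∈ s, z j) :
    ∃ p, ∑ j ∈ s, z j = toRat σ p := by
  set y := ∑ j ∈ s, z j with hy
  -- There is no pole along x_a = x_b: over a denominator (x_a - x_b) D with D symmetric in a and b,
  -- the numerator of the invariant y is anti-symmetric, hence divisible by x_a - x_b.
  have key : ∀ a b, (a, b) ∈ I.offDiag →
      ∃ p, y * toRat σ (diffProd ((I.offDiag.erase (b, a)).erase (a, b))) = toRat σ p := by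
    intro a b hab
    have hab' := Finset.mem_offDiag.1 hab
    have hne := hab'.2.2
    obtain ⟨p, hp⟩ := exists_sum_mul s z _ fun j hj => (h j hj).mul_diffProd hab
    have m1 : (a, b) ∈ I.offDiag.erase (b, a) :=
      Finset.mem_erase.2 ⟨fun e => hne (Prod.ext_iff.1 e).1, hab⟩
    set D := diffProd ((I.offDiag.erase (b, a)).erase (a, b)) with hD
    have e1 : diffProd (I.offDiag.erase (b, a)) = (X a - X b) * D := by
      rw [diffProd, hD, diffProd, ← Finset.mul_prod_erase _ _ m1]
    have e2 : rename (Equiv.swap a b) D = D := by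
      rw [hD, diffProd, map_prod]
      refine Finset.prod_nbij' (fun p => (Equiv.swap a b p.1, Equiv.swap a b p.2))
        (fun p => (Equiv.swap a b p.1, Equiv.swap a b p.2)) ?_ ?_ (by simp) (by simp) (by simp)
      all_goals
        rintro ⟨c, d⟩ hcd
        simp only [Finset.mem_erase, Finset.mem_offDiag, ne_eq, Prod.mk.injEq] at hcd ⊢
        have hmem : ∀ c ∈ I, Equiv.swap a b c ∈ I := fun c hc => by
          rw [Equiv.swap_apply_def]; split_ifs
          exacts [hab'.2.1, hab'.1, hc]
        have ha : ∀ c, Equiv.swap a b c = a ↔ c = b := fun c => by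
          rw [Equiv.swap_apply_eq_iff, Equiv.swap_apply_left]
        have hb : ∀ c, Equiv.swap a b c = b ↔ c = a := fun c => by
          rw [Equiv.swap_apply_eq_iff, Equiv.swap_apply_right]
        simp only [ha, hb, (Equiv.swap a b).injective.eq_iff]
        exact ⟨fun e => hcd.2.1 ⟨e.1, e.2⟩, fun e => hcd.1 ⟨e.1, e.2⟩, hmem _ hcd.2.2.1,
          hmem _ hcd.2.2.2.1, hcd.2.2.2.2⟩
    rw [e1, ← hy] at hp
    have e3 : rename (Equiv.swap a b) p = -p := by
      apply toRat_injective
      rw [← permRat_toRat, ← hp, map_mul, hs a hab'.1 b hab'.2.1 hne, permRat_toRat, map_mul, e2,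
        map_neg, ← hp, ← mul_neg, ← map_neg]
      congr 2
      simp
      ring
    obtain ⟨r, rfl⟩ := X_sub_X_dvd_of_swap hne e3
    refine ⟨r, ?_⟩
    have h0 : toRat σ (X a - X b) ≠ 0 := by
      rw [map_ne_zero_iff _ toRat_injective]
      exact (X_sub_X_prime hne).ne_zero
    refine mul_left_cancel₀ h0 ?_
    rw [← map_mul, ← hp, map_mul]
    ring
  -- A prime factor of the reduced denominator would be associated to some x_a - x_b, but by `key`
  -- it also divides a product of differences of other pairs.
  have hden : IsUnit (IsFractionRing.den (MvPolynomial σ ℂ) y : MvPolynomial σ ℂ) := by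
    by_contra hu
    have hdvd : ∀ w, (∃ p, y * toRat σ w = toRat σ p) →
        (IsFractionRing.den (MvPolynomial σ ℂ) y : MvPolynomial σ ℂ) ∣ w := by
      rintro w ⟨p, hp⟩
      have hd0 : toRat σ (IsFractionRing.den (MvPolynomial σ ℂ) y) ≠ 0 := by
        rw [map_ne_zero_iff _ toRat_injective]
        exact nonZeroDivisors.coe_ne_zero _
      have : IsFractionRing.num (MvPolynomial σ ℂ) y * w =
          p * (IsFractionRing.den (MvPolynomial σ ℂ) y : MvPolynomial σ ℂ) := by
        apply toRat_injective
        rw [map_mul, map_mul, ← hp]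
        nth_rewrite 2 [← IsFractionRing.mk'_num_den' (MvPolynomial σ ℂ) y]
        field_simp
      exact ((IsFractionRing.num_den_reduced (MvPolynomial σ ℂ) y).symm.dvd_of_dvd_mul_left
        (Dvd.intro_left p this.symm))
    obtain ⟨π, hπ, hdiv⟩ := WfDvdMonoid.exists_irreducible_factor hu
      (nonZeroDivisors.coe_ne_zero _)
    have hπ' : Prime π := hπ.prime
    have hfull : ∃ p, y * toRat σ (diffProd I.offDiag) = toRat σ p :=
      exists_sum_mul s z _ fun j hj => by
        obtain ⟨T, hT, -, hz⟩ := h j hj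
        exact mul_diffProd_of_subset hT hz
    obtain ⟨⟨a, b⟩, hab, hdab⟩ := (hπ'.dvd_finsetProd_iff _).1 (hdiv.trans (hdvd _ hfull))
    have hne := (Finset.mem_offDiag.1 hab).2.2
    have hassoc := hπ.associated_of_dvd (X_sub_X_prime hne).irreducible hdab
    have := hassoc.symm.dvd.trans (hdiv.trans (hdvd _ (key a b hab)))
    obtain ⟨⟨c, d⟩, hcd, hdcd⟩ := ((X_sub_X_prime hne).dvd_finsetProd_iff _).1 this
    simp only [Finset.mem_erase, Finset.mem_offDiag, ne_eq, Prod.mk.injEq] at hcd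
    exact X_sub_X_not_dvd hne hcd.2.2.2.2 hcd.1 hcd.2.1 hdcd
  obtain ⟨p, hp⟩ := IsFractionRing.isInteger_of_isUnit_den hden
  exact ⟨p, hp.symm⟩

end Poles

/-! ### Scaling of variables. -/

section Scaling

variable {σ : Type*}

/-- The substitution `X_i ↦ c_i X_i`. -/
noncomputable def scaleVar (c : σ → ℂ) : MvPolynomial σ ℂ →ₐ[ℂ] MvPolynomial σ ℂ :=
  aeval fun i => C (c i) * X i

theorem scaleVar_X (c : σ → ℂ) (i : σ) : scaleVar c (X i) = C (c i) * X i := aeval_X _ _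

theorem scaleVar_injective {c : σ → ℂ} (hc : ∀ i, c i ≠ 0) :
    Function.Injective (scaleVar c) := by
  have : (scaleVar fun i => (c i)⁻¹).comp (scaleVar c) = AlgHom.id ℂ _ := by
    refine MvPolynomial.algHom_ext fun i => ?_
    rw [AlgHom.comp_apply, scaleVar_X, map_mul, scaleVar_X, algHom_C, ← mul_assoc,
      algebraMap_eq, ← C_mul, mul_inv_cancel₀ (hc i)]
    simp
  exact Function.LeftInverse.injective (g := scaleVar fun i => (c i)⁻¹) fun p =>
    congrArg (fun f => f p) this

theorem scaleVar_monomial (c : σ → ℂ) (m : σ →₀ ℕ) (r : ℂ) :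
    scaleVar c (monomial m r) = monomial m ((m.prod fun i k => c i ^ k) * r) := by
  rw [scaleVar, aeval_monomial, monomial_eq (a := _ * r), C_mul, mul_comm (C _) (C r), mul_assoc]
  simp only [mul_pow, Finsupp.prod_mul, ← C_pow, algebraMap_eq]
  congr 2
  rw [Finsupp.prod, Finsupp.prod, map_prod]

theorem coeff_scaleVar (c : σ → ℂ) (p : MvPolynomial σ ℂ) (m : σ →₀ ℕ) :
    coeff m (scaleVar c p) = (m.prod fun i k => c i ^ k) * coeff m p := by
  classical
  induction p using MvPolynomial.induction_on' with
  | monomial u a =>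
    rw [scaleVar_monomial, coeff_monomial, coeff_monomial]
    split_ifs with h
    · rw [h]
    · rw [mul_zero]
  | add p q hp hq => rw [map_add, coeff_add, coeff_add, hp, hq, mul_add]

theorem scaleVar_rename {τ : Type*} (c : τ → ℂ) (f : σ → τ) (p : MvPolynomial σ ℂ) :
    scaleVar c (rename f p) = rename f (scaleVar (c ∘ f) p) := by
  rw [scaleVar, aeval_rename, scaleVar, ← AlgHom.comp_apply]
  congr 1
  refine MvPolynomial.algHom_ext fun i => ?_
  simp

end Scaling

/-! ### Equivariant homogeneous families. -/

/-- The variables as rational functions. -/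
noncomputable def pt (n : ℕ) : Fin n → RatFun (Fin n) := fun i => toRat _ (X i)

theorem pt_ne_zero {n : ℕ} (i : Fin n) : pt n i ≠ 0 := by
  rw [pt, map_ne_zero_iff _ toRat_injective]
  exact MvPolynomial.X_ne_zero i

theorem generic_pt (n : ℕ) : Generic (pt n) where
  sub_ne a b hab := by
    rw [pt, pt, ← map_sub, map_ne_zero_iff _ toRat_injective]
    exact (X_sub_X_prime hab).ne_zero
  add_ne a b hab := by
    rw [pt, pt, ← map_add, map_ne_zero_iff _ toRat_injective]
    simpa [add_comm] using (X_sub_prime hab (-1)).ne_zero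

/-- The automorphism of the rational functions doubling all variables. -/
noncomputable def doubleRat (n : ℕ) : RatFun (Fin n) →+* RatFun (Fin n) :=
  ratMap (scaleVar fun _ => 2) (scaleVar_injective fun _ => two_ne_zero)

theorem doubleRat_toRat {n : ℕ} (p : MvPolynomial (Fin n) ℂ) :
    doubleRat n (toRat _ p) = toRat _ (scaleVar (fun _ => 2) p) := ratMap_toRat _ _ _

/-- The families of polynomials `g_I` indexed by the subsets `I ⊆ {1, …, n}` with `l` elements,
equivariant for permutations of the variables and homogeneous of degree `d`: the condition
`g_I(2x) = 2^d g_I(x)` is equivalent to the homogeneity. -/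
def EqFam (n : ℕ) (l d : ℤ) : Submodule ℂ (Finset (Fin n) → MvPolynomial (Fin n) ℂ) where
  carrier := {g | (∀ I, (I.card : ℤ) ≠ l → g I = 0) ∧
    (∀ (τ : Equiv.Perm (Fin n)) I, rename τ (g I) = g (I.map τ.toEmbedding)) ∧
    ∀ I, scaleVar (fun _ => 2) (g I) = (2 : ℂ) ^ d • g I}
  zero_mem' := by simp
  add_mem' := by
    rintro g h ⟨hg, hg', hg''⟩ ⟨hh, hh', hh''⟩
    refine ⟨fun I hI => by simp [hg I hI, hh I hI], fun τ I => ?_, fun I => ?_⟩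
    · rw [Pi.add_apply, map_add, hg', hh', Pi.add_apply]
    · rw [Pi.add_apply, map_add, hg'', hh'', smul_add]
  smul_mem' := by
    rintro c g ⟨hg, hg', hg''⟩
    refine ⟨fun I hI => by simp [hg I hI], fun τ I => ?_, fun I => ?_⟩
    · rw [Pi.smul_apply, map_smul, hg', Pi.smul_apply]
    · rw [Pi.smul_apply, map_smul, hg'', smul_comm]

/-- A family of polynomials as a family of rational functions. -/
noncomputable def famRat {n : ℕ} (g : Finset (Fin n) → MvPolynomial (Fin n) ℂ) :
    Finset (Fin n) → RatFun (Fin n) := fun I => toRat _ (g I)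

theorem famRat_injective {n : ℕ} : Function.Injective (famRat (n := n)) := fun _ _ h =>
  funext fun I => toRat_injective (congrFun h I)

/-! ### The operators commute with permutations and dilations and preserve polynomial families. -/

section Natural

variable {n : ℕ}

/-- The family is an eigenvector of eigenvalue `e` of a twisted permutation. -/
def Natural (φ : RatFun (Fin n) →+* RatFun (Fin n)) (τ : Equiv.Perm (Fin n)) (e : RatFun (Fin n))
    (g : Finset (Fin n) → RatFun (Fin n)) : Prop :=
  ∀ I, φ (g I) = e * g (I.map τ.toEmbedding)

variable {φ : RatFun (Fin n) →+* RatFun (Fin n)} {τ : Equiv.Perm (Fin n)} {c e : RatFun (Fin n)}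
  {g : Finset (Fin n) → RatFun (Fin n)}

/-- The weights are homogeneous of degree 0, so the common scalar c drops out. This treats
permutations (c = 1) and the doubling of the variables (c = 2) simultaneously. -/
theorem map_wt (hc : c ≠ 0) (hφ : ∀ i, φ (pt n i) = c * pt n (τ i)) (a : Fin n)
    (I : Finset (Fin n)) : φ (wt (pt n) a I) = wt (pt n) (τ a) (I.map τ.toEmbedding) := by
  rw [wt, wt, map_prod, Finset.prod_map]
  refine Finset.prod_congr rfl fun b _ => ?_
  rw [map_div₀, map_add, map_sub, hφ, hφ, ← mul_add, ← mul_sub, mul_div_mul_left _ _ hc]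
  rfl

theorem Natural.crVec (hc : c ≠ 0) (hφ : ∀ i, φ (pt n i) = c * pt n (τ i))
    (hg : Natural φ τ e g) (k : ℕ) :
    Natural φ τ (c ^ k * e) (crVec (pt n) (fun i => pt n i ^ k) g) := by
  intro I
  rw [crVec_apply, crVec_apply, map_sum, Finset.mul_sum, Finset.sum_map]
  refine Finset.sum_congr rfl fun a _ => ?_
  rw [map_mul, map_mul, map_wt hc hφ, hg, map_pow, hφ, Finset.map_erase]
  simp only [Equiv.coe_toEmbedding]
  ring

theorem Natural.contr (hc : c ≠ 0) (hφ : ∀ i, φ (pt n i) = c * pt n (τ i))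
    (hg : Natural φ τ e g) : Natural φ τ e (contr (pt n) g) := by
  intro I
  have hcompl : (I.map τ.toEmbedding)ᶜ = Iᶜ.map τ.toEmbedding := by
    ext b; simp [Finset.mem_map_equiv]
  rw [contr_apply (generic_pt n), contr_apply (generic_pt n), map_sum, Finset.mul_sum, hcompl,
    Finset.sum_map]
  refine Finset.sum_congr rfl fun a _ => ?_
  rw [map_mul, map_wt hc hφ, hg, Finset.map_erase, Finset.map_insert]
  simp only [Equiv.coe_toEmbedding]
  ring

theorem Natural.crPair (hc : c ≠ 0) (hφ : ∀ i, φ (pt n i) = c * pt n (τ i))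
    (hg : Natural φ τ e g) : Natural φ τ e (crPair (pt n) g) := by
  intro I
  rw [crPair_apply, crPair_apply, map_mul, map_sum, Finset.mul_sum, Finset.mul_sum,
    Finset.sum_map, Finset.mul_sum]
  refine Finset.sum_congr rfl fun a _ => ?_
  rw [map_sum, ← Finset.map_erase, Finset.sum_map, Finset.mul_sum, Finset.mul_sum,
    Finset.mul_sum]
  refine Finset.sum_congr rfl fun b _ => ?_
  rw [map_mul, map_mul, map_mul, map_wt hc hφ, map_wt hc hφ, hg, map_div₀ φ (pt n a - pt n b),
    map_add, map_sub, hφ, hφ, ← mul_add, ← mul_sub, mul_div_mul_left _ _ hc, ← Finset.map_erase]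
  simp only [Equiv.coe_toEmbedding, map_div₀, map_one, map_ofNat]
  ring

theorem permRat_pt (τ : Equiv.Perm (Fin n)) (i : Fin n) :
    permRat τ (pt n i) = 1 * pt n (τ i) := by
  rw [pt, permRat_toRat, rename_X, one_mul, pt]

theorem toRat_C_smul {σ : Type*} (c : ℂ) (p : MvPolynomial σ ℂ) :
    toRat σ (c • p) = toRat σ (C c) * toRat σ p := by
  rw [← map_mul, C_mul']

theorem doubleRat_pt (i : Fin n) :
    doubleRat n (pt n i) = toRat _ (C 2) * pt n ((1 : Equiv.Perm (Fin n)) i) := by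
  rw [pt, doubleRat_toRat, scaleVar_X, map_mul]
  rfl

theorem toRat_C_ne_zero {σ : Type*} [DecidableEq σ] {c : ℂ} (hc : c ≠ 0) : toRat σ (C c) ≠ 0 := by
  rw [map_ne_zero_iff _ toRat_injective]
  simpa using hc

theorem map_one_perm (I : Finset (Fin n)) : I.map (1 : Equiv.Perm (Fin n)).toEmbedding = I :=
  Finset.map_refl

theorem natural_perm_of_mem {l d : ℤ} {u : Finset (Fin n) → MvPolynomial (Fin n) ℂ}
    (hu : u ∈ EqFam n l d) (τ : Equiv.Perm (Fin n)) : Natural (permRat τ) τ 1 (famRat u) :=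
  fun I => by rw [famRat, permRat_toRat, hu.2.1, one_mul, famRat]

theorem natural_double_of_mem {l d : ℤ} {u : Finset (Fin n) → MvPolynomial (Fin n) ℂ}
    (hu : u ∈ EqFam n l d) : Natural (doubleRat n) 1 (toRat _ (C ((2 : ℂ) ^ d))) (famRat u) :=
  fun I => by
    rw [famRat, doubleRat_toRat, hu.2.2, toRat_C_smul, famRat, map_one_perm]

theorem exists_mem_eqFam {l d : ℤ} (z : Finset (Fin n) → RatFun (Fin n))
    (hcard : ∀ I, (I.card : ℤ) ≠ l → z I = 0) (hperm : ∀ τ, Natural (permRat τ) τ 1 z)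
    (hdouble : Natural (doubleRat n) 1 (toRat _ (C ((2 : ℂ) ^ d))) z)
    (hpol : ∀ I, ∃ p, z I = toRat _ p) : ∃ h ∈ EqFam n l d, famRat h = z := by
  choose h hh using hpol
  refine ⟨h, ⟨fun I hI => ?_, fun τ I => ?_, fun I => ?_⟩, funext fun I => (hh I).symm⟩
  · apply toRat_injective
    rw [← hh, hcard I hI, map_zero]
  · apply toRat_injective
    rw [← permRat_toRat, ← hh, hperm, one_mul, hh]
  · apply toRat_injective
    rw [← doubleRat_toRat, ← hh, hdouble, toRat_C_smul, ← hh, map_one_perm]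

theorem simplePoles_wt {J : Finset (Fin n)} {a : Fin n} (ha : a ∈ J)
    (p : MvPolynomial (Fin n) ℂ) : SimplePoles J (wt (pt n) a (J.erase a) * toRat _ p) := by
  refine ⟨(J.erase a).image fun b => (a, b), ?_, ?_, (∏ b ∈ J.erase a, (X a + X b)) * p, ?_⟩
  · intro q hq
    obtain ⟨b, hb, rfl⟩ := Finset.mem_image.1 hq
    exact Finset.mem_offDiag.2 ⟨ha, Finset.mem_of_mem_erase hb, (Finset.ne_of_mem_erase hb).symm⟩
  · intro b c h h'
    simp only [Finset.mem_image, Prod.mk.injEq, Finset.mem_erase] at h h'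
    obtain ⟨_, h1, rfl, rfl⟩ := h
    obtain ⟨_, h2, e, rfl⟩ := h'
    exact h1.1 e.symm
  · rw [diffProd, Finset.prod_image (by simp), map_mul, mul_right_comm]
    congr 1
    rw [wt, map_prod, map_prod, ← Finset.prod_mul_distrib]
    refine Finset.prod_congr rfl fun b hb => ?_
    rw [map_sub, map_add]
    exact div_mul_cancel₀ _ ((generic_pt n).sub_ne a b (Finset.ne_of_mem_erase hb).symm)

/-- The pair coefficient cancels the factor at b of the weight of a. So neither x_a + x_b nor x_a -
x_b survives in the denominator, and the differences with other variables occur once each. -/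
theorem simplePoles_pair {J : Finset (Fin n)} {a b : Fin n} (ha : a ∈ J) (hb : b ∈ J.erase a)
    (p : MvPolynomial (Fin n) ℂ) :
    SimplePoles J ((pt n a - pt n b) / (pt n a + pt n b) *
      (wt (pt n) a (J.erase a) * wt (pt n) b ((J.erase a).erase b)) * toRat _ p) := by
  have hab := (Finset.ne_of_mem_erase hb).symm
  have e : (pt n a - pt n b) / (pt n a + pt n b) * wt (pt n) a (J.erase a) =
      wt (pt n) a ((J.erase a).erase b) := by
    rw [wt_erase (pt n) hb]
    have h1 := (generic_pt n).sub_ne a b hab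
    have h2 := (generic_pt n).add_ne a b hab
    field_simp
  rw [← mul_assoc, e]
  set S := (J.erase a).erase b with hS
  have hSJ : ∀ c ∈ S, c ≠ b ∧ c ≠ a ∧ c ∈ J := fun c hc => by simpa [hS] using hc
  have hdis : Disjoint (S.image fun c => (a, c)) (S.image fun c => (b, c)) := by
    rw [Finset.disjoint_left]
    rintro ⟨c, d⟩ h h'
    simp only [Finset.mem_image, Prod.mk.injEq] at h h'
    obtain ⟨_, -, rfl, rfl⟩ := h
    obtain ⟨_, -, e', rfl⟩ := h'
    exact hab e'.symm
  refine ⟨(S.image fun c => (a, c)) ∪ S.image fun c => (b, c), ?_, ?_,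
    (∏ c ∈ S, (X a + X c)) * (∏ c ∈ S, (X b + X c)) * p, ?_⟩
  · intro q hq
    rcases Finset.mem_union.1 hq with h | h <;> obtain ⟨c, hc, rfl⟩ := Finset.mem_image.1 h
    · exact Finset.mem_offDiag.2 ⟨ha, (hSJ c hc).2.2, (hSJ c hc).2.1.symm⟩
    · exact Finset.mem_offDiag.2 ⟨Finset.mem_of_mem_erase hb, (hSJ c hc).2.2, (hSJ c hc).1.symm⟩
  · intro c d h h'
    have key : ∀ c d, (c, d) ∈ (S.image fun c => (a, c)) ∪ S.image (fun c => (b, c)) →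
        (c = a ∨ c = b) ∧ d ≠ a ∧ d ≠ b := by
      intro c d h
      rcases Finset.mem_union.1 h with h | h <;> obtain ⟨x, hx, e⟩ := Finset.mem_image.1 h <;>
        obtain ⟨rfl, rfl⟩ := Prod.ext_iff.1 e
      · exact ⟨Or.inl rfl, (hSJ x hx).2.1, (hSJ x hx).1⟩
      · exact ⟨Or.inr rfl, (hSJ x hx).2.1, (hSJ x hx).1⟩
    have h1 := key _ _ h
    have h2 := key _ _ h'
    rcases h1.1 with e | e
    · exact h2.2.1 e
    · exact h2.2.2 e
  · rw [diffProd, Finset.prod_union hdis, Finset.prod_image (by simp), Finset.prod_image (by simp)]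
    have hw : ∀ d, (∀ c ∈ S, c ≠ d) → wt (pt n) d S * toRat _ (∏ c ∈ S, (X d - X c)) =
        toRat _ (∏ c ∈ S, (X d + X c)) := by
      intro d hd
      rw [wt, map_prod, map_prod, ← Finset.prod_mul_distrib]
      refine Finset.prod_congr rfl fun c hc => ?_
      rw [map_sub, map_add]
      exact div_mul_cancel₀ _ ((generic_pt n).sub_ne d c (hd c hc).symm)
    rw [map_mul, map_mul, map_mul, ← hw a fun c hc => (hSJ c hc).2.1,
      ← hw b fun c hc => (hSJ c hc).1]
    ring

theorem map_swap_eq_self {I : Finset (Fin n)} {a b : Fin n} (h : a ∈ I ↔ b ∈ I) :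
    I.map (Equiv.swap a b).toEmbedding = I := by
  ext c
  rw [Finset.mem_map_equiv, Equiv.symm_swap, Equiv.swap_apply_def]
  split_ifs with h1 h2
  · rw [h1, h]
  · rw [h2, h]
  · rfl

/-- The summands at I have simple poles along differences of variables in I, and equivariance makes
the sum invariant under transpositions within I, so the poles cancel. -/
theorem exists_crVec {l d : ℤ} {u : Finset (Fin n) → MvPolynomial (Fin n) ℂ}
    (hu : u ∈ EqFam n l d) (k : ℕ) : ∃ h ∈ EqFam n (l + 1) (d + k),
      famRat h = crVec (pt n) (fun i => pt n i ^ k) (famRat u) := by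
  have hp : ∀ τ, Natural (permRat τ) τ 1 (crVec (pt n) (fun i => pt n i ^ k) (famRat u)) := by
    intro τ
    simpa using (natural_perm_of_mem hu τ).crVec one_ne_zero (permRat_pt τ) k
  refine exists_mem_eqFam _ ?_ hp ?_ ?_
  · intro I hI
    rw [crVec_apply]
    refine Finset.sum_eq_zero fun a ha => ?_
    have h1 := Finset.card_pos.2 ⟨a, ha⟩
    rw [famRat, hu.1, map_zero, mul_zero]
    rw [Finset.card_erase_of_mem ha]
    omega
  · have := (natural_double_of_mem hu).crVec (toRat_C_ne_zero two_ne_zero) doubleRat_pt k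
    rwa [← map_pow, ← C_pow, ← map_mul, ← C_mul, ← zpow_natCast, ← zpow_add₀ two_ne_zero,
      add_comm (k : ℤ)] at this
  · intro I
    have e : crVec (pt n) (fun i => pt n i ^ k) (famRat u) I =
        ∑ a ∈ I, wt (pt n) a (I.erase a) * toRat _ (X a ^ k * u (I.erase a)) := by
      rw [crVec_apply]
      refine Finset.sum_congr rfl fun a _ => ?_
      rw [map_mul, map_pow, famRat, pt]
      ring
    rw [e]
    refine exists_polynomial_of_simplePoles I I _ (fun a ha => simplePoles_wt ha _) ?_
    intro a ha b hb _
    rw [← e, hp, one_mul, map_swap_eq_self (by simp [ha, hb])]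

theorem exists_contr {l d : ℤ} {u : Finset (Fin n) → MvPolynomial (Fin n) ℂ}
    (hu : u ∈ EqFam n l d) : ∃ h ∈ EqFam n (l - 1) d, famRat h = contr (pt n) (famRat u) := by
  have hp : ∀ τ, Natural (permRat τ) τ 1 (contr (pt n) (famRat u)) := fun τ =>
    (natural_perm_of_mem hu τ).contr one_ne_zero (permRat_pt τ)
  refine exists_mem_eqFam _ ?_ hp
    ((natural_double_of_mem hu).contr (toRat_C_ne_zero two_ne_zero) doubleRat_pt) ?_
  · intro I hI
    rw [contr_apply (generic_pt n)]
    refine Finset.sum_eq_zero fun a ha => ?_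
    rw [famRat, hu.1, map_zero, mul_zero]
    rw [Finset.card_insert_of_notMem (Finset.mem_compl.1 ha)]
    push_cast
    omega
  · intro I
    rw [contr_apply (generic_pt n)]
    refine exists_polynomial_of_simplePoles Iᶜ Iᶜ _ (fun a ha => simplePoles_wt ha _) ?_
    intro a ha b hb _
    have := hp (Equiv.swap a b) I
    rw [contr_apply (generic_pt n), one_mul, map_swap_eq_self, contr_apply (generic_pt n)] at this
    · exact this
    · simp [Finset.mem_compl.1 ha, Finset.mem_compl.1 hb]

theorem exists_crPair {l d : ℤ} {u : Finset (Fin n) → MvPolynomial (Fin n) ℂ}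
    (hu : u ∈ EqFam n l d) : ∃ h ∈ EqFam n (l + 2) d, famRat h = crPair (pt n) (famRat u) := by
  have hp : ∀ τ, Natural (permRat τ) τ 1 (crPair (pt n) (famRat u)) := fun τ =>
    (natural_perm_of_mem hu τ).crPair one_ne_zero (permRat_pt τ)
  refine exists_mem_eqFam _ ?_ hp
    ((natural_double_of_mem hu).crPair (toRat_C_ne_zero two_ne_zero) doubleRat_pt) ?_
  · intro I hI
    rw [crPair_apply, Finset.sum_eq_zero, mul_zero]
    refine fun a ha => Finset.sum_eq_zero fun b hb => ?_
    have h1 := Finset.card_pos.2 ⟨b, hb⟩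
    rw [famRat, hu.1, map_zero, mul_zero]
    rw [Finset.card_erase_of_mem hb, Finset.card_erase_of_mem ha]
    rw [Finset.card_erase_of_mem ha] at h1
    omega
  · intro I
    have e : crPair (pt n) (famRat u) I = ∑ q ∈ I.sigma fun a => I.erase a,
        ((pt n q.1 - pt n q.2) / (pt n q.1 + pt n q.2) *
          (wt (pt n) q.1 (I.erase q.1) * wt (pt n) q.2 ((I.erase q.1).erase q.2)) *
          toRat _ (C (1 / 2) * u ((I.erase q.1).erase q.2))) := by
      rw [crPair_apply, Finset.sum_sigma, Finset.mul_sum]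
      refine Finset.sum_congr rfl fun a _ => ?_
      rw [Finset.mul_sum]
      refine Finset.sum_congr rfl fun b _ => ?_
      have : toRat (Fin n) (C (1 / 2)) = 1 / 2 := by
        rw [eq_div_iff two_ne_zero]
        have : toRat (Fin n) (C (1 / 2)) * toRat _ (C 2) = 1 := by
          rw [← map_mul, ← C_mul]; norm_num
        rwa [show (C (2 : ℂ) : MvPolynomial (Fin n) ℂ) = 2 from map_ofNat C 2, map_ofNat] at this
      rw [map_mul, this, famRat]
      ring
    rw [e]
    refine exists_polynomial_of_simplePoles I _ _ (fun q hq => ?_) ?_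
    · obtain ⟨h1, h2⟩ := Finset.mem_sigma.1 hq
      exact simplePoles_pair h1 h2 _
    · intro a ha b hb _
      rw [← e, hp, one_mul, map_swap_eq_self (by simp [ha, hb])]

end Natural

/-! ### Restriction of families to x_n = 0 and its kernel. -/

section Restriction

variable {n : ℕ}

/-- The substitution `x_n = 0` of the last variable. -/
noncomputable def resVar (n : ℕ) : MvPolynomial (Fin (n + 1)) ℂ →ₐ[ℂ] MvPolynomial (Fin n) ℂ :=
  aeval (Fin.snoc (α := fun _ => MvPolynomial (Fin n) ℂ) X 0)

theorem resVar_X_castSucc (i : Fin n) : resVar n (X i.castSucc) = X i := by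
  rw [resVar, aeval_X, Fin.snoc_castSucc]

theorem resVar_X_last : resVar n (X (Fin.last n)) = 0 := by
  rw [resVar, aeval_X, Fin.snoc_last]

theorem X_last_dvd_sub (p : MvPolynomial (Fin (n + 1)) ℂ) :
    X (Fin.last n) ∣ p - rename Fin.castSucc (resVar n p) := by
  let J : Ideal (MvPolynomial (Fin (n + 1)) ℂ) := Ideal.span {X (Fin.last n)}
  have e : (Ideal.Quotient.mkₐ ℂ J).comp ((rename Fin.castSucc).comp (resVar n)) =
      Ideal.Quotient.mkₐ ℂ J := by
    refine MvPolynomial.algHom_ext fun d => ?_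
    rw [AlgHom.comp_apply, AlgHom.comp_apply]
    induction d using Fin.lastCases with
    | last =>
      rw [resVar_X_last, map_zero]
      refine Ideal.Quotient.eq.2 ?_
      rw [zero_sub, neg_mem_iff]
      exact Ideal.subset_span rfl
    | cast i => rw [resVar_X_castSucc, rename_X]
  have := congrArg (fun f => f p) e
  exact Ideal.mem_span_singleton.1 (Ideal.Quotient.eq.1 this.symm)

theorem X_last_dvd_of_resVar {p : MvPolynomial (Fin (n + 1)) ℂ} (h : resVar n p = 0) :
    X (Fin.last n) ∣ p := by
  simpa [h] using X_last_dvd_sub p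

theorem coeff_resVar (p : MvPolynomial (Fin (n + 1)) ℂ) (m : Fin n →₀ ℕ) :
    coeff m (resVar n p) = coeff (m.mapDomain Fin.castSucc) p := by
  obtain ⟨r, hr⟩ := X_last_dvd_sub p
  have h1 : p = rename Fin.castSucc (resVar n p) + X (Fin.last n) * r := by rw [← hr]; ring
  have h2 : Fin.last n ∉ (m.mapDomain Fin.castSucc).support := by
    rw [Finsupp.notMem_support_iff, Finsupp.mapDomain_of_notMem_range]
    rintro ⟨i, hi⟩
    exact (Fin.castSucc_lt_last i).ne hi
  conv_rhs => rw [h1]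
  rw [coeff_add, coeff_rename_mapDomain _ (Fin.castSucc_injective n), coeff_X_mul', if_neg h2,
    add_zero]

/-- The integral powers of 2 are distinct, so the single dilation by 2 detects the degree of each
monomial. Unlike a condition on supports, it extends to rational functions. -/
theorem scaleVar_two_iff (p : MvPolynomial (Fin n) ℂ) (d : ℤ) :
    scaleVar (fun _ => 2) p = (2 : ℂ) ^ d • p ↔
      ∀ m, coeff m p ≠ 0 → ∑ i, (m i : ℤ) = d := by
  have e : ∀ m : Fin n →₀ ℕ, (m.prod fun _ k => (2 : ℂ) ^ k) = (2 : ℂ) ^ (∑ i, (m i : ℤ)) := by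
    intro m
    rw [Finsupp.prod_fintype _ _ (by simp), Finset.prod_pow_eq_pow_sum, ← zpow_natCast]
    push_cast
    rfl
  have inj : Function.Injective fun k : ℤ => (2 : ℂ) ^ k := by
    intro a b hab
    have : (2 : ℝ) ^ a = (2 : ℝ) ^ b := by
      simpa [norm_zpow] using congrArg norm hab
    exact zpow_right_injective₀ (by norm_num) (by norm_num) this
  constructor
  · intro h m hm
    have := congrArg (coeff m) h
    rw [coeff_scaleVar, coeff_smul, smul_eq_mul, e] at this
    exact inj (mul_right_cancel₀ hm this)
  · intro h
    ext m
    rw [coeff_scaleVar, coeff_smul, smul_eq_mul, e]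
    by_cases hm : coeff m p = 0
    · rw [hm, mul_zero, mul_zero]
    · rw [h m hm]

theorem scaleVar_resVar (p : MvPolynomial (Fin (n + 1)) ℂ) :
    scaleVar (fun _ => 2) (resVar n p) = resVar n (scaleVar (fun _ => 2) p) := by
  rw [← AlgHom.comp_apply, ← AlgHom.comp_apply]
  congr 1
  refine MvPolynomial.algHom_ext fun d => ?_
  rw [AlgHom.comp_apply, AlgHom.comp_apply, scaleVar_X, map_mul, algHom_C]
  induction d using Fin.lastCases with
  | last => rw [resVar_X_last, map_zero, mul_zero]
  | cast i => rw [resVar_X_castSucc, scaleVar_X]; rfl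

/-- The extension of a permutation of the first `n` variables. -/
def extPerm (τ : Equiv.Perm (Fin n)) : Equiv.Perm (Fin (n + 1)) where
  toFun := Fin.snoc (α := fun _ => Fin (n + 1)) (fun i => (τ i).castSucc) (Fin.last n)
  invFun := Fin.snoc (α := fun _ => Fin (n + 1)) (fun i => (τ.symm i).castSucc) (Fin.last n)
  left_inv i := by induction i using Fin.lastCases <;> simp
  right_inv i := by induction i using Fin.lastCases <;> simp

theorem extPerm_castSucc (τ : Equiv.Perm (Fin n)) (i : Fin n) :
    extPerm τ i.castSucc = (τ i).castSucc := by simp [extPerm]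

theorem extPerm_last (τ : Equiv.Perm (Fin n)) : extPerm τ (Fin.last n) = Fin.last n := by
  simp [extPerm]

theorem rename_resVar (τ : Equiv.Perm (Fin n)) (p : MvPolynomial (Fin (n + 1)) ℂ) :
    rename τ (resVar n p) = resVar n (rename (extPerm τ) p) := by
  rw [← AlgHom.comp_apply, ← AlgHom.comp_apply]
  congr 1
  refine MvPolynomial.algHom_ext fun d => ?_
  rw [AlgHom.comp_apply, AlgHom.comp_apply, rename_X]
  induction d using Fin.lastCases with
  | last => rw [extPerm_last, resVar_X_last, map_zero]
  | cast i => rw [extPerm_castSucc, resVar_X_castSucc, resVar_X_castSucc, rename_X]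

theorem map_castSucc_map (τ : Equiv.Perm (Fin n)) (I : Finset (Fin n)) :
    (I.map Fin.castSuccEmb).map (extPerm τ).toEmbedding =
      (I.map τ.toEmbedding).map Fin.castSuccEmb := by
  rw [Finset.map_map, Finset.map_map]
  congr 1
  ext i
  simp [extPerm_castSucc]

/-- The restriction of a family to `x_n = 0`, on the subsets which do not contain `n`. -/
noncomputable def resFam (n : ℕ) : (Finset (Fin (n + 1)) → MvPolynomial (Fin (n + 1)) ℂ) →ₗ[ℂ]
    Finset (Fin n) → MvPolynomial (Fin n) ℂ where
  toFun g I := resVar n (g (I.map Fin.castSuccEmb))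
  map_add' g h := by ext1 I; simp
  map_smul' c g := by ext1 I; simp

theorem resFam_apply (g : Finset (Fin (n + 1)) → MvPolynomial (Fin (n + 1)) ℂ)
    (I : Finset (Fin n)) : resFam n g I = resVar n (g (I.map Fin.castSuccEmb)) := rfl

theorem resFam_mem {l d : ℤ} {g : Finset (Fin (n + 1)) → MvPolynomial (Fin (n + 1)) ℂ}
    (hg : g ∈ EqFam (n + 1) l d) : resFam n g ∈ EqFam n l d := by
  refine ⟨fun I hI => ?_, fun τ I => ?_, fun I => ?_⟩
  · rw [resFam_apply, hg.1 _ (by rwa [Finset.card_map]), map_zero]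
  · rw [resFam_apply, rename_resVar, hg.2.1, map_castSucc_map, resFam_apply]
  · rw [resFam_apply, scaleVar_resVar, hg.2.2, map_smul]

/-- The family indexed by the complements. -/
def flipFam (n : ℕ) : (Finset (Fin n) → MvPolynomial (Fin n) ℂ) →ₗ[ℂ]
    Finset (Fin n) → MvPolynomial (Fin n) ℂ where
  toFun g I := g Iᶜ
  map_add' _ _ := rfl
  map_smul' _ _ := rfl

theorem flipFam_apply (g : Finset (Fin n) → MvPolynomial (Fin n) ℂ) (I : Finset (Fin n)) :
    flipFam n g I = g Iᶜ := rfl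

theorem flipFam_flipFam (g : Finset (Fin n) → MvPolynomial (Fin n) ℂ) :
    flipFam n (flipFam n g) = g := by
  ext1 I
  rw [flipFam_apply, flipFam_apply, compl_compl]

theorem map_perm_compl (τ : Equiv.Perm (Fin n)) (I : Finset (Fin n)) :
    (I.map τ.toEmbedding)ᶜ = Iᶜ.map τ.toEmbedding := by
  ext b; simp [Finset.mem_map_equiv]

theorem card_compl_int (I : Finset (Fin n)) : (Iᶜ.card : ℤ) = n - I.card := by
  have := Finset.card_add_card_compl I
  rw [Fintype.card_fin] at this
  omega

theorem flipFam_mem {l d : ℤ} {g : Finset (Fin n) → MvPolynomial (Fin n) ℂ}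
    (hg : g ∈ EqFam n l d) : flipFam n g ∈ EqFam n (n - l) d := by
  refine ⟨fun I hI => ?_, fun τ I => ?_, fun I => ?_⟩
  · refine hg.1 _ ?_
    rw [card_compl_int]
    omega
  · rw [flipFam_apply, flipFam_apply, hg.2.1, map_perm_compl]
  · exact hg.2.2 _

theorem flipFam_mem' {l d : ℤ} {g : Finset (Fin n) → MvPolynomial (Fin n) ℂ}
    (hg : g ∈ EqFam n (n - l) d) : flipFam n g ∈ EqFam n l d := by
  simpa using flipFam_mem hg

/-- The product of a family with `∏_{j ∉ I} x_j`. -/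
noncomputable def mulCompl (n : ℕ) : (Finset (Fin n) → MvPolynomial (Fin n) ℂ) →ₗ[ℂ]
    Finset (Fin n) → MvPolynomial (Fin n) ℂ where
  toFun g I := (∏ j ∈ Iᶜ, X j) * g I
  map_add' g h := by ext1 I; simp [mul_add]
  map_smul' c g := by ext1 I; simp

theorem mulCompl_apply (g : Finset (Fin n) → MvPolynomial (Fin n) ℂ) (I : Finset (Fin n)) :
    mulCompl n g I = (∏ j ∈ Iᶜ, X j) * g I := rfl

theorem prod_X_ne_zero (I : Finset (Fin n)) : (∏ j ∈ I, X j : MvPolynomial (Fin n) ℂ) ≠ 0 :=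
  Finset.prod_ne_zero_iff.2 fun _ _ => X_ne_zero _

theorem mulCompl_injective : Function.Injective (mulCompl n) := fun g h e => by
  ext1 I
  exact mul_left_cancel₀ (prod_X_ne_zero _) (congrFun e I)

theorem rename_prod_X (τ : Equiv.Perm (Fin n)) (I : Finset (Fin n)) :
    rename τ (∏ j ∈ I, X j : MvPolynomial (Fin n) ℂ) = ∏ j ∈ I.map τ.toEmbedding, X j := by
  rw [map_prod, Finset.prod_map]
  simp

theorem scaleVar_prod_X (I : Finset (Fin n)) :
    scaleVar (fun _ => 2) (∏ j ∈ I, X j : MvPolynomial (Fin n) ℂ) =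
      (2 : ℂ) ^ (I.card : ℤ) • ∏ j ∈ I, X j := by
  rw [map_prod]
  simp only [scaleVar_X]
  rw [Finset.prod_mul_distrib, Finset.prod_const, zpow_natCast, ← C_pow, C_mul']

theorem mulCompl_mem_iff {l d : ℤ} {g : Finset (Fin n) → MvPolynomial (Fin n) ℂ} :
    mulCompl n g ∈ EqFam n l (d + (n - l)) ↔ g ∈ EqFam n l d := by
  have h2 : ∀ k : ℤ, (2 : ℂ) ^ k ≠ 0 := fun k => zpow_ne_zero _ two_ne_zero
  constructor
  · intro h
    have h1 : ∀ I : Finset (Fin n), (I.card : ℤ) ≠ l → g I = 0 := fun I hI =>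
      (mul_eq_zero.1 (h.1 I hI)).resolve_left (prod_X_ne_zero _)
    refine ⟨h1, fun τ I => ?_, fun I => ?_⟩
    · have := h.2.1 τ I
      rw [mulCompl_apply, mulCompl_apply, map_mul, rename_prod_X, map_perm_compl] at this
      exact mul_left_cancel₀ (prod_X_ne_zero _) this
    · by_cases hI : (I.card : ℤ) = l
      · have := h.2.2 I
        rw [mulCompl_apply, map_mul, scaleVar_prod_X, card_compl_int, hI, add_comm d,
          zpow_add₀ two_ne_zero, mul_smul, smul_mul_assoc] at this
        have := smul_right_injective _ (h2 _) this
        rw [← mul_smul_comm] at this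
        exact mul_left_cancel₀ (prod_X_ne_zero _) this
      · rw [h1 I hI, map_zero, smul_zero]
  · intro h
    refine ⟨fun I hI => ?_, fun τ I => ?_, fun I => ?_⟩
    · rw [mulCompl_apply, h.1 I hI, mul_zero]
    · rw [mulCompl_apply, mulCompl_apply, map_mul, rename_prod_X, map_perm_compl, h.2.1]
    · by_cases hI : (I.card : ℤ) = l
      · rw [mulCompl_apply, map_mul, scaleVar_prod_X, card_compl_int, hI, h.2.2, add_comm d,
          zpow_add₀ two_ne_zero, mul_smul, smul_mul_assoc, mul_smul_comm]
      · rw [mulCompl_apply, h.1 I hI, mul_zero, map_zero, smul_zero]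

/-- The hypothesis says that the last variable divides g_I whenever I does not contain the last
index. Equivariance gives the same for x_j with any j ∉ I, and distinct variables are coprime. -/
theorem exists_mulCompl_of_resFam_eq_zero {l d : ℤ}
    {g : Finset (Fin (n + 1)) → MvPolynomial (Fin (n + 1)) ℂ} (hg : g ∈ EqFam (n + 1) l d)
    (h : resFam n g = 0) : ∃ g' ∈ EqFam (n + 1) l (d - ((n + 1 : ℕ) - l)), mulCompl _ g' = g := by
  have hlast : ∀ I, Fin.last n ∉ I → X (Fin.last n) ∣ g I := by
    intro I hI
    have hI' : (I.preimage Fin.castSucc (Fin.castSucc_injective n).injOn).map Fin.castSuccEmb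
        = I := by
      ext j
      induction j using Fin.lastCases with
      | last =>
        simp only [Finset.mem_map, Finset.mem_preimage, Fin.coe_castSuccEmb, hI, iff_false]
        rintro ⟨a, -, ha⟩
        exact (Fin.castSucc_lt_last a).ne ha
      | cast i => simp
    have := congrFun h (I.preimage Fin.castSucc (Fin.castSucc_injective n).injOn)
    rw [resFam_apply, hI'] at this
    exact X_last_dvd_of_resVar this
  have hdvd : ∀ I, (∏ j ∈ Iᶜ, X j) ∣ g I := by
    intro I
    refine Finset.prod_dvd_of_isRelPrime (fun i _ j _ hij => ?_) fun j hj => ?_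
    · have hp : Prime (X i : MvPolynomial (Fin (n + 1)) ℂ) := X_prime
      exact hp.irreducible.isRelPrime_iff_not_dvd.2 fun hd => hij (X_dvd_X.1 hd)
    · set τ := Equiv.swap j (Fin.last n)
      have h1 : Fin.last n ∉ I.map τ.toEmbedding := by
        rw [Finset.mem_map_equiv, Equiv.symm_swap, Equiv.swap_apply_right]
        exact Finset.mem_compl.1 hj
      have h2 := map_dvd (rename τ : _ →ₐ[ℂ] MvPolynomial (Fin (n + 1)) ℂ) (hlast _ h1)
      rw [rename_X, Equiv.swap_apply_right, hg.2.1, Finset.map_map] at h2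
      convert h2 using 2
      ext c
      simp [τ]
  choose g' hg' using hdvd
  have e : mulCompl _ g' = g := funext fun I => (hg' I).symm
  refine ⟨g', ?_, e⟩
  rw [← mulCompl_mem_iff, e]
  simpa using hg

end Restriction

/-! ### Lifting families along x_n = 0. -/

section Lift

variable {n : ℕ}

/-- The exponents of all variables except for the one labelled by the image of the last index. -/
noncomputable def pullExp (τ : Equiv.Perm (Fin (n + 1))) (m : Fin (n + 1) →₀ ℕ) : Fin n →₀ ℕ :=
  Finsupp.equivFunOnFinite.symm fun j => m (τ j.castSucc)

theorem pullExp_apply (τ : Equiv.Perm (Fin (n + 1))) (m : Fin (n + 1) →₀ ℕ) (j : Fin n) :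
    pullExp τ m j = m (τ j.castSucc) := rfl

/-- The subset of the first `n` labels corresponding to a subset of all labels. -/
def pullSet (τ : Equiv.Perm (Fin (n + 1))) (I : Finset (Fin (n + 1))) : Finset (Fin n) :=
  Finset.univ.filter fun j => τ j.castSucc ∈ I

theorem mem_pullSet (τ : Equiv.Perm (Fin (n + 1))) (I : Finset (Fin (n + 1))) (j : Fin n) :
    j ∈ pullSet τ I ↔ τ j.castSucc ∈ I := by simp [pullSet]

theorem card_pullSet {τ : Equiv.Perm (Fin (n + 1))} {I : Finset (Fin (n + 1))}
    (h : τ (Fin.last n) ∉ I) : (pullSet τ I).card = I.card := by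
  rw [← Finset.card_map (Fin.castSuccEmb.trans τ.toEmbedding)]
  congr 1
  ext j
  simp only [Finset.mem_map, mem_pullSet, Function.Embedding.trans_apply, Fin.coe_castSuccEmb,
    Equiv.coe_toEmbedding]
  constructor
  · rintro ⟨i, hi, rfl⟩
    exact hi
  · intro hj
    obtain ⟨i, rfl⟩ := τ.surjective j
    induction i using Fin.lastCases with
    | last => exact absurd hj h
    | cast i => exact ⟨i, hj, rfl⟩

theorem sum_pullExp {τ : Equiv.Perm (Fin (n + 1))} {m : Fin (n + 1) →₀ ℕ}
    (h : m (τ (Fin.last n)) = 0) : ∑ j, (pullExp τ m j : ℤ) = ∑ j, (m j : ℤ) := by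
  rw [← Equiv.sum_comp τ, Fin.sum_univ_castSucc, h]
  simp [pullExp_apply]

/-- Well-definedness of the lift. Two labels outside I at which the exponent m vanishes are
exchanged by a transposition preserving both I and m. Hence the two relabellings differ by a
permutation of the first n labels, which the equivariance of v absorbs. -/
theorem coeff_pull_eq {l d : ℤ} {v : Finset (Fin n) → MvPolynomial (Fin n) ℂ}
    (hv : v ∈ EqFam n l d) {I : Finset (Fin (n + 1))} {m : Fin (n + 1) →₀ ℕ}
    {τ τ' : Equiv.Perm (Fin (n + 1))} (h : τ (Fin.last n) ∉ I ∧ m (τ (Fin.last n)) = 0)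
    (h' : τ' (Fin.last n) ∉ I ∧ m (τ' (Fin.last n)) = 0) :
    coeff (pullExp τ m) (v (pullSet τ I)) = coeff (pullExp τ' m) (v (pullSet τ' I)) := by
  set s := Equiv.swap (τ (Fin.last n)) (τ' (Fin.last n)) with hs
  have hsm : ∀ j, m (s j) = m j := by
    intro j
    rw [hs, Equiv.swap_apply_def]
    split_ifs with h1 h2
    · rw [h1, h.2, h'.2]
    · rw [h2, h.2, h'.2]
    · rfl
  have hsI : ∀ j, s j ∈ I ↔ j ∈ I := by
    intro j
    rw [hs, Equiv.swap_apply_def]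
    split_ifs with h1 h2
    · rw [h1]; exact iff_of_false h'.1 h.1
    · rw [h2]; exact iff_of_false h.1 h'.1
    · rfl
  set π := (τ'.trans s).trans τ.symm with hπ
  have hlast : π (Fin.last n) = Fin.last n := by simp [hπ, hs]
  have hex : ∀ i : Fin n, ∃ j : Fin n, j.castSucc = π i.castSucc := by
    intro i
    refine Fin.exists_castSucc_eq.2 fun e => ?_
    exact (Fin.castSucc_lt_last i).ne (π.injective (e.trans hlast.symm))
  choose ρ hρ using hex
  have hρi : Function.Injective ρ := fun i j e => by
    apply Fin.castSucc_injective n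
    apply π.injective
    rw [← hρ, ← hρ, e]
  let ρ' : Equiv.Perm (Fin n) := Equiv.ofBijective ρ (Finite.injective_iff_bijective.1 hρi)
  have hρ' : ∀ i, τ (ρ' i).castSucc = s (τ' i.castSucc) := fun i => by
    change τ (ρ i).castSucc = _
    rw [hρ]
    simp [hπ]
  have e1 : pullExp τ m = (pullExp τ' m).mapDomain ρ' := by
    ext j
    obtain ⟨i, rfl⟩ := ρ'.surjective j
    rw [Finsupp.mapDomain_apply ρ'.injective, pullExp_apply, pullExp_apply, hρ', hsm]
  have e2 : pullSet τ I = (pullSet τ' I).map ρ'.toEmbedding := by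
    ext j
    obtain ⟨i, rfl⟩ := ρ'.surjective j
    rw [Finset.mem_map_equiv, Equiv.symm_apply_apply, mem_pullSet, mem_pullSet, hρ', hsI]
  rw [e1, e2, ← hv.2.1, coeff_rename_mapDomain _ ρ'.injective]

open Classical in
/-- The coefficients of a lift. -/
noncomputable def liftCoeff (v : Finset (Fin n) → MvPolynomial (Fin n) ℂ)
    (I : Finset (Fin (n + 1))) (m : Fin (n + 1) →₀ ℕ) : ℂ :=
  -- If some variable with label outside I is absent from the monomial, that label is renamed to the
  -- last one and the coefficient of v is used. Every other monomial gets coefficient 0.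
  if h : ∃ τ : Equiv.Perm (Fin (n + 1)), τ (Fin.last n) ∉ I ∧ m (τ (Fin.last n)) = 0 then
    coeff (pullExp h.choose m) (v (pullSet h.choose I)) else 0

theorem liftCoeff_eq {l d : ℤ} {v : Finset (Fin n) → MvPolynomial (Fin n) ℂ}
    (hv : v ∈ EqFam n l d) {I : Finset (Fin (n + 1))} {m : Fin (n + 1) →₀ ℕ}
    {τ : Equiv.Perm (Fin (n + 1))} (h : τ (Fin.last n) ∉ I ∧ m (τ (Fin.last n)) = 0) :
    liftCoeff v I m = coeff (pullExp τ m) (v (pullSet τ I)) := by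
  have hex : ∃ τ : Equiv.Perm (Fin (n + 1)), τ (Fin.last n) ∉ I ∧ m (τ (Fin.last n)) = 0 := ⟨τ, h⟩
  rw [liftCoeff, dif_pos hex]
  exact coeff_pull_eq hv hex.choose_spec h

theorem exists_of_liftCoeff_ne_zero {v : Finset (Fin n) → MvPolynomial (Fin n) ℂ}
    {I : Finset (Fin (n + 1))} {m : Fin (n + 1) →₀ ℕ} (h : liftCoeff v I m ≠ 0) :
    ∃ τ : Equiv.Perm (Fin (n + 1)), (τ (Fin.last n) ∉ I ∧ m (τ (Fin.last n)) = 0) ∧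
      coeff (pullExp τ m) (v (pullSet τ I)) ≠ 0 := by
  rw [liftCoeff] at h
  split_ifs at h with hex
  · exact ⟨hex.choose, hex.choose_spec, h⟩
  · exact absurd rfl h

theorem finite_liftCoeff (v : Finset (Fin n) → MvPolynomial (Fin n) ℂ)
    (I : Finset (Fin (n + 1))) : {m | liftCoeff v I m ≠ 0}.Finite := by
  have : {m | liftCoeff v I m ≠ 0} ⊆ ⋃ τ : Equiv.Perm (Fin (n + 1)),
      {m | m (τ (Fin.last n)) = 0 ∧ pullExp τ m ∈ (v (pullSet τ I)).support} := by
    intro m hm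
    obtain ⟨τ, h1, h2⟩ := exists_of_liftCoeff_ne_zero hm
    exact Set.mem_iUnion.2 ⟨τ, h1.2, mem_support_iff.2 h2⟩
  refine (Set.finite_iUnion fun τ => ?_).subset this
  refine Set.Finite.of_finite_image (f := pullExp τ)
    ((v (pullSet τ I)).support.finite_toSet.subset ?_) ?_
  · rintro _ ⟨m, hm, rfl⟩
    exact hm.2
  · intro m hm m' hm' e
    ext j
    obtain ⟨i, rfl⟩ := τ.surjective j
    induction i using Fin.lastCases with
    | last => rw [hm.1, hm'.1]
    | cast i => exact DFunLike.congr_fun e i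

/-- A lift of a family. -/
noncomputable def liftFam (v : Finset (Fin n) → MvPolynomial (Fin n) ℂ)
    (I : Finset (Fin (n + 1))) : MvPolynomial (Fin (n + 1)) ℂ :=
  ∑ m ∈ (finite_liftCoeff v I).toFinset, monomial m (liftCoeff v I m)

theorem coeff_liftFam (v : Finset (Fin n) → MvPolynomial (Fin n) ℂ)
    (I : Finset (Fin (n + 1))) (m : Fin (n + 1) →₀ ℕ) :
    coeff m (liftFam v I) = liftCoeff v I m := by
  classical
  rw [liftFam, coeff_sum]
  simp only [coeff_monomial]
  rw [Finset.sum_ite_eq']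
  split_ifs with h
  · rfl
  · simpa using Eq.symm (by simpa using h)

theorem liftFam_mem {l d : ℤ} {v : Finset (Fin n) → MvPolynomial (Fin n) ℂ}
    (hv : v ∈ EqFam n l d) : liftFam v ∈ EqFam (n + 1) l d := by
  refine ⟨fun I hI => ?_, fun σ I => ?_, fun I => ?_⟩
  · ext m
    rw [coeff_liftFam, coeff_zero]
    by_contra h
    obtain ⟨τ, h1, h2⟩ := exists_of_liftCoeff_ne_zero h
    rw [hv.1 _ (by rwa [card_pullSet h1.1])] at h2
    exact h2 (coeff_zero _)
  · ext m
    obtain ⟨m, rfl⟩ : ∃ m', m'.mapDomain σ = m :=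
      ⟨m.mapDomain σ.symm, by rw [← Finsupp.mapDomain_comp]; simp⟩
    have key : ∀ τ : Equiv.Perm (Fin (n + 1)),
        (τ (Fin.last n) ∉ I ∧ m (τ (Fin.last n)) = 0) ↔
        ((τ.trans σ) (Fin.last n) ∉ I.map σ.toEmbedding ∧
          m.mapDomain σ ((τ.trans σ) (Fin.last n)) = 0) := by
      intro τ
      rw [Finset.mem_map_equiv, Equiv.trans_apply, Equiv.symm_apply_apply,
        Finsupp.mapDomain_apply σ.injective]
    rw [coeff_rename_mapDomain _ σ.injective, coeff_liftFam, coeff_liftFam]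
    by_cases hex : ∃ τ : Equiv.Perm (Fin (n + 1)), τ (Fin.last n) ∉ I ∧ m (τ (Fin.last n)) = 0
    · obtain ⟨τ, h⟩ := hex
      have e1 : pullExp (τ.trans σ) (m.mapDomain σ) = pullExp τ m := by
        ext j
        rw [pullExp_apply, pullExp_apply, Equiv.trans_apply, Finsupp.mapDomain_apply σ.injective]
      have e2 : pullSet (τ.trans σ) (I.map σ.toEmbedding) = pullSet τ I := by
        ext j
        rw [mem_pullSet, mem_pullSet, Finset.mem_map_equiv, Equiv.trans_apply,
          Equiv.symm_apply_apply]
      rw [liftCoeff_eq hv h, liftCoeff_eq hv ((key τ).1 h), e1, e2]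
    · have hex' : ¬ ∃ τ : Equiv.Perm (Fin (n + 1)), τ (Fin.last n) ∉ I.map σ.toEmbedding ∧
          m.mapDomain σ (τ (Fin.last n)) = 0 := by
        rintro ⟨τ, h⟩
        refine hex ⟨τ.trans σ.symm, (key _).2 ?_⟩
        simpa using h
      rw [liftCoeff, liftCoeff, dif_neg hex, dif_neg hex']
  · rw [scaleVar_two_iff]
    intro m hm
    rw [coeff_liftFam] at hm
    obtain ⟨τ, h1, h2⟩ := exists_of_liftCoeff_ne_zero hm
    rw [← sum_pullExp h1.2]
    exact (scaleVar_two_iff _ _).1 (hv.2.2 _) _ h2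

theorem resFam_liftFam {l d : ℤ} {v : Finset (Fin n) → MvPolynomial (Fin n) ℂ}
    (hv : v ∈ EqFam n l d) : resFam n (liftFam v) = v := by
  ext1 I
  ext m
  have hne : ∀ i : Fin n, i.castSucc ≠ Fin.last n := fun i => (Fin.castSucc_lt_last i).ne
  rw [resFam_apply, coeff_resVar, coeff_liftFam, liftCoeff_eq hv (τ := 1)]
  · congr 2
    · ext j
      rw [pullExp_apply, Equiv.Perm.one_apply, Finsupp.mapDomain_apply (Fin.castSucc_injective n)]
    · ext j
      rw [mem_pullSet, Equiv.Perm.one_apply]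
      simp
  · refine ⟨?_, ?_⟩
    · simp [hne]
    · rw [Equiv.Perm.one_apply, Finsupp.mapDomain_of_notMem_range]
      rintro ⟨i, hi⟩
      exact hne i hi

theorem exists_lift {l d : ℤ} {v : Finset (Fin n) → MvPolynomial (Fin n) ℂ}
    (hv : v ∈ EqFam n l d) : ∃ u ∈ EqFam (n + 1) l d, resFam n u = v :=
  ⟨liftFam v, liftFam_mem hv, resFam_liftFam hv⟩

end Lift

/-! ### Finite dimensionality and the recursion for the dimensions of spaces of families. -/

section Dimension

instance eqFam_finite (n : ℕ) (l d : ℤ) : Module.Finite ℂ (EqFam n l d) := by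
  let f : EqFam n l d →ₗ[ℂ] Finset (Fin n) → restrictTotalDegree (Fin n) ℂ d.toNat :=
    LinearMap.pi fun I => LinearMap.codRestrict _
      ((LinearMap.proj I).comp (EqFam n l d).subtype) fun g => by
        rw [mem_restrictTotalDegree]
        refine Finset.sup_le fun m hm => ?_
        have := (scaleVar_two_iff _ _).1 (g.2.2.2 I) m (mem_support_iff.1 hm)
        rw [Finsupp.sum_fintype _ _ (by simp)]
        zify
        omega
  refine Module.Finite.of_injective f fun g h e => ?_
  ext1
  funext I
  exact congrArg Subtype.val (congrFun e I)

theorem eqFam_eq_bot_of_neg (n : ℕ) (l : ℤ) {d : ℤ} (hd : d < 0) : EqFam n l d = ⊥ := by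
  rw [eq_bot_iff]
  intro g hg
  refine (Submodule.mem_bot ℂ).2 (funext fun I => ?_)
  ext m
  by_contra h
  have := (scaleVar_two_iff _ _).1 (hg.2.2 I) m h
  have h2 : (0 : ℤ) ≤ ∑ i, (m i : ℤ) := Finset.sum_nonneg fun _ _ => by positivity
  omega

theorem eqFam_eq_bot_of_card (n : ℕ) {l : ℤ} (d : ℤ) (hl : l < 0 ∨ (n : ℤ) < l) :
    EqFam n l d = ⊥ := by
  rw [eq_bot_iff]
  intro g hg
  refine (Submodule.mem_bot ℂ).2 (funext fun I => hg.1 I ?_)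
  have := card_finset_fin_le I
  omega

/-- The dimension of the space of homogeneous equivariant families. -/
noncomputable def eqDim (n : ℕ) (l d : ℤ) : ℕ := Module.finrank ℂ (EqFam n l d)

theorem eqDim_flip (n : ℕ) (l d : ℤ) : eqDim n (n - l) d = eqDim n l d := by
  have e : ∀ l, eqDim n l d ≤ eqDim n (n - l) d := fun l => by
    let f : EqFam n l d →ₗ[ℂ] EqFam n (n - l) d :=
      (flipFam n).restrict fun g hg => flipFam_mem hg
    refine LinearMap.finrank_le_finrank_of_injective (f := f) fun g h e => ?_
    ext1
    have := congrArg (flipFam n) (congrArg Subtype.val e)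
    simpa [f, flipFam_flipFam] using this
  refine le_antisymm ?_ (e l)
  simpa using e (n - l)

/-- Rank and nullity of the restriction to the vanishing of the last variable: it is surjective
because families lift, and its kernel consists of the multiples of ∏_{j ∉ I} x_j, a product of
degree n + 1 - l. -/
theorem eqDim_succ (n : ℕ) (l d : ℤ) :
    eqDim (n + 1) l d = eqDim n l d + eqDim (n + 1) l (d - ((n + 1 : ℕ) - l)) := by
  let f : EqFam (n + 1) l d →ₗ[ℂ] EqFam n l d := (resFam n).restrict fun g hg => resFam_mem hg
  have hf : Function.Surjective f := fun v => by
    obtain ⟨u, hu, h⟩ := exists_lift v.2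
    exact ⟨⟨u, hu⟩, Subtype.ext h⟩
  have hmem : ∀ g ∈ EqFam (n + 1) l (d - ((n + 1 : ℕ) - l)),
      mulCompl (n + 1) g ∈ EqFam (n + 1) l d := fun g hg => by
    simpa using mulCompl_mem_iff.2 hg
  let k : EqFam (n + 1) l (d - ((n + 1 : ℕ) - l)) →ₗ[ℂ] EqFam (n + 1) l d :=
    (mulCompl (n + 1)).restrict hmem
  have hk : Function.Injective k := fun g h e => by
    ext1
    exact mulCompl_injective (congrArg Subtype.val e)
  have hker : LinearMap.ker f = LinearMap.range k := by
    ext g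
    rw [LinearMap.mem_ker, LinearMap.mem_range]
    constructor
    · intro h
      obtain ⟨g', hg', e⟩ := exists_mulCompl_of_resFam_eq_zero g.2 (congrArg Subtype.val h)
      exact ⟨⟨g', hg'⟩, Subtype.ext e⟩
    · rintro ⟨g', rfl⟩
      refine Subtype.ext (funext fun I => ?_)
      change resVar n (mulCompl (n + 1) g' (I.map Fin.castSuccEmb)) = 0
      rw [mulCompl_apply, map_mul, map_prod, Finset.prod_eq_zero (i := Fin.last n) _ resVar_X_last,
        zero_mul]
      simp [fun i : Fin n => (Fin.castSucc_lt_last i).ne]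
  have := LinearMap.finrank_range_add_finrank_ker f
  rw [LinearMap.range_eq_top.2 hf, finrank_top, hker, LinearMap.finrank_range_of_inj hk] at this
  exact this.symm

end Dimension

/-! ### Creation operators under x_n = 0 and under multiplication by products of variables. -/

section Specialization

variable {n : ℕ}

theorem sum_wt_mul_prod {L : Type*} [Field L] (y : Fin n → L) (hy : Function.Injective y)
    (ξ v : Fin n → L) (I : Finset (Fin n)) :
    (∏ c ∈ I, ∏ b ∈ I.erase c, (y c - y b)) * (∑ a ∈ I, ξ a * wt y a (I.erase a) * v a) =
      ∑ a ∈ I, ξ a * (∏ b ∈ I.erase a, (y a + y b)) *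
        (∏ c ∈ I.erase a, ∏ b ∈ I.erase c, (y c - y b)) * v a := by
  rw [Finset.mul_sum]
  refine Finset.sum_congr rfl fun a ha => ?_
  have h : (∏ b ∈ I.erase a, (y a - y b)) * wt y a (I.erase a) =
      ∏ b ∈ I.erase a, (y a + y b) := by
    rw [wt, ← Finset.prod_mul_distrib]
    refine Finset.prod_congr rfl fun b hb => mul_div_cancel₀ _ ?_
    exact sub_ne_zero.2 fun e => Finset.ne_of_mem_erase hb (hy e).symm
  rw [← Finset.mul_prod_erase I _ ha, ← h]
  ring

/-- The relation between a family and its image under a creation operator specializes. -/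
theorem crVec_specialize {L : Type*} [Field L] (φ : MvPolynomial (Fin n) ℂ →+* L)
    (hφ : Function.Injective fun i => φ (X i)) (k : ℕ)
    {u h : Finset (Fin n) → MvPolynomial (Fin n) ℂ}
    (hu : famRat h = crVec (pt n) (fun i => pt n i ^ k) (famRat u)) (I : Finset (Fin n)) :
    φ (h I) = ∑ a ∈ I, φ (X a) ^ k * wt (fun i => φ (X i)) a (I.erase a) * φ (u (I.erase a)) := by
  have hpt : Function.Injective (pt n) := fun a b hab => by
    by_contra hne
    exact (generic_pt n).sub_ne a b hne (sub_eq_zero.2 hab)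
  -- Clearing the denominators with all ordered differences gives a polynomial identity, to which φ
  -- can be applied. The cleared factor stays nonzero because φ keeps the variables distinct.
  have e1 : (∏ c ∈ I, ∏ b ∈ I.erase c, (X c - X b)) * h I =
      ∑ a ∈ I, X a ^ k * (∏ b ∈ I.erase a, (X a + X b)) *
        (∏ c ∈ I.erase a, ∏ b ∈ I.erase c, (X c - X b)) * u (I.erase a) := by
    apply toRat_injective
    have := sum_wt_mul_prod (pt n) hpt (fun i => pt n i ^ k) (fun a => famRat u (I.erase a)) I
    rw [← crVec_apply, ← hu] at this
    simpa only [map_mul, map_sum, map_prod, map_sub, map_add, map_pow, famRat, pt] using this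
  have e2 := sum_wt_mul_prod (fun i => φ (X i)) hφ (fun i => φ (X i) ^ k)
    (fun a => φ (u (I.erase a))) I
  have e3 := congrArg φ e1
  simp only [map_mul, map_sum, map_prod, map_sub, map_add, map_pow] at e3
  rw [← e3] at e2
  refine (mul_left_cancel₀ ?_ e2).symm
  refine Finset.prod_ne_zero_iff.2 fun c _ => Finset.prod_ne_zero_iff.2 fun b hb => ?_
  exact sub_ne_zero.2 fun e => Finset.ne_of_mem_erase hb (hφ e).symm

theorem resVar_toRat_injective :
    Function.Injective fun i => ((toRat (Fin n)).comp (resVar n).toRingHom) (X i) := by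
  intro i j h
  have h' : resVar n (X i) = resVar n (X j) := toRat_injective h
  induction i using Fin.lastCases with
  | last =>
    induction j using Fin.lastCases with
    | last => rfl
    | cast j =>
      rw [resVar_X_castSucc, resVar_X_last] at h'
      exact absurd h'.symm (X_ne_zero j)
  | cast i =>
    induction j using Fin.lastCases with
    | last =>
      rw [resVar_X_castSucc, resVar_X_last] at h'
      exact absurd h' (X_ne_zero i)
    | cast j =>
      rw [resVar_X_castSucc, resVar_X_castSucc] at h'
      rw [X_injective h']

theorem resFam_crVec (k : ℕ) {u h : Finset (Fin (n + 1)) → MvPolynomial (Fin (n + 1)) ℂ}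
    (hu : famRat h = crVec (pt (n + 1)) (fun i => pt (n + 1) i ^ k) (famRat u)) :
    famRat (resFam n h) = crVec (pt n) (fun i => pt n i ^ k) (famRat (resFam n u)) := by
  ext I
  have := crVec_specialize ((toRat (Fin n)).comp (resVar n).toRingHom) resVar_toRat_injective k hu
    (I.map Fin.castSuccEmb)
  rw [crVec_apply]
  refine this.trans ?_
  rw [Finset.sum_map]
  refine Finset.sum_congr rfl fun a _ => ?_
  have e : ∀ i : Fin n, ((toRat (Fin n)).comp (resVar n).toRingHom) (X i.castSucc) = pt n i :=
    fun i => congrArg (toRat (Fin n)) (resVar_X_castSucc i)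
  rw [← Finset.map_erase, wt, Finset.prod_map, wt]
  simp only [Fin.coe_castSuccEmb, e]
  rfl

/-- The restriction of a family to `x_n = 0`, on the subsets which contain `n`. -/
noncomputable def resFamLast (n : ℕ) : (Finset (Fin (n + 1)) → MvPolynomial (Fin (n + 1)) ℂ) →ₗ[ℂ]
    Finset (Fin n) → MvPolynomial (Fin n) ℂ := flipFam n ∘ₗ resFam n ∘ₗ flipFam (n + 1)

theorem resFamLast_apply (g : Finset (Fin (n + 1)) → MvPolynomial (Fin (n + 1)) ℂ)
    (I : Finset (Fin n)) :
    resFamLast n g I = resVar n (g (insert (Fin.last n) (I.map Fin.castSuccEmb))) := by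
  change resVar n (g (Iᶜ.map Fin.castSuccEmb)ᶜ) = _
  congr 2
  ext j
  induction j using Fin.lastCases with
  | last => simp [fun i : Fin n => (Fin.castSucc_lt_last i).ne]
  | cast i => simp [(Fin.castSucc_lt_last i).ne]

theorem resFamLast_mem {l d : ℤ} {g : Finset (Fin (n + 1)) → MvPolynomial (Fin (n + 1)) ℂ}
    (hg : g ∈ EqFam (n + 1) l d) : resFamLast n g ∈ EqFam n (l - 1) d := by
  change flipFam n (resFam n (flipFam (n+1) g)) ∈ EqFam n (l - 1) d
  refine flipFam_mem' ?_
  convert resFam_mem (flipFam_mem hg) using 2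
  push_cast
  ring

theorem exists_liftLast {l d : ℤ} {v : Finset (Fin n) → MvPolynomial (Fin n) ℂ}
    (hv : v ∈ EqFam n l d) : ∃ u ∈ EqFam (n + 1) (l + 1) d, resFamLast n u = v := by
  obtain ⟨u, hu, e⟩ := exists_lift (flipFam_mem hv)
  refine ⟨flipFam (n + 1) u, flipFam_mem' ?_, ?_⟩
  · convert hu using 2
    push_cast
    ring
  · simp only [resFamLast, LinearMap.comp_apply, flipFam_flipFam, e]

/-- When the last variable is zero, the summand removing the last index vanishes because of its
coefficient, the first power of that variable. In the other summands the last index contributes the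
factor (x_a + 0)/(x_a - 0) = 1. -/
theorem resFamLast_crVec {u h : Finset (Fin (n + 1)) → MvPolynomial (Fin (n + 1)) ℂ}
    (hu : famRat h = crVec (pt (n + 1)) (fun i => pt (n + 1) i ^ 1) (famRat u)) :
    famRat (resFamLast n h) = crVec (pt n) (fun i => pt n i ^ 1) (famRat (resFamLast n u)) := by
  ext I
  have hl : Fin.last n ∉ I.map Fin.castSuccEmb := by
    simp [fun i : Fin n => (Fin.castSucc_lt_last i).ne]
  have := crVec_specialize ((toRat (Fin n)).comp (resVar n).toRingHom) resVar_toRat_injective 1 hu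
    (insert (Fin.last n) (I.map Fin.castSuccEmb))
  rw [crVec_apply, famRat, resFamLast_apply]
  refine this.trans ?_
  have e0 : ((toRat (Fin n)).comp (resVar n).toRingHom) (X (Fin.last n)) = 0 :=
    (congrArg (toRat (Fin n)) resVar_X_last).trans (map_zero _)
  have e : ∀ i : Fin n, ((toRat (Fin n)).comp (resVar n).toRingHom) (X i.castSucc) = pt n i :=
    fun i => congrArg (toRat (Fin n)) (resVar_X_castSucc i)
  rw [Finset.sum_insert hl, e0, zero_pow one_ne_zero, zero_mul, zero_mul, zero_add,
    Finset.sum_map]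
  refine Finset.sum_congr rfl fun a _ => ?_
  have hne : Fin.castSuccEmb a ≠ Fin.last n := (Fin.castSucc_lt_last a).ne
  have hl' : Fin.last n ∉ (I.erase a).map Fin.castSuccEmb := by
    simp [fun i : Fin n => (Fin.castSucc_lt_last i).ne]
  rw [Finset.erase_insert_of_ne hne.symm, ← Finset.map_erase, wt_insert _ hl', wt, Finset.prod_map,
    wt]
  simp only [Fin.coe_castSuccEmb, e, e0, add_zero, sub_zero]
  rw [div_self (pt_ne_zero a), one_mul, famRat, resFamLast_apply]
  rfl

/-- The product of a family with `∏_{j ∈ I} x_j`. -/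
noncomputable def mulIn (n : ℕ) : (Finset (Fin n) → MvPolynomial (Fin n) ℂ) →ₗ[ℂ]
    Finset (Fin n) → MvPolynomial (Fin n) ℂ := flipFam n ∘ₗ mulCompl n ∘ₗ flipFam n

theorem mulIn_apply (g : Finset (Fin n) → MvPolynomial (Fin n) ℂ) (I : Finset (Fin n)) :
    mulIn n g I = (∏ j ∈ I, X j) * g I := by
  change (∏ j ∈ Iᶜᶜ, X j) * g Iᶜᶜ = _
  rw [compl_compl]

theorem mulIn_mem {l d : ℤ} {g : Finset (Fin n) → MvPolynomial (Fin n) ℂ}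
    (hg : g ∈ EqFam n l d) : mulIn n g ∈ EqFam n l (d + l) := by
  change flipFam n (mulCompl n (flipFam n g)) ∈ EqFam n l (d + l)
  refine flipFam_mem' ?_
  have := mulCompl_mem_iff.2 (flipFam_mem hg)
  rwa [sub_sub_cancel] at this

theorem exists_mulIn_of_resFamLast_eq_zero {l d : ℤ}
    {g : Finset (Fin (n + 1)) → MvPolynomial (Fin (n + 1)) ℂ} (hg : g ∈ EqFam (n + 1) l d)
    (h : resFamLast n g = 0) : ∃ g' ∈ EqFam (n + 1) l (d - l), mulIn _ g' = g := by
  have h0 : resFam n (flipFam (n + 1) g) = 0 := by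
    rw [← flipFam_flipFam (resFam n (flipFam (n + 1) g))]
    change flipFam n (resFamLast n g) = 0
    rw [h, map_zero]
  obtain ⟨g', hg', e⟩ := exists_mulCompl_of_resFam_eq_zero (flipFam_mem hg) h0
  rw [sub_sub_cancel] at hg'
  refine ⟨flipFam _ g', flipFam_mem' hg', ?_⟩
  simp only [mulIn, LinearMap.comp_apply, flipFam_flipFam, e]

/-- The complement of I \ {a} is that of I together with a, which supplies one more power of x_a. In
`crVec_mulIn` the exponent moves in the opposite direction, so the complexes with exponents 0 and 1
are mapped to each other. -/
theorem crVec_mulCompl (k : ℕ) (u : Finset (Fin n) → MvPolynomial (Fin n) ℂ)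
    (I : Finset (Fin n)) :
    crVec (pt n) (fun i => pt n i ^ k) (famRat (mulCompl n u)) I =
      toRat _ (∏ j ∈ Iᶜ, X j) * crVec (pt n) (fun i => pt n i ^ (k + 1)) (famRat u) I := by
  rw [crVec_apply, crVec_apply, Finset.mul_sum]
  refine Finset.sum_congr rfl fun a ha => ?_
  have : (I.erase a)ᶜ = insert a Iᶜ := by rw [Finset.compl_erase]
  rw [famRat, mulCompl_apply, this, Finset.prod_insert (by simpa using ha), map_mul, map_mul,
    famRat, pt]
  ring

theorem crVec_mulIn (k : ℕ) (u : Finset (Fin n) → MvPolynomial (Fin n) ℂ)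
    (I : Finset (Fin n)) :
    crVec (pt n) (fun i => pt n i ^ (k + 1)) (famRat (mulIn n u)) I =
      toRat _ (∏ j ∈ I, X j) * crVec (pt n) (fun i => pt n i ^ k) (famRat u) I := by
  rw [crVec_apply, crVec_apply, Finset.mul_sum]
  refine Finset.sum_congr rfl fun a ha => ?_
  rw [famRat, mulIn_apply, ← Finset.mul_prod_erase I _ ha, map_mul, map_mul, famRat, pt]
  ring

end Specialization

/-! ### Exactness of the complexes of creation operators. -/

section Exactness

/-- Exactness of the complex of the creation operators of the vector `(x_i^k)`. -/
def ExactCr (k n : ℕ) (l d : ℤ) : Prop :=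
  ∀ u ∈ EqFam n l d, crVec (pt n) (fun i => pt n i ^ k) (famRat u) = 0 →
    ∃ v ∈ EqFam n (l - 1) (d - k), famRat u = crVec (pt n) (fun i => pt n i ^ k) (famRat v)

theorem exactCr_of_bot {k n : ℕ} {l d : ℤ} (h : EqFam n l d = ⊥) : ExactCr k n l d := by
  intro u hu _
  rw [h, Submodule.mem_bot] at hu
  refine ⟨0, zero_mem _, ?_⟩
  have : famRat (0 : Finset (Fin n) → MvPolynomial (Fin n) ℂ) = 0 := by
    ext1 I
    exact map_zero _
  rw [hu, this, map_zero]

theorem famRat_add {n : ℕ} (u v : Finset (Fin n) → MvPolynomial (Fin n) ℂ) :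
    famRat (u + v) = famRat u + famRat v := funext fun _ => map_add _ _ _

theorem famRat_sub {n : ℕ} (u v : Finset (Fin n) → MvPolynomial (Fin n) ℂ) :
    famRat (u - v) = famRat u - famRat v := funext fun _ => map_sub _ _ _

theorem famRat_zero {n : ℕ} : famRat (0 : Finset (Fin n) → MvPolynomial (Fin n) ℂ) = 0 :=
  funext fun _ => map_zero _

theorem famRat_smul {n : ℕ} (c : ℂ) (u : Finset (Fin n) → MvPolynomial (Fin n) ℂ) :
    famRat (c • u) = toRat (Fin n) (C c) • famRat u := funext fun _ => toRat_C_smul _ _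

/-- The operator `contr` is a contracting homotopy preserving polynomial families: if ψu = 0, then u
= ψ(contr u). -/
theorem exactCr_zero_of_odd {n : ℕ} (hn : Odd n) (l d : ℤ) : ExactCr 0 n l d := by
  intro u hu h
  obtain ⟨v, hv, e⟩ := exists_contr hu
  refine ⟨v, by simpa using hv, ?_⟩
  have h1 : (fun i => pt n i ^ 0) = 1 := by ext; simp
  rw [h1] at h ⊢
  have := congrArg (fun f => f (famRat u))
    (contr_mul_crVec (generic_pt n) pt_ne_zero (by simpa using hn))
  simp only [LinearMap.add_apply, Module.End.mul_apply, h, map_zero, zero_add,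
    Module.End.one_apply] at this
  rw [e, this]

/-- Write ψ_k for the operator of exponent k. The restriction of a cocycle u to the vanishing of the
last variable, on sets containing the last index, is ψ_1 of something. Lifting this to w makes u -
ψ_1 w divisible by ∏_{j ∈ I} x_j. The quotient is a ψ_0-cocycle, hence equal to ψ_0 z, and
multiplying back turns ψ_0 z into ψ_1 of the multiplied family. -/
theorem exactCr_one_of_zero {n : ℕ} {l d : ℤ} (h1 : ExactCr 1 n (l - 1) d)
    (h0 : ExactCr 0 (n + 1) l (d - l)) : ExactCr 1 (n + 1) l d := by
  intro u hu h
  have hz : famRat (0 : Finset (Fin (n + 1)) → MvPolynomial (Fin (n + 1)) ℂ) =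
      crVec (pt (n + 1)) (fun i => pt (n + 1) i ^ 1) (famRat u) := by rw [famRat_zero, h]
  have hres := resFamLast_crVec hz
  rw [map_zero, famRat_zero] at hres
  obtain ⟨w', hw', e⟩ := h1 _ (resFamLast_mem hu) hres.symm
  obtain ⟨w, hw, rfl⟩ := exists_liftLast hw'
  rw [sub_add_cancel] at hw
  obtain ⟨t, ht, et⟩ := exists_crVec hw 1
  rw [sub_add_cancel, Nat.cast_one, sub_add_cancel] at ht
  have e2 : resFamLast n (u - t) = 0 := by
    apply famRat_injective
    rw [map_sub, famRat_sub, resFamLast_crVec et, e, sub_self, famRat_zero]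
  obtain ⟨u', hu', eu'⟩ := exists_mulIn_of_resFamLast_eq_zero (sub_mem hu ht) e2
  have e3 : crVec (pt (n + 1)) (fun i => pt (n + 1) i ^ 0) (famRat u') = 0 := by
    ext I
    have h3 : crVec (pt (n + 1)) (fun i => pt (n + 1) i ^ (0 + 1)) (famRat (mulIn _ u')) = 0 := by
      rw [eu', famRat_sub, map_sub, zero_add, h, et, ← Module.End.mul_apply, crVec_mul_self]
      simp
    have := crVec_mulIn 0 u' I
    rw [h3] at this
    exact (mul_eq_zero.1 this.symm).resolve_left
      ((map_ne_zero_iff _ toRat_injective).2 (prod_X_ne_zero I))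
  obtain ⟨z, hz, ez⟩ := h0 u' hu' e3
  refine ⟨w + mulIn _ z, add_mem (by simpa using hw) ?_, ?_⟩
  · have := mulIn_mem hz
    convert this using 2
    push_cast
    ring
  · rw [famRat_add, map_add, ← et]
    have e4 : crVec (pt (n + 1)) (fun i => pt (n + 1) i ^ 1) (famRat (mulIn _ z)) =
        famRat (mulIn _ u') := by
      ext I
      rw [crVec_mulIn 0, ← ez, famRat, famRat, mulIn_apply, map_mul]
    rw [e4, eu', famRat_sub]
    abel

/-- Restriction on sets without the last index leads to the exact complex with the odd number n of
variables. What remains is divisible by ∏_{j ∉ I} x_j, with quotient a cocycle for exponent 1. -/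
theorem exactCr_zero_of_even {n : ℕ} (hn : Odd n) (h1 : ∀ l : ℤ, l < n → ∀ d, ExactCr 1 n l d)
    (l : ℤ) (hl : l < (n + 1 : ℕ)) (d : ℤ) : ExactCr 0 (n + 1) l d := by
  by_cases hl0 : l < 0
  · exact exactCr_of_bot (eqFam_eq_bot_of_card _ _ (Or.inl hl0))
  -- Induction on the degree: dividing first by ∏_{j ∉ I} x_j and then, in `exactCr_one_of_zero`, by
  -- ∏_{j ∈ I} x_j returns to exponent 0 with the degree lowered by n + 1.
  have key : ∀ (N : ℕ) (d : ℤ), d < N → ExactCr 0 (n + 1) l d := by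
    intro N
    induction N with
    | zero =>
      intro d hd
      exact exactCr_of_bot (eqFam_eq_bot_of_neg _ _ (by simpa using hd))
    | succ N ih =>
      intro d hd u hu h
      have hz : famRat (0 : Finset (Fin (n + 1)) → MvPolynomial (Fin (n + 1)) ℂ) =
          crVec (pt (n + 1)) (fun i => pt (n + 1) i ^ 0) (famRat u) := by rw [famRat_zero, h]
      have hres := resFam_crVec 0 hz
      rw [map_zero, famRat_zero] at hres
      obtain ⟨v', hv', e⟩ := exactCr_zero_of_odd hn l d _ (resFam_mem hu) hres.symm
      obtain ⟨v, hv, rfl⟩ := exists_lift hv'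
      obtain ⟨t, ht, et⟩ := exists_crVec hv 0
      rw [sub_add_cancel, sub_add_cancel] at ht
      have e2 : resFam n (u - t) = 0 := by
        apply famRat_injective
        rw [map_sub, famRat_sub, resFam_crVec 0 et, e, sub_self, famRat_zero]
      obtain ⟨u', hu', eu'⟩ := exists_mulCompl_of_resFam_eq_zero (sub_mem hu ht) e2
      have e3 : crVec (pt (n + 1)) (fun i => pt (n + 1) i ^ 1) (famRat u') = 0 := by
        ext I
        have h3 : crVec (pt (n + 1)) (fun i => pt (n + 1) i ^ 0) (famRat (mulCompl _ u')) = 0 := by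
          rw [eu', famRat_sub, map_sub, h, et, ← Module.End.mul_apply, crVec_mul_self]
          simp
        have := crVec_mulCompl 0 u' I
        rw [h3] at this
        exact (mul_eq_zero.1 this.symm).resolve_left
          ((map_ne_zero_iff _ toRat_injective).2 (prod_X_ne_zero _))
      obtain ⟨z, hz, ez⟩ := exactCr_one_of_zero (h1 (l - 1) (by push_cast at hl; omega) _)
        (ih (d - ((n + 1 : ℕ) - l) - l) (by push_cast at *; omega)) u' hu' e3
      refine ⟨v + mulCompl _ z, add_mem (by simpa using hv) ?_, ?_⟩
      · have := mulCompl_mem_iff.2 hz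
        convert this using 2
        push_cast
        ring
      · rw [famRat_add, map_add, ← et]
        have e4 : crVec (pt (n + 1)) (fun i => pt (n + 1) i ^ 0) (famRat (mulCompl _ z)) =
            famRat (mulCompl _ u') := by
          ext I
          rw [crVec_mulCompl 0, zero_add, ← ez, famRat, famRat, mulCompl_apply, map_mul]
        rw [e4, eu', famRat_sub]
        abel
  exact key (d.toNat + 1) d (by push_cast; omega)

/-- The bound l < n cannot be dropped: for n = l = 1 and exponent 1 the image consists of multiples
of x_1, while every family is a cocycle. -/
theorem exactCr (n : ℕ) : (∀ l : ℤ, l < n → ∀ d, ExactCr 1 n l d) ∧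
    ∀ l : ℤ, l < n → ∀ d, ExactCr 0 n l d := by
  induction n with
  | zero =>
    exact ⟨fun l hl d => exactCr_of_bot (eqFam_eq_bot_of_card _ _ (Or.inl (by simpa using hl))),
      fun l hl d => exactCr_of_bot (eqFam_eq_bot_of_card _ _ (Or.inl (by simpa using hl)))⟩
  | succ n ih =>
    have h0 : ∀ l : ℤ, l < (n + 1 : ℕ) → ∀ d, ExactCr 0 (n + 1) l d := by
      intro l hl d
      rcases Nat.even_or_odd n with hn | hn
      · exact exactCr_zero_of_odd hn.add_one l d
      · exact exactCr_zero_of_even hn ih.1 l hl d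
    exact ⟨fun l hl d => exactCr_one_of_zero (ih.1 _ (by push_cast at hl; omega) _) (h0 l hl _), h0⟩

end Exactness

/-! ### The rank of (v, u) ↦ ψv + Qu on polynomial families. -/

section NullDimension

variable {n : ℕ}

/-- The restriction to polynomial families of an operator on families of rational functions. -/
noncomputable def polyOp (T : Module.End (RatFun (Fin n)) (Finset (Fin n) → RatFun (Fin n)))
    {l d l' d' : ℤ} (h : ∀ u ∈ EqFam n l d, ∃ v ∈ EqFam n l' d', famRat v = T (famRat u)) :
    EqFam n l d →ₗ[ℂ] EqFam n l' d' where
  toFun u := ⟨(h u u.2).choose, (h u u.2).choose_spec.1⟩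
  map_add' u v := by
    apply Subtype.ext
    apply famRat_injective
    simp only [Submodule.coe_add]
    refine (h _ (u + v).2).choose_spec.2.trans ?_
    rw [famRat_add]
    refine Eq.trans ?_ (congrArg₂ (· + ·) (h _ u.2).choose_spec.2 (h _ v.2).choose_spec.2).symm
    rw [← map_add, ← famRat_add]
    rfl
  map_smul' c u := by
    apply Subtype.ext
    apply famRat_injective
    simp only [Submodule.coe_smul, RingHom.id_apply]
    refine (h _ (c • u).2).choose_spec.2.trans ?_
    rw [famRat_smul]
    refine Eq.trans ?_ (congrArg (_ • ·) (h _ u.2).choose_spec.2).symm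
    rw [← map_smul, ← famRat_smul]
    rfl

theorem famRat_polyOp (T : Module.End (RatFun (Fin n)) (Finset (Fin n) → RatFun (Fin n)))
    {l d l' d' : ℤ} (h : ∀ u ∈ EqFam n l d, ∃ v ∈ EqFam n l' d', famRat v = T (famRat u))
    (u : EqFam n l d) : famRat (polyOp T h u : Finset (Fin n) → MvPolynomial (Fin n) ℂ) =
      T (famRat u) := (h u u.2).choose_spec.2

theorem exists_crVec_one (l d : ℤ) : ∀ u ∈ EqFam n (l - 1) d, ∃ v ∈ EqFam n l d,
    famRat v = crVec (pt n) 1 (famRat u) := fun u hu => by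
  obtain ⟨v, hv, e⟩ := exists_crVec hu 0
  refine ⟨v, by simpa using hv, ?_⟩
  rw [e]
  congr 1

theorem exists_crPair_sub (l d : ℤ) : ∀ u ∈ EqFam n (l - 1 - 1) d, ∃ v ∈ EqFam n l d,
    famRat v = crPair (pt n) (famRat u) := fun u hu => by
  obtain ⟨v, hv, e⟩ := exists_crPair hu
  exact ⟨v, by convert hv using 2; ring, e⟩

/-- The creation operator on polynomial families. -/
noncomputable def raise (n : ℕ) (l d : ℤ) : EqFam n (l - 1) d →ₗ[ℂ] EqFam n l d :=
  polyOp (crVec (pt n) 1) (exists_crVec_one l d)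

/-- The creation operator of pairs on polynomial families. -/
noncomputable def raisePair (n : ℕ) (l d : ℤ) : EqFam n (l - 1 - 1) d →ₗ[ℂ] EqFam n l d :=
  polyOp (crPair (pt n)) (exists_crPair_sub l d)

theorem famRat_raise {l d : ℤ} (u : EqFam n (l - 1) d) :
    famRat (raise n l d u : Finset (Fin n) → MvPolynomial (Fin n) ℂ) =
      crVec (pt n) 1 (famRat u) := famRat_polyOp _ _ u

theorem famRat_raisePair {l d : ℤ} (u : EqFam n (l - 1 - 1) d) :
    famRat (raisePair n l d u : Finset (Fin n) → MvPolynomial (Fin n) ℂ) =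
      crPair (pt n) (famRat u) := famRat_polyOp _ _ u

theorem crVec_one_crVec_one (u : Finset (Fin n) → RatFun (Fin n)) :
    crVec (pt n) 1 (crVec (pt n) 1 u) = 0 := by
  rw [← Module.End.mul_apply, crVec_mul_self, LinearMap.zero_apply]

theorem exists_raise_eq {l d : ℤ} (hl : l < n) (u : EqFam n l d)
    (h : crVec (pt n) 1 (famRat (u : Finset (Fin n) → MvPolynomial (Fin n) ℂ)) = 0) :
    ∃ v, raise n l d v = u := by
  have h1 : (fun i => pt n i ^ 0) = 1 := by ext; simp
  obtain ⟨v, hv, e⟩ := (exactCr n).2 l hl d u u.2 (by rw [h1, h])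
  refine ⟨⟨v, by simpa using hv⟩, ?_⟩
  apply Subtype.ext
  apply famRat_injective
  rw [famRat_raise, e, h1]

theorem finrank_ker_raise {l d : ℤ} (hl : l ≤ n) :
    Module.finrank ℂ (LinearMap.ker (raise n l d)) +
      Module.finrank ℂ (LinearMap.ker (raise n (l - 1) d)) = eqDim n (l - 1 - 1) d := by
  have h1 : LinearMap.ker (raise n l d) = LinearMap.range (raise n (l - 1) d) := by
    ext u
    rw [LinearMap.mem_ker, LinearMap.mem_range]
    constructor
    · intro h
      refine exists_raise_eq (by omega) u ?_
      rw [← famRat_raise, h]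
      exact famRat_zero
    · rintro ⟨v, rfl⟩
      apply Subtype.ext
      apply famRat_injective
      rw [famRat_raise, famRat_raise, crVec_one_crVec_one]
      exact famRat_zero.symm
  rw [h1]
  exact LinearMap.finrank_range_add_finrank_ker _

theorem crVec_eq_zero_of_crPair {l d : ℤ} (hl : 2 * l ≤ n) (u : EqFam n (l - 1 - 1) d)
    (h : crVec (pt n) 1 (crPair (pt n) (famRat (u : Finset (Fin n) → MvPolynomial (Fin n) ℂ))) = 0) :
    crVec (pt n) 1 (famRat (u : Finset (Fin n) → MvPolynomial (Fin n) ℂ)) = 0 := by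
  by_cases h2 : l < 2
  · have h0 : (u : Finset (Fin n) → MvPolynomial (Fin n) ℂ) = 0 := by
      exact (Submodule.mem_bot ℂ).1
        ((eqFam_eq_bot_of_card n d (Or.inl (by omega))).le u.2)
    rw [h0, famRat_zero, map_zero]
  · obtain ⟨k, rfl⟩ : ∃ k : ℕ, l = k + 2 := ⟨(l - 2).toNat, by omega⟩
    -- Here r = 1 and M = k + 1 = l - 1, and the vacuum condition 2M + 1 ≤ n reads 2l - 1 ≤ n.
    refine crVec_eq_zero_of_crPair_pow (generic_pt n) (M := k + 1)
      (crVec_crPair_pow_oneOn_ne (generic_pt n) pt_ne_zero (by simp; omega)) k 1 rfl _ ?_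
      (by rwa [pow_one])
    rw [mem_cardSupp]
    intro I hI
    rw [famRat, u.2.1 I (by omega), map_zero]

/-- The kernel is an extension of ker ψ at place l - 2 by ker ψ at place l - 1. By exactness these
dimensions add up to that of the second summand of the source, so the rank is the dimension of the
first. -/
theorem range_coprod_finrank {l d : ℤ} (hl : 2 * l ≤ n) :
    Module.finrank ℂ (LinearMap.range ((raise n l d).coprod (raisePair n l d))) =
      eqDim n (l - 1) d := by
  have key : ∀ (v : EqFam n (l - 1) d) (u : EqFam n (l - 1 - 1) d),
      raise n l d v + raisePair n l d u = 0 → raise n (l - 1) d u = 0 := by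
    intro v u h
    have h' := congrArg (fun t : EqFam n l d =>
      crVec (pt n) 1 (famRat (t : Finset (Fin n) → MvPolynomial (Fin n) ℂ))) h
    simp only [Submodule.coe_add, famRat_add, map_add, famRat_raise, famRat_raisePair,
      crVec_one_crVec_one, zero_add, Submodule.coe_zero, famRat_zero, map_zero] at h'
    apply Subtype.ext
    apply famRat_injective
    rw [famRat_raise, crVec_eq_zero_of_crPair hl u h']
    exact famRat_zero.symm
  set f := (raise n l d).coprod (raisePair n l d) with hf
  let p : LinearMap.ker f →ₗ[ℂ] EqFam n (l - 1 - 1) d :=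
    (LinearMap.snd ℂ _ _).comp (LinearMap.ker f).subtype
  have hr : LinearMap.range p =
      LinearMap.ker (raise n (l - 1) d) := by
    ext u
    rw [LinearMap.mem_range, LinearMap.mem_ker]
    constructor
    · rintro ⟨⟨⟨v, u⟩, hvu⟩, rfl⟩
      exact key v u hvu
    · intro h
      obtain ⟨w, rfl⟩ := exists_raise_eq (by omega) u (by rw [← famRat_raise, h]; exact famRat_zero)
      -- The pair (-Qw, ψw) lies in the kernel because Q and ψ commute.
      refine ⟨⟨(-raisePair n (l - 1) d w, raise n (l - 1 - 1) d w), ?_⟩, rfl⟩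
      rw [LinearMap.mem_ker, hf, LinearMap.coprod_apply]
      change raise n l d (-raisePair n (l - 1) d w) + raisePair n l d (raise n (l - 1 - 1) d w) = 0
      rw [map_neg, neg_add_eq_zero]
      apply Subtype.ext
      apply famRat_injective
      rw [famRat_raise, famRat_raisePair, famRat_raisePair, famRat_raise, ← Module.End.mul_apply,
        ← crPair_mul_crVec, Module.End.mul_apply]
  let e : LinearMap.ker (raise n l d) →ₗ[ℂ] LinearMap.ker f :=
    ((LinearMap.inl ℂ _ _).comp (LinearMap.ker (raise n l d)).subtype).codRestrict _ fun v => by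
      simp [hf]
  have he : Function.Injective e := fun v w h => Subtype.ext
    (congrArg (fun t : LinearMap.ker f => (t : EqFam n (l - 1) d × EqFam n (l - 1 - 1) d).1) h)
  have hk : LinearMap.ker p = LinearMap.range e := by
    ext t
    rw [LinearMap.mem_ker, LinearMap.mem_range]
    constructor
    · obtain ⟨⟨v, u⟩, hvu⟩ := t
      intro h
      obtain rfl : u = 0 := h
      exact ⟨⟨v, by simpa [hf] using hvu⟩, rfl⟩
    · rintro ⟨v, rfl⟩
      rfl
  have d1 := LinearMap.finrank_range_add_finrank_ker f
  have d2 := LinearMap.finrank_range_add_finrank_ker (V := LinearMap.ker f) p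
  rw [hr, hk, LinearMap.finrank_range_of_inj he] at d2
  have d3 := finrank_ker_raise (n := n) (l := l) (d := d) (by omega)
  rw [Module.finrank_prod] at d1
  change _ = eqDim n (l - 1) d + eqDim n (l - 1 - 1) d at d1
  omega

end NullDimension

/-! ### Evaluation at the points X_a = -1/x_{s(a)}. -/

section Evaluation

variable {n ℓ : ℕ}

/-- The evaluation `X_a = ξ_a`, `x_j = y_j`. -/
noncomputable def evalAt {L : Type*} [CommRing L] [Algebra ℂ L] (ξ : Fin ℓ → L) (y : Fin n → L) :
    Poly n ℓ →ₐ[ℂ] L := aeval (Sum.elim ξ y)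

section

variable {L : Type*} [CommRing L] [Algebra ℂ L] (ξ : Fin ℓ → L) (y : Fin n → L)

theorem evalAt_inl (a : Fin ℓ) : evalAt ξ y (X (Sum.inl a)) = ξ a := aeval_X _ _

theorem evalAt_inr (j : Fin n) : evalAt ξ y (X (Sum.inr j)) = y j := aeval_X _ _

theorem evalAt_rename {k : ℕ} (f : Fin k → Fin ℓ) (τ : Fin n → Fin n) (P : Poly n k) :
    evalAt ξ y (rename (Sum.map f τ) P) = evalAt (ξ ∘ f) (y ∘ τ) P := by
  rw [evalAt, aeval_rename, evalAt]
  congr 2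
  ext (a | j) <;> rfl

theorem evalAt_perm {P : Poly n ℓ} (hP : P ∈ wedgePower n ℓ) (σ : Equiv.Perm (Fin ℓ))
    (τ : Equiv.Perm (Fin n)) :
    evalAt (ξ ∘ σ) (y ∘ τ) P = (Equiv.Perm.sign σ : ℤ) • evalAt ξ y P := by
  have h : rename (Sum.map σ τ) P = (Equiv.Perm.sign σ : ℤ) • P := by
    rw [← hP.2.1 σ]
    nth_rw 2 [← hP.2.2 τ]
    rw [rename_rename, Sum.map_comp_map]
    rfl
  rw [← evalAt_rename, h, map_zsmul]

theorem evalAt_eq_zero_of_eq {P : Poly n ℓ} (hP : P ∈ wedgePower n ℓ) [IsDomain L]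
    {a b : Fin ℓ} (hab : a ≠ b) (h : ξ a = ξ b) : evalAt ξ y P = 0 := by
  have h1 := evalAt_perm ξ y hP (Equiv.swap a b) 1
  have h2 : ξ ∘ Equiv.swap a b = ξ := by
    ext c
    rw [Function.comp_apply, Equiv.swap_apply_def]
    split_ifs with h3 h3
    · rw [h3, h]
    · rw [h3, h]
    · rfl
  rw [h2, Equiv.Perm.sign_swap hab] at h1
  have h3 : evalAt ξ y P = -evalAt ξ y P := by simpa using h1
  have h4 : algebraMap ℂ L 2 * evalAt ξ y P = 0 := by
    rw [map_ofNat, two_mul]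
    nth_rw 2 [h3]
    exact add_neg_cancel _
  refine (mul_eq_zero.1 h4).resolve_left ?_
  rw [← ne_eq, map_ne_zero_iff _ (algebraMap ℂ L).injective]
  exact two_ne_zero

end

/-- A polynomial as a polynomial in the `X_a` with coefficients rational in the `x_j`. -/
noncomputable def overRat (n ℓ : ℕ) : Poly n ℓ →ₐ[ℂ] MvPolynomial (Fin ℓ) (RatFun (Fin n)) :=
  aeval (Sum.elim X fun j => C (pt n j))

theorem overRat_inl (a : Fin ℓ) : overRat n ℓ (X (Sum.inl a)) = X a := aeval_X _ _

theorem overRat_inr (j : Fin n) : overRat n ℓ (X (Sum.inr j)) = C (pt n j) := aeval_X _ _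

theorem overRat_eq : (overRat n ℓ : Poly n ℓ →+* MvPolynomial (Fin ℓ) (RatFun (Fin n))) =
    (MvPolynomial.map (toRat (Fin n))).comp (sumAlgEquiv ℂ (Fin ℓ) (Fin n)).toRingHom := by
  apply MvPolynomial.ringHom_ext
  · intro r
    simp only [RingHom.comp_apply, RingEquiv.toRingHom_eq_coe,
      AlgEquiv.toRingEquiv_toRingHom, RingHom.coe_coe, sumAlgEquiv_C_inl, map_C, overRat, aeval_C]
    rfl
  · rintro (a | j)
    · simp [overRat_inl]
    · simp [overRat_inr, pt]

theorem overRat_injective : Function.Injective (overRat n ℓ) := by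
  have : ⇑(overRat n ℓ) = ⇑((MvPolynomial.map (toRat (Fin n))).comp
      (sumAlgEquiv ℂ (Fin ℓ) (Fin n)).toRingHom) := by rw [← overRat_eq]; rfl
  rw [this, RingHom.coe_comp]
  exact (map_injective _ toRat_injective).comp (sumAlgEquiv ℂ (Fin ℓ) (Fin n)).injective

theorem eval_overRat (ξ : Fin ℓ → RatFun (Fin n)) (P : Poly n ℓ) :
    eval ξ (overRat n ℓ P) = evalAt ξ (pt n) P := by
  have : (eval ξ).comp (overRat n ℓ : Poly n ℓ →+* MvPolynomial (Fin ℓ) (RatFun (Fin n))) = (evalAt ξ (pt n) : Poly n ℓ →+* _) := by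
    apply MvPolynomial.ringHom_ext
    · intro r
      simp [evalAt, overRat, algebraMap_eq, IsScalarTower.algebraMap_apply ℂ (RatFun (Fin n))
        (MvPolynomial (Fin ℓ) (RatFun (Fin n)))]
    · rintro (a | j)
      · simp [overRat_inl, evalAt_inl]
      · simp [overRat_inr, evalAt_inr]
  exact congrArg (fun f => f P) this

theorem overRat_rename_inr (p : MvPolynomial (Fin n) ℂ) :
    overRat n ℓ (rename Sum.inr p) = C (toRat _ p) := by
  have : (overRat n ℓ : Poly n ℓ →+* MvPolynomial (Fin ℓ) (RatFun (Fin n))).comp (rename Sum.inr : _ →ₐ[ℂ] _).toRingHom =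
      C.comp (toRat (Fin n)) := by
    apply MvPolynomial.ringHom_ext
    · intro r
      simp [overRat, IsScalarTower.algebraMap_apply ℂ (RatFun (Fin n))
        (MvPolynomial (Fin ℓ) (RatFun (Fin n))), algebraMap_eq]
      rfl
    · intro j
      simp [overRat_inr, pt]
  exact congrArg (fun f => f p) this

theorem overRat_rename_left (σ : Equiv.Perm (Fin ℓ)) (P : Poly n ℓ) :
    overRat n ℓ (rename (Sum.map σ id) P) = rename σ (overRat n ℓ P) := by
  have : (overRat n ℓ).comp (rename (Sum.map σ id)) =
      ((rename σ : _ →ₐ[RatFun (Fin n)] _).restrictScalars ℂ).comp (overRat n ℓ) := by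
    apply MvPolynomial.algHom_ext
    rintro (a | j)
    · simp [overRat_inl]
    · simp [overRat_inr]
  exact congrArg (fun f => f P) this

theorem overRat_rename_right (τ : Equiv.Perm (Fin n)) (P : Poly n ℓ) :
    overRat n ℓ (rename (Sum.map id τ) P) = MvPolynomial.map (permRat τ) (overRat n ℓ P) := by
  have : (overRat n ℓ : Poly n ℓ →+* MvPolynomial (Fin ℓ) (RatFun (Fin n))).comp (rename (Sum.map id τ) : _ →ₐ[ℂ] _).toRingHom =
      (MvPolynomial.map (permRat τ)).comp (overRat n ℓ : Poly n ℓ →+* MvPolynomial (Fin ℓ) (RatFun (Fin n))) := by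
    apply MvPolynomial.ringHom_ext
    · intro r
      have : overRat n ℓ (C r) = C (toRat _ (C r)) := by
        rw [← overRat_rename_inr, rename_C]
      simp [this, permRat_toRat]
    · rintro (a | j)
      · simp [overRat_inl]
      · simp [overRat_inr, permRat_pt]
  exact congrArg (fun f => f P) this

theorem degreeOf_overRat {P : Poly n ℓ} (hP : ∀ m ∈ P.support, ∀ a : Fin ℓ, m (Sum.inl a) < n)
    (hn : 0 < n) (a : Fin ℓ) : degreeOf a (overRat n ℓ P) < n := by
  rw [P.as_sum, map_sum]
  refine (degreeOf_sum_le a _ _).trans_lt ?_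
  rw [Finset.sup_lt_iff hn]
  intro m hm
  have e : overRat n ℓ (monomial m (coeff m P)) =
      C (toRat _ (C (coeff m P)) * ∏ j, pt n j ^ m (Sum.inr j)) * ∏ b, X b ^ m (Sum.inl b) := by
    have : overRat n ℓ (C (coeff m P)) = C (toRat _ (C (coeff m P))) := by
      rw [← overRat_rename_inr, rename_C]
    rw [monomial_eq, map_mul, this, Finsupp.prod_fintype _ _ (by simp), Fintype.prod_sum_type,
      map_mul, map_prod, map_prod, map_mul, map_prod]
    simp only [map_pow, overRat_inl, overRat_inr]
    ring
  rw [e]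
  refine (degreeOf_C_mul_le _ _ _).trans_lt ((degreeOf_prod_le _ _ _).trans_lt ?_)
  refine lt_of_le_of_lt (Finset.sum_le_sum fun b _ => degreeOf_pow_le a (X b) (m (Sum.inl b))) ?_
  simp only [degreeOf_X]
  simpa using hP m hm a

/-- The evaluation `X_a = -1/x_{s(a)}`. -/
noncomputable def evalPoint (s : Fin ℓ → Fin n) : Poly n ℓ →ₐ[ℂ] RatFun (Fin n) :=
  evalAt (fun a => -(pt n (s a))⁻¹) (pt n)

theorem pt_injective : Function.Injective (pt n) := fun i j h => by
  by_contra hij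
  exact (generic_pt n).sub_ne i j hij (sub_eq_zero.2 h)

/-- An element of the exterior power is determined by its values at `X_a = -1/x_{s(a)}`. -/
theorem eq_zero_of_evalPoint {P : Poly n ℓ} (hP : P ∈ wedgePower n ℓ)
    (h : ∀ s : Fin ℓ ↪ Fin n, evalPoint s P = 0) : P = 0 := by
  -- For n = 0 and ℓ ≠ 0 no exponent satisfies the degree bound, so P has empty support.
  by_cases hn : n = 0 ∧ ℓ ≠ 0
  · obtain ⟨rfl, hl⟩ := hn
    by_contra h0
    obtain ⟨m, hm⟩ := Finset.nonempty_iff_ne_empty.2 (mt support_eq_empty.1 h0)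
    exact absurd (hP.1 m hm ⟨0, by omega⟩) (by simp)
  · have hinj : Function.Injective fun i => -(pt n i)⁻¹ :=
      neg_injective.comp (inv_injective.comp pt_injective)
    classical
    apply overRat_injective
    rw [map_zero]
    -- Degree less than n in each variable and a grid of n values per variable. Grid points with
    -- repeated values are covered by anti-symmetry.
    refine eq_zero_of_eval_zero_at_prod_finset _
      (fun _ => Finset.univ.image fun i => -(pt n i)⁻¹) (fun a => ?_) fun ξ hξ => ?_
    · rw [Finset.card_image_of_injective _ hinj, Finset.card_univ, Fintype.card_fin]
      have := a.2
      exact degreeOf_overRat hP.1 (by omega) a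
    · simp only [Finset.mem_image, Finset.mem_univ, true_and] at hξ
      choose s hs using hξ
      obtain rfl : (fun a => -(pt n (s a))⁻¹) = ξ := funext hs
      rw [eval_overRat]
      by_cases hs' : Function.Injective s
      · exact h ⟨s, hs'⟩
      · simp only [Function.Injective, not_forall] at hs'
        obtain ⟨a, b, e, hab⟩ := hs'
        exact evalAt_eq_zero_of_eq _ _ hP hab (by rw [e])

/-- A polynomial over the field of rational functions whose coefficients are polynomials. -/
theorem exists_overRat_eq (T : MvPolynomial (Fin ℓ) (RatFun (Fin n)))
    (hT : ∀ m, ∃ p, coeff m T = toRat _ p) (hd : ∀ m ∈ T.support, ∀ a, m a < n) :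
    ∃ P : Poly n ℓ, overRat n ℓ P = T ∧ ∀ m ∈ P.support, ∀ a : Fin ℓ, m (Sum.inl a) < n := by
  choose p hp using hT
  refine ⟨∑ m ∈ T.support, rename Sum.inr (p m) * rename Sum.inl (monomial m 1), ?_, ?_⟩
  · conv_rhs => rw [T.as_sum]
    rw [map_sum]
    refine Finset.sum_congr rfl fun m _ => ?_
    have : overRat n ℓ (rename Sum.inl (monomial m 1)) = monomial m 1 := by
      rw [rename_monomial, monomial_eq, monomial_eq, map_mul, C_1, map_one, C_1,
        Finsupp.prod_mapDomain_index_inj Sum.inl_injective]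
      simp only [Finsupp.prod, map_prod, map_pow, overRat_inl]
    rw [map_mul, overRat_rename_inr, this, ← hp, C_mul_monomial, mul_one]
  · classical
    intro m hm a
    obtain ⟨k, hk, hm⟩ := Finset.mem_biUnion.1 (support_sum hm)
    refine lt_of_le_of_lt (le_trans (monomial_le_degreeOf (Sum.inl a) hm) ?_) (hd k hk a)
    refine (degreeOf_mul_le _ _ _).trans ?_
    rw [degreeOf_rename_of_injective Sum.inl_injective]
    have h1 : degreeOf (Sum.inl a) (rename Sum.inr (p k) : Poly n ℓ) = 0 := by
      rw [degreeOf_def, Multiset.count_eq_zero]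
      intro h
      have := degrees_rename _ _ h
      simp at this
    rw [h1, zero_add]
    refine (degreeOf_monomial_eq _ _ one_ne_zero).le

end Evaluation

/-! ### Products over pairs of indices and the common factor of the values. -/

section Pairs

variable {n ℓ : ℕ}

/-- The pairs `(a, b)` with `a < b`. -/
def ltPairs (ℓ : ℕ) : Finset (Fin ℓ × Fin ℓ) := Finset.univ.filter fun p => p.1 < p.2

theorem prod_ltPairs {M : Type*} [CommMonoid M] (f : Fin ℓ → Fin ℓ → M) :
    ∏ p ∈ ltPairs ℓ, f p.1 p.2 = ∏ a, ∏ b ∈ Finset.Ioi a, f a b := by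
  rw [ltPairs, Finset.prod_filter, Fintype.prod_prod_type]
  refine Finset.prod_congr rfl fun a _ => ?_
  rw [← Finset.prod_filter]
  congr 1
  ext b
  simp

theorem prod_ltPairs_comp {R : Type*} [CommRing R] (f : Fin ℓ → Fin ℓ → R)
    (hf : ∀ a b, f a b = -f b a) (σ : Equiv.Perm (Fin ℓ)) :
    ∏ p ∈ ltPairs ℓ, f (σ p.1) (σ p.2) =
      ((Equiv.Perm.sign σ : ℤ) : R) * ∏ p ∈ ltPairs ℓ, f p.1 p.2 := by
  rw [prod_ltPairs f, prod_ltPairs fun a b => f (σ a) (σ b)]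
  exact Equiv.Perm.prod_Ioi_comp_eq_sign_mul_prod σ hf

/-- The pairs `(s(a), s(b))` with `a < b`, and the pairs `(i, j)` with `i`, but not `j` in the image
of `s`. -/
def poleSet (s : Fin ℓ ↪ Fin n) : Finset (Fin n × Fin n) :=
  (ltPairs ℓ).map (s.prodMap s) ∪ (Finset.univ.map s) ×ˢ (Finset.univ.map s)ᶜ

theorem mem_poleSet {s : Fin ℓ ↪ Fin n} {p : Fin n × Fin n} :
    p ∈ poleSet s ↔ (∃ a b, a < b ∧ p = (s a, s b)) ∨ (∃ a, p.1 = s a ∧ ∀ b, p.2 ≠ s b) := by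
  obtain ⟨i, j⟩ := p
  simp only [poleSet, Finset.mem_union, Finset.mem_map, ltPairs, Finset.mem_filter,
    Finset.mem_univ, true_and, Finset.mem_product, Finset.mem_compl, not_exists, Prod.exists,
    Function.Embedding.coe_prodMap, Prod.map_apply, Prod.mk.injEq, Function.Embedding.coeFn_mk]
  constructor
  · rintro (⟨a, b, h, rfl, rfl⟩ | ⟨⟨a, rfl⟩, h⟩)
    · exact Or.inl ⟨a, b, h, rfl, rfl⟩
    · exact Or.inr ⟨a, rfl, fun b e => h b e.symm⟩
  · rintro (⟨a, b, h, rfl, rfl⟩ | ⟨a, rfl, h⟩)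
    · exact Or.inl ⟨a, b, h, rfl, rfl⟩
    · exact Or.inr ⟨⟨a, rfl⟩, fun b e => h b e.symm⟩

theorem disjoint_poleSet (s : Fin ℓ ↪ Fin n) : Disjoint ((ltPairs ℓ).map (s.prodMap s))
    ((Finset.univ.map s) ×ˢ (Finset.univ.map s)ᶜ) := by
  rw [Finset.disjoint_left]
  rintro p hp hp'
  obtain ⟨⟨a, b⟩, _, rfl⟩ := Finset.mem_map.1 hp
  simp at hp'

theorem poleSet_subset (s : Fin ℓ ↪ Fin n) : poleSet s ⊆ Finset.univ.offDiag := by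
  intro p hp
  rw [Finset.mem_offDiag]
  refine ⟨Finset.mem_univ _, Finset.mem_univ _, ?_⟩
  rcases mem_poleSet.1 hp with ⟨a, b, h, rfl⟩ | ⟨a, h, h'⟩
  · exact fun e => h.ne (s.injective e)
  · rw [h]
    exact fun e => h' a e.symm

theorem poleSet_asymm {s : Fin ℓ ↪ Fin n} {i j : Fin n} (h : (i, j) ∈ poleSet s) :
    (j, i) ∉ poleSet s := by
  intro h'
  rcases mem_poleSet.1 h with ⟨a, b, hab, e⟩ | ⟨a, e, e'⟩ <;>
    rcases mem_poleSet.1 h' with ⟨c, d, hcd, f⟩ | ⟨c, f, f'⟩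
  · simp only [Prod.mk.injEq] at e f
    have h1 := s.injective (e.1.symm.trans f.2)
    have h2 := s.injective (e.2.symm.trans f.1)
    subst h1 h2
    exact hab.asymm hcd
  · simp only [Prod.mk.injEq] at e
    exact f' a e.1
  · simp only [Prod.mk.injEq] at f
    exact e' c f.1
  · exact e' c f

theorem univ_erase_apply (s : Fin ℓ ↪ Fin n) (a : Fin ℓ) :
    Finset.univ.erase (s a) = (Finset.univ.erase a).map s ∪ (Finset.univ.map s)ᶜ := by
  ext j
  simp only [Finset.mem_erase, Finset.mem_univ, and_true, Finset.mem_union, Finset.mem_map,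
    Finset.mem_compl, not_exists, true_and]
  constructor
  · intro h
    by_cases hj : ∃ b, s b = j
    · obtain ⟨b, rfl⟩ := hj
      exact Or.inl ⟨b, fun e => h (e ▸ rfl), rfl⟩
    · push Not at hj
      exact Or.inr hj
  · rintro (⟨b, hb, rfl⟩ | h)
    · exact fun e => hb (s.injective e)
    · exact fun e => h a e.symm

/-- An ordered pair starting in the image of s either leaves the image or joins two of its points.
The increasing pairs of the second kind belong to `poleSet`, and the reversed ones form the last
product. -/
theorem prod_erase_apply {M : Type*} [CommMonoid M] (s : Fin ℓ ↪ Fin n) (F : Fin n → Fin n → M) :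
    ∏ a, ∏ j ∈ Finset.univ.erase (s a), F (s a) j =
      (∏ p ∈ poleSet s, F p.1 p.2) * ∏ p ∈ ltPairs ℓ, F (s p.2) (s p.1) := by
  have h1 : ∀ a, ∏ j ∈ Finset.univ.erase (s a), F (s a) j =
      (∏ b ∈ Finset.univ.erase a, F (s a) (s b)) * ∏ j ∈ (Finset.univ.map s)ᶜ, F (s a) j := by
    intro a
    rw [univ_erase_apply, Finset.prod_union, Finset.prod_map]
    rw [Finset.disjoint_left]
    intro j hj hj'
    obtain ⟨b, _, rfl⟩ := Finset.mem_map.1 hj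
    simp at hj'
  have h2 : ∏ a, ∏ b ∈ Finset.univ.erase a, F (s a) (s b) =
      (∏ p ∈ ltPairs ℓ, F (s p.1) (s p.2)) * ∏ p ∈ ltPairs ℓ, F (s p.2) (s p.1) := by
    rw [prod_ltPairs fun a b => F (s a) (s b), prod_ltPairs fun a b => F (s b) (s a)]
    have h3 : ∀ a : Fin ℓ, ∏ b ∈ Finset.univ.erase a, F (s a) (s b) =
        (∏ b ∈ Finset.Ioi a, F (s a) (s b)) * ∏ b ∈ Finset.Iio a, F (s a) (s b) := by
      intro a
      rw [← Finset.prod_union]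
      · congr 1
        ext b
        simp only [Finset.mem_erase, Finset.mem_univ, and_true, Finset.mem_union, Finset.mem_Ioi,
          Finset.mem_Iio, ne_eq]
        omega
      · rw [Finset.disjoint_left]
        intro b hb hb'
        simp only [Finset.mem_Ioi, Finset.mem_Iio] at hb hb'
        exact hb.asymm hb'
    simp_rw [h3, Finset.prod_mul_distrib]
    congr 1
    rw [Finset.prod_comm' (t' := Finset.univ) (s' := fun b => Finset.Ioi b)]
    simp
  simp_rw [h1, Finset.prod_mul_distrib]
  rw [h2, poleSet, Finset.prod_union (disjoint_poleSet s), Finset.prod_map, Finset.prod_product,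
    Finset.prod_map]
  simp only [Function.Embedding.coe_prodMap, Prod.map_fst, Prod.map_snd]
  exact mul_right_comm _ _ _

/-- The factor `∏_{a < b} (x_{s(a)} - x_{s(b)}) / (x_{s(a)} + x_{s(b)})`. -/
noncomputable def signFactor (s : Fin ℓ → Fin n) : RatFun (Fin n) :=
  ∏ p ∈ ltPairs ℓ, (pt n (s p.1) - pt n (s p.2)) / (pt n (s p.1) + pt n (s p.2))

theorem signFactor_comp (s : Fin ℓ → Fin n) (σ : Equiv.Perm (Fin ℓ)) :
    signFactor (s ∘ σ) = ((Equiv.Perm.sign σ : ℤ) : RatFun (Fin n)) * signFactor s := by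
  exact prod_ltPairs_comp (fun a b => (pt n (s a) - pt n (s b)) / (pt n (s a) + pt n (s b)))
    (fun a b => by rw [← neg_div, neg_sub, add_comm]) σ

theorem signFactor_ne_zero (s : Fin ℓ ↪ Fin n) : signFactor s ≠ 0 :=
  Finset.prod_ne_zero_iff.2 fun p hp => by
    have h : s p.1 ≠ s p.2 := fun e => by
      have := (Finset.mem_filter.1 hp).2
      exact this.ne (s.injective e)
    exact div_ne_zero ((generic_pt n).sub_ne _ _ h) ((generic_pt n).add_ne _ _ h)

/-- The common factor of the values of the solutions at `X_a = -1/x_{s(a)}`. -/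
noncomputable def baseValue (s : Fin ℓ → Fin n) : RatFun (Fin n) :=
  signFactor s * ∏ a, ∏ j ∈ Finset.univ.erase (s a), (pt n (s a) + pt n j) / pt n (s a)

theorem baseValue_comp (s : Fin ℓ → Fin n) (σ : Equiv.Perm (Fin ℓ)) :
    baseValue (s ∘ σ) = ((Equiv.Perm.sign σ : ℤ) : RatFun (Fin n)) * baseValue s := by
  rw [baseValue, signFactor_comp, baseValue, mul_assoc]
  congr 2
  exact Equiv.prod_comp σ fun a => ∏ j ∈ Finset.univ.erase (s a), (pt n (s a) + pt n j) / pt n (s a)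

theorem baseValue_ne_zero (s : Fin ℓ ↪ Fin n) : baseValue s ≠ 0 := by
  refine mul_ne_zero (signFactor_ne_zero s) (Finset.prod_ne_zero_iff.2 fun a _ =>
    Finset.prod_ne_zero_iff.2 fun j hj => ?_)
  exact div_ne_zero ((generic_pt n).add_ne _ _ (Finset.ne_of_mem_erase hj).symm) (pt_ne_zero _)

/-- The product of the sums of variables in a set of pairs. -/
noncomputable def sumProd {σ : Type*} (T : Finset (σ × σ)) : MvPolynomial σ ℂ :=
  ∏ p ∈ T, (X p.1 + X p.2)

/-- Each sum x_{s(a)} + x_{s(b)} occurs twice in the product over a, and `signFactor` replaces one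
copy by the difference. -/
theorem baseValue_mul (s : Fin ℓ ↪ Fin n) :
    baseValue s * ∏ a, pt n (s a) ^ (n - 1) =
      toRat _ (diffProd ((ltPairs ℓ).map (s.prodMap s)) * sumProd (poleSet s)) := by
  have h1 : ∀ a, (∏ j ∈ Finset.univ.erase (s a), (pt n (s a) + pt n j) / pt n (s a)) *
      pt n (s a) ^ (n - 1) = ∏ j ∈ Finset.univ.erase (s a), (pt n (s a) + pt n j) := by
    intro a
    rw [Finset.prod_div_distrib, Finset.prod_const, Finset.card_erase_of_mem (Finset.mem_univ _),
      Finset.card_univ, Fintype.card_fin, div_mul_cancel₀ _ (pow_ne_zero _ (pt_ne_zero _))]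
  rw [baseValue, mul_assoc, ← Finset.prod_mul_distrib]
  simp_rw [h1]
  rw [prod_erase_apply s fun i j => pt n i + pt n j, signFactor, map_mul, diffProd, sumProd,
    map_prod, map_prod, Finset.prod_map, mul_left_comm, ← Finset.prod_mul_distrib, mul_comm]
  simp only [map_sub, map_add, Function.Embedding.coe_prodMap, Prod.map_fst, Prod.map_snd]
  congr 1
  refine Finset.prod_congr rfl fun p hp => ?_
  have h : s p.1 ≠ s p.2 := fun e => by
    have := (Finset.mem_filter.1 hp).2
    exact this.ne (s.injective e)
  rw [add_comm (pt n (s p.2)), div_mul_cancel₀ _ ((generic_pt n).add_ne _ _ h)]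
  rfl

end Pairs

/-! ### Coprimality of the forms x_i ± x_j. -/

section LinearForms

theorem linear_not_dvd {n : ℕ} {i j k l : Fin n} {c e : ℤ} (hij : i ≠ j) (hkl : k ≠ l)
    (hc : c = 1 ∨ c = -1) (he : e = 1 ∨ e = -1)
    (h : c ≠ e ∨ ¬ ((k = i ∧ l = j) ∨ (k = j ∧ l = i))) :
    ¬ (X j - C (c : ℂ) * X i : MvPolynomial (Fin n) ℂ) ∣ X l - C (e : ℂ) * X k := by
  rintro ⟨r, hr⟩
  -- A zero of the first form at which the second does not vanish: the coordinates other than i and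
  -- j are distinct integers that are at least 2.
  let v : Fin n → ℤ := fun t => if t = i then 1 else if t = j then c else t + 2
  have h1 := congrArg (eval fun t => (v t : ℂ)) hr
  simp only [map_mul, map_sub, eval_X, eval_C] at h1
  have hvi : v i = 1 := if_pos rfl
  have hvj : v j = c := by simp [v, hij.symm]
  rw [hvi, hvj, Int.cast_one, mul_one, sub_self, zero_mul] at h1
  have h2 : v l - e * v k = 0 := by exact_mod_cast h1
  simp only [v] at h2
  have hkl' : (k : ℕ) ≠ l := fun h => hkl (Fin.ext h)
  rcases hc with rfl | rfl <;> rcases he with rfl | rfl <;> split_ifs at h2 <;> grind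

theorem prod_linear_dvd {n : ℕ} {S T : Finset (Fin n × Fin n)} (hS : S ⊆ T)
    (hT : T ⊆ Finset.univ.offDiag) (hT' : ∀ i j, (i, j) ∈ T → (j, i) ∉ T)
    {p : MvPolynomial (Fin n) ℂ} (h1 : ∀ t ∈ S, X t.1 - X t.2 ∣ p)
    (h2 : ∀ t ∈ T, X t.1 + X t.2 ∣ p) : diffProd S * sumProd T ∣ p := by
  let f : (Fin n × Fin n) ⊕ (Fin n × Fin n) → MvPolynomial (Fin n) ℂ :=
    Sum.elim (fun t => X t.1 - C ((1 : ℤ) : ℂ) * X t.2) fun t => X t.1 - C ((-1 : ℤ) : ℂ) * X t.2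
  have e1 : diffProd S * sumProd T = ∏ t ∈ S.disjSum T, f t := by
    rw [Finset.prod_disjSum, diffProd, sumProd]
    simp [f]
  have hne : ∀ t ∈ T, t.1 ≠ t.2 := fun t ht => (Finset.mem_offDiag.1 (hT ht)).2.2
  have hirr : ∀ t ∈ S.disjSum T, Irreducible (f t) := by
    intro t ht
    rcases Finset.mem_disjSum.1 ht with ⟨u, hu, rfl⟩ | ⟨u, hu, rfl⟩
    · exact (X_sub_prime (hne u (hS hu)).symm _).irreducible
    · exact (X_sub_prime (hne u hu).symm _).irreducible
  rw [e1]
  refine Finset.prod_dvd_of_isRelPrime ?_ ?_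
  · intro t ht u hu htu
    rw [Function.onFun, (hirr t ht).isRelPrime_iff_not_dvd]
    rcases Finset.mem_disjSum.1 ht with ⟨t, ht', rfl⟩ | ⟨t, ht', rfl⟩ <;>
      rcases Finset.mem_disjSum.1 hu with ⟨u, hu', rfl⟩ | ⟨u, hu', rfl⟩ <;>
      clear ht hu <;> rename' ht' => ht, hu' => hu
    · refine linear_not_dvd (hne t (hS ht)).symm (hne u (hS hu)).symm (Or.inl rfl) (Or.inl rfl)
        (Or.inr ?_)
      rintro (⟨e, e'⟩ | ⟨e, e'⟩)
      · exact htu (congrArg _ (Prod.ext e'.symm e.symm))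
      · refine hT' _ _ (hS ht) ?_
        convert hS hu using 1
        exact Prod.ext e'.symm e.symm
    · exact linear_not_dvd (hne t (hS ht)).symm (hne u hu).symm (Or.inl rfl) (Or.inr rfl)
        (Or.inl (by decide))
    · exact linear_not_dvd (hne t ht).symm (hne u (hS hu)).symm (Or.inr rfl) (Or.inl rfl)
        (Or.inl (by decide))
    · refine linear_not_dvd (hne t ht).symm (hne u hu).symm (Or.inr rfl) (Or.inr rfl)
        (Or.inr ?_)
      rintro (⟨e, e'⟩ | ⟨e, e'⟩)
      · exact htu (congrArg _ (Prod.ext e'.symm e.symm))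
      · refine hT' _ _ ht ?_
        convert hu using 1
        exact Prod.ext e'.symm e.symm
  · intro t ht
    rcases Finset.mem_disjSum.1 ht with ⟨u, hu, rfl⟩ | ⟨u, hu, rfl⟩
    · simpa [f] using h1 u hu
    · simpa [f] using h2 u hu

end LinearForms

/-! ### Consequences of the null residue equations at arbitrary points. -/

section Vanishing

/-- Clearing the denominators of the substitution `X_ℓ = ε x⁻¹`, `x_{n-1} = x`, `x_n = -x`. -/
theorem exists_rho_clear {m k : ℕ} (ε : ℂ) (P : Poly (m + 2) (k + 1)) :
    ∃ (N : ℕ) (Q : Poly (m + 1) k),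
      rho ε P * algebraMap (Poly (m + 1) k) (FractionRing (Poly (m + 1) k)) (X (Sum.inr (Fin.last m)) ^ N) =
        algebraMap (Poly (m + 1) k) (FractionRing (Poly (m + 1) k)) Q ∧
      ∀ {L : Type} [Field L] [Algebra ℂ L] (ξ : Fin (k + 1) → L) (y : Fin (m + 2) → L),
        y (Fin.last _) = -y (Fin.last m).castSucc → y (Fin.last m).castSucc ≠ 0 →
        ξ (Fin.last k) = algebraMap ℂ L ε * (y (Fin.last m).castSucc)⁻¹ →
        evalAt ξ y P * y (Fin.last m).castSucc ^ N =
          evalAt (fun a => ξ a.castSucc) (fun j => y j.castSucc) Q := by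
  have hx : algebraMap (Poly (m + 1) k) (FractionRing (Poly (m + 1) k)) (X (Sum.inr (Fin.last m))) ≠ 0 := by
    rw [map_ne_zero_iff _ (IsFractionRing.injective _ _)]
    exact X_ne_zero _
  induction P using MvPolynomial.induction_on with
  | C r =>
    refine ⟨0, C r, ?_, fun ξ y _ _ _ => ?_⟩
    · simp only [rho, aeval_C, pow_zero, map_one, mul_one]
      rfl
    · simp only [evalAt, aeval_C, pow_zero, mul_one]
  | add P P' ih ih' =>
    obtain ⟨N, Q, h1, h2⟩ := ih
    obtain ⟨N', Q', h1', h2'⟩ := ih'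
    refine ⟨N + N', Q * X (Sum.inr (Fin.last m)) ^ N' + Q' * X (Sum.inr (Fin.last m)) ^ N, ?_,
      fun ξ y e1 e2 e3 => ?_⟩
    · simp only [map_add, map_mul, ← h1, ← h1', map_pow]
      ring
    · simp only [map_add, map_mul, ← h2 ξ y e1 e2 e3, ← h2' ξ y e1 e2 e3, map_pow, evalAt_inr]
      ring
  | mul_X P i ih =>
    obtain ⟨N, Q, h1, h2⟩ := ih
    rcases i with a | j
    · induction a using Fin.lastCases with
      | last =>
        refine ⟨N + 1, Q * C ε, ?_, fun ξ y e1 e2 e3 => ?_⟩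
        · have e : rho ε (X (Sum.inl (Fin.last k)) : Poly (m + 2) (k + 1)) =
              algebraMap ℂ _ ε * (algebraMap (Poly (m + 1) k) (FractionRing (Poly (m + 1) k))
                (X (Sum.inr (Fin.last m))))⁻¹ := by
            simp only [rho, aeval_X, Sum.elim_inl, Fin.snoc_last]
          have e' : algebraMap (Poly (m + 1) k) (FractionRing (Poly (m + 1) k)) (C ε : Poly (m + 1) k) =
              algebraMap ℂ _ ε := rfl
          rw [map_mul, map_mul, ← h1, e, e', map_pow, map_pow, pow_succ]
          field_simp
        · rw [map_mul, map_mul, ← h2 ξ y e1 e2 e3, evalAt_inl, e3, pow_succ]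
          have e' : evalAt (fun a => ξ a.castSucc) (fun j => y j.castSucc) (C ε) =
              algebraMap ℂ _ ε := aeval_C _ _
          rw [e']
          field_simp
      | cast a =>
        refine ⟨N, Q * X (Sum.inl a), ?_, fun ξ y e1 e2 e3 => ?_⟩
        · have e : rho ε (X (Sum.inl a.castSucc) : Poly (m + 2) (k + 1)) =
              algebraMap (Poly (m + 1) k) (FractionRing (Poly (m + 1) k)) (X (Sum.inl a)) := by
            simp only [rho, aeval_X, Sum.elim_inl, Fin.snoc_castSucc]
          rw [map_mul, map_mul, ← h1, e]
          ring
        · rw [map_mul, map_mul, ← h2 ξ y e1 e2 e3, evalAt_inl, evalAt_inl]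
          ring
    · induction j using Fin.lastCases with
      | last =>
        refine ⟨N, -(Q * X (Sum.inr (Fin.last m))), ?_, fun ξ y e1 e2 e3 => ?_⟩
        · have e : rho ε (X (Sum.inr (Fin.last (m + 1))) : Poly (m + 2) (k + 1)) =
              -algebraMap (Poly (m + 1) k) (FractionRing (Poly (m + 1) k)) (X (Sum.inr (Fin.last m))) := by
            simp only [rho, aeval_X, Sum.elim_inr, Fin.snoc_last]
          rw [map_mul, map_neg, map_mul, ← h1, e]
          ring
        · rw [map_mul, map_neg, map_mul, ← h2 ξ y e1 e2 e3, evalAt_inr, evalAt_inr, e1]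
          ring
      | cast j =>
        refine ⟨N, Q * X (Sum.inr j), ?_, fun ξ y e1 e2 e3 => ?_⟩
        · have e : rho ε (X (Sum.inr j.castSucc) : Poly (m + 2) (k + 1)) =
              algebraMap (Poly (m + 1) k) (FractionRing (Poly (m + 1) k)) (X (Sum.inr j)) := by
            simp only [rho, aeval_X, Sum.elim_inr, Fin.snoc_castSucc]
          rw [map_mul, map_mul, ← h1, e]
          ring
        · rw [map_mul, map_mul, ← h2 ξ y e1 e2 e3, evalAt_inr, evalAt_inr]
          ring

/-- The equation holds at the generic point. Multiplied by a power of x it is a polynomial identity,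
and so it specializes to every point with x ≠ 0, whatever coincidences hold among the other
coordinates. -/
theorem evalAt_eq_zero_of_rho {m k : ℕ} {ε : ℂ} {P : Poly (m + 2) (k + 1)} (h : rho ε P = 0)
    {L : Type} [Field L] [Algebra ℂ L] (ξ : Fin (k + 1) → L) (y : Fin (m + 2) → L)
    (e1 : y (Fin.last _) = -y (Fin.last m).castSucc) (e2 : y (Fin.last m).castSucc ≠ 0)
    (e3 : ξ (Fin.last k) = algebraMap ℂ L ε * (y (Fin.last m).castSucc)⁻¹) :
    evalAt ξ y P = 0 := by
  obtain ⟨N, Q, h1, h2⟩ := exists_rho_clear ε P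
  rw [h, zero_mul, eq_comm, map_eq_zero_iff _ (IsFractionRing.injective _ _)] at h1
  have := h2 ξ y e1 e2 e3
  rw [h1, map_zero] at this
  exact (mul_eq_zero.1 this).resolve_right (pow_ne_zero _ e2)

theorem exists_perm_pair {α : Type*} [DecidableEq α] {a b i j : α} (hab : a ≠ b) (hij : i ≠ j) :
    ∃ τ : Equiv.Perm α, τ a = i ∧ τ b = j := by
  refine ⟨Equiv.swap b j * Equiv.swap a (Equiv.swap b j i), ?_, ?_⟩
  · rw [Equiv.Perm.mul_apply, Equiv.swap_apply_left, Equiv.swap_apply_self]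
  · have h : b ≠ Equiv.swap b j i := fun e => hij (by
      have := congrArg (Equiv.swap b j) e
      rwa [Equiv.swap_apply_self, Equiv.swap_apply_left, eq_comm] at this)
    rw [Equiv.Perm.mul_apply, Equiv.swap_apply_of_ne_of_ne hab.symm h, Equiv.swap_apply_left]

/-- The symmetries of P move a, i, j to the positions used in the definition. The equation with sign
-1 suffices, since exchanging the last two variables turns it into the other one. -/
theorem evalAt_eq_zero_of_mem_U {n ℓ : ℕ} {P : Poly n ℓ} (hP : P ∈ U n ℓ)
    {L : Type} [Field L] [Algebra ℂ L] (ξ : Fin ℓ → L) (y : Fin n → L) {a : Fin ℓ} {i j : Fin n}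
    (hij : i ≠ j) (h0 : y i ≠ 0) (hy : y j = -y i) (hξ : ξ a = -(y i)⁻¹) :
    evalAt ξ y P = 0 := by
  obtain ⟨m, rfl⟩ : ∃ m, n = m + 2 := ⟨n - 2, by
    have h1 : (i : ℕ) ≠ j := fun h => hij (Fin.ext h)
    have := i.2
    have := j.2
    omega⟩
  obtain ⟨k, rfl⟩ : ∃ k, ℓ = k + 1 := ⟨ℓ - 1, by
    have := a.2
    omega⟩
  obtain ⟨τ, h1, h2⟩ := exists_perm_pair (Fin.castSucc_lt_last (Fin.last m)).ne hij
  have h3 := evalAt_perm ξ y hP.1 (Equiv.swap (Fin.last k) a) τ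
  rw [evalAt_eq_zero_of_rho (ε := -1) hP.2.2] at h3
  · rcases Int.units_eq_one_or (Equiv.Perm.sign (Equiv.swap (Fin.last k) a)) with e | e <;>
      rw [e] at h3 <;> simpa [eq_comm] using h3
  · simp [h1, h2, hy]
  · simpa [h1] using h0
  · simp [h1, hξ]

end Vanishing

/-! ### Solutions give equivariant polynomial values. -/

section Forward

variable {n ℓ : ℕ}

/-- The degree bound makes the power n - 1 sufficient. The polynomial p does not depend on the point
y, so its divisibility can be tested by substituting x_j = ±x_i in y. -/
theorem exists_clear {P : Poly n ℓ} (hP : ∀ m ∈ P.support, ∀ a : Fin ℓ, m (Sum.inl a) < n)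
    (s : Fin ℓ → Fin n) : ∃ p : MvPolynomial (Fin n) ℂ,
      ∀ y : Fin n → RatFun (Fin n), (∀ i, y i ≠ 0) →
        evalAt (fun a => -(y (s a))⁻¹) y P * ∏ a, y (s a) ^ (n - 1) = aeval y p := by
  refine ⟨∑ m ∈ P.support, C (coeff m P) * (∏ a, (-1) ^ m (Sum.inl a) *
    X (s a) ^ (n - 1 - m (Sum.inl a))) * ∏ j, X j ^ m (Sum.inr j), fun y hy => ?_⟩
  conv_lhs => rw [P.as_sum]
  rw [map_sum, map_sum, Finset.sum_mul]
  refine Finset.sum_congr rfl fun m hm => ?_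
  rw [monomial_eq, map_mul, Finsupp.prod_fintype _ _ (by simp), Fintype.prod_sum_type, map_mul,
    map_prod, map_prod, map_mul, map_mul, map_prod, map_prod]
  simp only [map_pow, map_mul, evalAt_inl, evalAt_inr, aeval_X, map_neg, map_one, aeval_C]
  have e : evalAt (fun a => -(y (s a))⁻¹) y (C (coeff m P)) = algebraMap ℂ _ (coeff m P) :=
    aeval_C _ _
  have e2 : (∏ a, (-(y (s a))⁻¹) ^ m (Sum.inl a)) * ∏ a, y (s a) ^ (n - 1) =
      ∏ a, (-1) ^ m (Sum.inl a) * y (s a) ^ (n - 1 - m (Sum.inl a)) := by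
    rw [← Finset.prod_mul_distrib]
    refine Finset.prod_congr rfl fun a _ => ?_
    have h1 : n - 1 = (n - 1 - m (Sum.inl a)) + m (Sum.inl a) := by
      have := hP m hm a
      omega
    rw [neg_pow, mul_assoc]
    congr 1
    nth_rw 1 [h1]
    rw [pow_add, mul_left_comm, ← mul_pow, inv_mul_cancel₀ (hy _), one_pow, mul_one]
  rw [e, ← e2]
  ring

theorem aeval_pt (p : MvPolynomial (Fin n) ℂ) : aeval (pt n) p = toRat _ p := by
  have : aeval (pt n) = IsScalarTower.toAlgHom ℂ (MvPolynomial (Fin n) ℂ) (RatFun (Fin n)) := by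
    apply MvPolynomial.algHom_ext
    intro i
    rw [aeval_X]
    rfl
  rw [this]
  rfl

theorem toRat_substVar (i j : Fin n) (c : ℂ) (p : MvPolynomial (Fin n) ℂ) :
    toRat _ (substVar i j c p) = aeval (fun t => toRat _ (substVar i j c (X t))) p := by
  have : (IsScalarTower.toAlgHom ℂ (MvPolynomial (Fin n) ℂ) (RatFun (Fin n))).comp
      (substVar i j c) = aeval fun t => toRat _ (substVar i j c (X t)) := by
    apply MvPolynomial.algHom_ext
    intro t
    rw [aeval_X]
    rfl
  rw [← this]
  rfl

theorem substVar_X_ne_zero {i j : Fin n} {c : ℂ} (hc : c ≠ 0) (t : Fin n) :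
    toRat _ (substVar i j c (X t)) ≠ 0 := by
  rw [map_ne_zero_iff _ toRat_injective]
  by_cases ht : t = j
  · rw [ht, substVar_X_self]
    exact mul_ne_zero (by simpa using hc) (X_ne_zero _)
  · rw [substVar_X_of_ne c ht]
    exact X_ne_zero _

/-- The cleared value vanishes on x_{s(a)} = x_{s(b)} by anti-symmetry and on x_j = -x_{s(a)} by the
null residue equation. These linear forms are pairwise non-associated primes, so their product
divides it. -/
theorem exists_eq_baseValue_mul {P : Poly n ℓ} (hP : P ∈ U n ℓ) (s : Fin ℓ ↪ Fin n) :
    ∃ g : MvPolynomial (Fin n) ℂ, evalPoint s P = baseValue s * toRat _ g := by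
  obtain ⟨p, hp⟩ := exists_clear hP.1.1 s
  have hsub : ∀ (i j : Fin n) (c : ℂ), i ≠ j → c ≠ 0 →
      evalAt (fun a => -(toRat _ (substVar i j c (X (s a))))⁻¹)
        (fun t => toRat _ (substVar i j c (X t))) P = 0 → X j - C c * X i ∣ p := by
    intro i j c hij hc h
    rw [X_sub_dvd_iff hij]
    apply toRat_injective
    rw [toRat_substVar, ← hp _ (substVar_X_ne_zero hc), h, zero_mul, map_zero]
  have hdvd : diffProd ((ltPairs ℓ).map (s.prodMap s)) * sumProd (poleSet s) ∣ p := by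
    refine prod_linear_dvd Finset.subset_union_left (poleSet_subset s) (fun i j => poleSet_asymm)
      (fun t ht => ?_) fun t ht => ?_
    · obtain ⟨⟨a, b⟩, hab, rfl⟩ := Finset.mem_map.1 ht
      have hab' : a ≠ b := (Finset.mem_filter.1 hab).2.ne
      have hs : s b ≠ s a := fun e => hab' (s.injective e).symm
      have := hsub (s b) (s a) 1 hs one_ne_zero (evalAt_eq_zero_of_eq _ _ hP.1 hab' (by
        rw [substVar_X_self, substVar_X_of_ne _ hs]
        simp))
      simpa using this
    · obtain ⟨a, ha⟩ : ∃ a, t.1 = s a := by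
        rcases mem_poleSet.1 ht with ⟨a, b, _, rfl⟩ | ⟨a, h, _⟩
        · exact ⟨a, rfl⟩
        · exact ⟨a, h⟩
      have hne := (Finset.mem_offDiag.1 (poleSet_subset s ht)).2.2
      have := hsub t.1 t.2 (-1) hne (by norm_num)
        (evalAt_eq_zero_of_mem_U hP _ _ (a := a) hne (substVar_X_ne_zero (by norm_num) _) (by
          rw [substVar_X_self, substVar_X_of_ne _ hne]
          simp) (by rw [ha]))
      simpa [add_comm] using this
  obtain ⟨g, rfl⟩ := hdvd
  refine ⟨g, ?_⟩
  have h1 := hp (pt n) pt_ne_zero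
  rw [aeval_pt, map_mul (toRat _) _ g, ← baseValue_mul, mul_right_comm] at h1
  exact mul_right_cancel₀ (Finset.prod_ne_zero_iff.2 fun a _ => pow_ne_zero _ (pt_ne_zero _)) h1

theorem permRat_evalPoint {P : Poly n ℓ} (hP : P ∈ wedgePower n ℓ) (s : Fin ℓ → Fin n)
    (τ : Equiv.Perm (Fin n)) : permRat τ (evalPoint s P) = evalPoint (τ ∘ s) P := by
  have h1 : (permRat τ).comp (evalPoint s : Poly n ℓ →+* RatFun (Fin n)) =
      (evalAt (fun a => -(pt n (τ (s a)))⁻¹) (pt n ∘ τ) : Poly n ℓ →+* RatFun (Fin n)) := by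
    apply MvPolynomial.ringHom_ext
    · intro r
      have e1 : evalPoint s (C r : Poly n ℓ) = toRat _ (C r) := aeval_C _ _
      have e2 : evalAt (fun a => -(pt n (τ (s a)))⁻¹) (pt n ∘ τ) (C r : Poly n ℓ) =
        toRat _ (C r) := aeval_C _ _
      simp only [RingHom.comp_apply, RingHom.coe_coe]
      rw [e1, e2, permRat_toRat, rename_C]
    · rintro (a | j)
      · simp only [RingHom.comp_apply, RingHom.coe_coe]
        rw [evalPoint, evalAt_inl, evalAt_inl, map_neg, map_inv₀, permRat_pt, one_mul]
      · simp only [RingHom.comp_apply, RingHom.coe_coe]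
        rw [evalPoint, evalAt_inr, evalAt_inr, permRat_pt, one_mul, Function.comp_apply]
  refine (congrArg (fun f => f P) h1).trans ?_
  have := evalAt_perm (fun a => -(pt n (τ (s a)))⁻¹) (pt n) hP 1 τ
  simpa [evalPoint, Function.comp_def] using this

theorem evalPoint_comp {P : Poly n ℓ} (hP : P ∈ wedgePower n ℓ) (s : Fin ℓ → Fin n)
    (σ : Equiv.Perm (Fin ℓ)) :
    evalPoint (s ∘ σ) P = ((Equiv.Perm.sign σ : ℤ) : RatFun (Fin n)) * evalPoint s P := by
  have := evalAt_perm (fun a => -(pt n (s a))⁻¹) (pt n) hP σ 1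
  rw [zsmul_eq_mul] at this
  exact this

end Forward

/-! ### The family attached to a solution. -/

section Families

variable {n ℓ : ℕ}

theorem map_signFactor {φ : RatFun (Fin n) →+* RatFun (Fin n)} {τ : Equiv.Perm (Fin n)}
    {c : RatFun (Fin n)} (hc : c ≠ 0) (hφ : ∀ i, φ (pt n i) = c * pt n (τ i)) (s : Fin ℓ → Fin n) :
    φ (signFactor s) = signFactor (τ ∘ s) := by
  rw [signFactor, signFactor, map_prod]
  refine Finset.prod_congr rfl fun p _ => ?_
  rw [map_div₀, map_sub, map_add, hφ, hφ, ← mul_sub, ← mul_add, mul_div_mul_left _ _ hc]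
  rfl

theorem prod_univ_erase_perm {M : Type*} [CommMonoid M] (τ : Equiv.Perm (Fin n)) (i : Fin n)
    (f : Fin n → M) :
    ∏ j ∈ Finset.univ.erase i, f (τ j) = ∏ j ∈ Finset.univ.erase (τ i), f j := by
  refine Finset.prod_bij (fun j _ => τ j) (fun j hj => ?_) (fun j _ k _ h => τ.injective h)
    (fun j hj => ⟨τ.symm j, ?_, τ.apply_symm_apply j⟩) fun _ _ => rfl
  · simpa using hj
  · simp only [Finset.mem_erase, Finset.mem_univ, and_true] at hj ⊢
    exact fun e => hj (by rw [← e, Equiv.apply_symm_apply])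

theorem map_baseValue {φ : RatFun (Fin n) →+* RatFun (Fin n)} {τ : Equiv.Perm (Fin n)}
    {c : RatFun (Fin n)} (hc : c ≠ 0) (hφ : ∀ i, φ (pt n i) = c * pt n (τ i)) (s : Fin ℓ → Fin n) :
    φ (baseValue s) = baseValue (τ ∘ s) := by
  rw [baseValue, map_mul, map_signFactor hc hφ, baseValue, map_prod]
  congr 1
  refine Finset.prod_congr rfl fun a _ => ?_
  rw [map_prod, Function.comp_apply, ← prod_univ_erase_perm τ (s a) fun j =>
    (pt n (τ (s a)) + pt n j) / pt n (τ (s a))]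
  refine Finset.prod_congr rfl fun j _ => ?_
  rw [map_div₀, map_add, hφ, hφ, ← mul_add, mul_div_mul_left _ _ hc]

/-- The families of polynomials `g_I` indexed by the subsets with `ℓ` elements, equivariant for
permutations of the variables. -/
def IsFamily (ℓ : ℕ) (g : Finset (Fin n) → MvPolynomial (Fin n) ℂ) : Prop :=
  (∀ I, I.card ≠ ℓ → g I = 0) ∧
    ∀ (τ : Equiv.Perm (Fin n)) I, rename τ (g I) = g (I.map τ.toEmbedding)

/-- The polynomial has the values `g_I`, up to the common factors, where `I` is the image of
`s`. -/
def HasValues (P : Poly n ℓ) (g : Finset (Fin n) → MvPolynomial (Fin n) ℂ) : Prop :=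
  ∀ s : Fin ℓ ↪ Fin n, evalPoint s P = baseValue s * toRat _ (g (Finset.univ.map s))

theorem exists_perm_of_map_eq {s t : Fin ℓ ↪ Fin n} (h : Finset.univ.map s = Finset.univ.map t) :
    ∃ σ : Equiv.Perm (Fin ℓ), (s : Fin ℓ → Fin n) = t ∘ σ := by
  have h1 : ∀ a, ∃ b, t b = s a := fun a => by
    have : s a ∈ Finset.univ.map t := h ▸ Finset.mem_map_of_mem s (Finset.mem_univ a)
    simpa using this
  choose f hf using h1
  have hinj : Function.Injective f := fun a b e => s.injective (by rw [← hf, ← hf, e])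
  exact ⟨Equiv.ofBijective f (Finite.injective_iff_bijective.1 hinj), funext fun a => (hf a).symm⟩

theorem exists_hasValues {P : Poly n ℓ} (hP : P ∈ U n ℓ) :
    ∃ g, IsFamily ℓ g ∧ HasValues P g := by
  choose f hf using exists_eq_baseValue_mul hP
  -- The increasing enumeration of I is one choice of s. Any other differs by a permutation of the
  -- X_a, which multiplies both the value and `baseValue` by its sign.
  let g : Finset (Fin n) → MvPolynomial (Fin n) ℂ := fun I =>
    if h : I.card = ℓ then f (I.orderEmbOfFin h).toEmbedding else 0
  have hg : HasValues P g := by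
    intro s
    have hcard : (Finset.univ.map s).card = ℓ := by simp
    have h1 : Finset.univ.map s =
        Finset.univ.map ((Finset.univ.map s).orderEmbOfFin hcard).toEmbedding := by
      rw [Finset.map_orderEmbOfFin_univ]
    obtain ⟨σ, hσ⟩ := exists_perm_of_map_eq h1
    have h2 : g (Finset.univ.map s) =
      f ((Finset.univ.map s).orderEmbOfFin hcard).toEmbedding := dif_pos hcard
    rw [h2, hσ, evalPoint_comp hP.1, baseValue_comp, hf, mul_assoc]
  refine ⟨g, ⟨fun I hI => dif_neg hI, fun τ I => ?_⟩, hg⟩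
  by_cases hI : I.card = ℓ
  · obtain ⟨s, rfl⟩ : ∃ s : Fin ℓ ↪ Fin n, Finset.univ.map s = I :=
      ⟨(I.orderEmbOfFin hI).toEmbedding, Finset.map_orderEmbOfFin_univ _ _⟩
    apply toRat_injective
    rw [← permRat_toRat]
    have h1 := congrArg (permRat τ) (hg s)
    have h2 := hg (s.trans τ.toEmbedding)
    rw [map_mul, permRat_evalPoint hP.1, map_baseValue one_ne_zero (permRat_pt τ)] at h1
    rw [Finset.map_map]
    refine mul_left_cancel₀ (baseValue_ne_zero (s.trans τ.toEmbedding)) ?_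
    rw [← h2]
    exact h1.symm
  · have h1 : g I = 0 := dif_neg hI
    have h2 : g (I.map τ.toEmbedding) = 0 := dif_neg (by rwa [Finset.card_map])
    rw [h1, h2, map_zero]

theorem HasValues.eq {P Q : Poly n ℓ} {g : Finset (Fin n) → MvPolynomial (Fin n) ℂ}
    (hP : P ∈ wedgePower n ℓ) (hQ : Q ∈ wedgePower n ℓ) (h : HasValues P g) (h' : HasValues Q g) :
    P = Q := by
  rw [← sub_eq_zero]
  refine eq_zero_of_evalPoint (sub_mem hP hQ) fun s => ?_
  rw [map_sub, h s, h' s, sub_self]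

theorem HasValues.eq_family {P : Poly n ℓ} {g g' : Finset (Fin n) → MvPolynomial (Fin n) ℂ}
    (hg : IsFamily ℓ g) (hg' : IsFamily ℓ g') (h : HasValues P g) (h' : HasValues P g') :
    g = g' := by
  ext1 I
  by_cases hI : I.card = ℓ
  · obtain ⟨s, rfl⟩ : ∃ s : Fin ℓ ↪ Fin n, Finset.univ.map s = I :=
      ⟨(I.orderEmbOfFin hI).toEmbedding, Finset.map_orderEmbOfFin_univ _ _⟩
    exact toRat_injective (mul_left_cancel₀ (baseValue_ne_zero s) ((h s).symm.trans (h' s)))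
  · rw [hg.1 I hI, hg'.1 I hI]

end Families

/-! ### Lagrange interpolation of an equivariant family. -/

section Interpolation

variable {n ℓ : ℕ}

/-- The coefficients of the Lagrange interpolation. -/
noncomputable def lagrangeCoeff (g : Finset (Fin n) → MvPolynomial (Fin n) ℂ) (s : Fin ℓ ↪ Fin n) :
    RatFun (Fin n) :=
  toRat _ (g (Finset.univ.map s)) *
    (signFactor s * ∏ a, ∏ j ∈ Finset.univ.erase (s a),
      (pt n (s a) + pt n j) / (pt n (s a) - pt n j))

/-- The numerators of the Lagrange polynomials. -/
noncomputable def lagrangePoly (s : Fin ℓ → Fin n) : Poly n ℓ :=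
  ∏ a, ∏ j ∈ Finset.univ.erase (s a), (1 + X (Sum.inl a) * X (Sum.inr j))

/-- Within the image of s each difference occurs twice in the denominator, and `signFactor` removes
one of the two copies up to sign. Hence all poles are simple. -/
theorem lagrangeCoeff_mul_diffProd (g : Finset (Fin n) → MvPolynomial (Fin n) ℂ)
    (s : Fin ℓ ↪ Fin n) : lagrangeCoeff g s * toRat _ (diffProd (poleSet s)) =
      toRat _ (g (Finset.univ.map s) * ((-1) ^ (ltPairs ℓ).card * sumProd (poleSet s))) := by
  have h1 : (∏ p ∈ poleSet s, (pt n p.1 + pt n p.2) / (pt n p.1 - pt n p.2)) *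
      toRat _ (diffProd (poleSet s)) = toRat _ (sumProd (poleSet s)) := by
    rw [diffProd, sumProd, map_prod, map_prod, ← Finset.prod_mul_distrib]
    refine Finset.prod_congr rfl fun p hp => ?_
    have hne := (Finset.mem_offDiag.1 (poleSet_subset s hp)).2.2
    rw [map_sub, map_add]
    exact div_mul_cancel₀ _ ((generic_pt n).sub_ne _ _ hne)
  have h2 : signFactor s * ∏ p ∈ ltPairs ℓ,
      (pt n (s p.2) + pt n (s p.1)) / (pt n (s p.2) - pt n (s p.1)) = (-1) ^ (ltPairs ℓ).card := by
    rw [signFactor, ← Finset.prod_mul_distrib, ← Finset.prod_const]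
    refine Finset.prod_congr rfl fun p hp => ?_
    have h : s p.2 ≠ s p.1 := fun e => by
      have := (Finset.mem_filter.1 hp).2
      exact this.ne (s.injective e).symm
    have e1 := (generic_pt n).sub_ne _ _ h
    have e2 := (generic_pt n).add_ne _ _ h
    rw [← neg_sub (pt n (s p.2)), add_comm (pt n (s p.1)), div_mul_div_cancel₀ e2,
      neg_div_self e1]
  rw [lagrangeCoeff, prod_erase_apply s fun i j => (pt n i + pt n j) / (pt n i - pt n j),
    mul_left_comm (signFactor _), h2, map_mul, map_mul, map_pow, map_neg, map_one, ← h1]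
  ring

theorem dvd_sumProd {σ : Type*} {T : Finset (σ × σ)} {i j : σ} (h : (i, j) ∈ T) :
    X i + X j ∣ sumProd T := by
  classical
  rw [sumProd, ← Finset.mul_prod_erase T _ h]
  exact dvd_mul_right _ _

/-- The numerators retain the factors x_{s(a)} + x_j, which are responsible for the null residue
equations. -/
theorem exists_lagrangeCoeff_mul (g : Finset (Fin n) → MvPolynomial (Fin n) ℂ)
    (s : Fin ℓ ↪ Fin n) : ∃ p, lagrangeCoeff g s * toRat _ (diffProd Finset.univ.offDiag) =
      toRat _ p ∧ ∀ a j, j ≠ s a → X (s a) + X j ∣ p := by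
  refine ⟨g (Finset.univ.map s) * ((-1) ^ (ltPairs ℓ).card * sumProd (poleSet s)) *
    diffProd (Finset.univ.offDiag \ poleSet s), ?_, fun a j hj => ?_⟩
  · rw [map_mul, ← lagrangeCoeff_mul_diffProd, mul_assoc, ← map_mul]
    congr 2
    rw [diffProd, diffProd, diffProd, mul_comm, Finset.prod_sdiff (poleSet_subset s)]
  · refine Dvd.dvd.mul_right (Dvd.dvd.mul_left (Dvd.dvd.mul_left ?_ _) _) _
    by_cases h : ∃ b, j = s b
    · obtain ⟨b, rfl⟩ := h
      have hab : a ≠ b := fun e => hj (e ▸ rfl)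
      rcases hab.lt_or_gt with h | h
      · exact dvd_sumProd (mem_poleSet.2 (Or.inl ⟨a, b, h, rfl⟩))
      · rw [add_comm]
        exact dvd_sumProd (mem_poleSet.2 (Or.inl ⟨b, a, h, rfl⟩))
    · push Not at h
      exact dvd_sumProd (mem_poleSet.2 (Or.inr ⟨a, rfl, h⟩))

theorem lagrangeCoeff_trans {g : Finset (Fin n) → MvPolynomial (Fin n) ℂ} (hg : IsFamily ℓ g)
    (s : Fin ℓ ↪ Fin n) (τ : Equiv.Perm (Fin n)) :
    permRat τ (lagrangeCoeff g s) = lagrangeCoeff g (s.trans τ.toEmbedding) := by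
  rw [lagrangeCoeff, lagrangeCoeff, map_mul, map_mul, permRat_toRat, hg.2, Finset.map_map,
    map_signFactor one_ne_zero (permRat_pt τ), map_prod]
  congr 2
  refine Finset.prod_congr rfl fun a _ => ?_
  rw [map_prod]
  refine Eq.trans (Finset.prod_congr rfl fun j _ => ?_) (prod_univ_erase_perm τ (s a) fun j =>
    (pt n (τ (s a)) + pt n j) / (pt n (τ (s a)) - pt n j))
  rw [map_div₀, map_add, map_sub, permRat_pt, permRat_pt, one_mul, one_mul]

theorem lagrangeCoeff_comp (g : Finset (Fin n) → MvPolynomial (Fin n) ℂ)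
    (s : Fin ℓ ↪ Fin n) (σ : Equiv.Perm (Fin ℓ)) :
    lagrangeCoeff g (σ.toEmbedding.trans s) =
      ((Equiv.Perm.sign σ : ℤ) : RatFun (Fin n)) * lagrangeCoeff g s := by
  have h1 : Finset.univ.map (σ.toEmbedding.trans s) = Finset.univ.map s := by
    rw [← Finset.map_map, Finset.map_univ_equiv]
  have h2 : signFactor (σ.toEmbedding.trans s) =
      ((Equiv.Perm.sign σ : ℤ) : RatFun (Fin n)) * signFactor s := signFactor_comp s σ
  rw [lagrangeCoeff, h1, h2, lagrangeCoeff, mul_assoc, mul_left_comm]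
  congr 3
  exact Equiv.prod_comp σ fun a => ∏ j ∈ Finset.univ.erase (s a),
    (pt n (s a) + pt n j) / (pt n (s a) - pt n j)

/-- The Lagrange interpolation. -/
noncomputable def lagrangeSum (ℓ : ℕ) (g : Finset (Fin n) → MvPolynomial (Fin n) ℂ) :
    MvPolynomial (Fin ℓ) (RatFun (Fin n)) :=
  ∑ s : Fin ℓ ↪ Fin n, C (lagrangeCoeff g s) * overRat n ℓ (lagrangePoly s)

theorem rename_right_lagrangePoly (s : Fin ℓ → Fin n) (τ : Equiv.Perm (Fin n)) :
    rename (Sum.map id τ) (lagrangePoly s) = lagrangePoly (τ ∘ s) := by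
  rw [lagrangePoly, lagrangePoly, map_prod]
  refine Finset.prod_congr rfl fun a _ => ?_
  rw [map_prod]
  refine Eq.trans (Finset.prod_congr rfl fun j _ => ?_) (prod_univ_erase_perm τ (s a) fun j =>
    (1 + X (Sum.inl a) * X (Sum.inr j) : Poly n ℓ))
  simp

theorem rename_left_lagrangePoly (s : Fin ℓ → Fin n) (σ : Equiv.Perm (Fin ℓ)) :
    rename (Sum.map σ id) (lagrangePoly (s ∘ σ)) = lagrangePoly s := by
  rw [lagrangePoly, lagrangePoly, map_prod, ← Equiv.prod_comp σ fun b =>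
    ∏ j ∈ Finset.univ.erase (s b), (1 + X (Sum.inl b) * X (Sum.inr j) : Poly n ℓ)]
  refine Finset.prod_congr rfl fun a _ => ?_
  rw [map_prod]
  refine Finset.prod_congr rfl fun j _ => ?_
  simp

theorem map_permRat_lagrangeSum {g : Finset (Fin n) → MvPolynomial (Fin n) ℂ} (hg : IsFamily ℓ g)
    (τ : Equiv.Perm (Fin n)) :
    MvPolynomial.map (permRat τ) (lagrangeSum ℓ g) = lagrangeSum ℓ g := by
  rw [lagrangeSum, map_sum]
  refine Fintype.sum_equiv (Equiv.embeddingCongr (Equiv.refl _) τ) _ _ fun s => ?_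
  rw [map_mul, map_C, lagrangeCoeff_trans hg, ← overRat_rename_right, rename_right_lagrangePoly]
  rfl

theorem rename_lagrangeSum (g : Finset (Fin n) → MvPolynomial (Fin n) ℂ) (σ : Equiv.Perm (Fin ℓ)) :
    rename σ (lagrangeSum ℓ g) = ((Equiv.Perm.sign σ : ℤ) : MvPolynomial (Fin ℓ) (RatFun (Fin n))) *
      lagrangeSum ℓ g := by
  have h1 : lagrangeSum ℓ g = ∑ s : Fin ℓ ↪ Fin n, C (lagrangeCoeff g (σ.toEmbedding.trans s)) *
      overRat n ℓ (lagrangePoly (s ∘ σ)) :=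
    (Fintype.sum_equiv (Equiv.embeddingCongr σ.symm (Equiv.refl _)) _ _ fun s => rfl).symm
  nth_rw 1 [h1]
  rw [map_sum, lagrangeSum, Finset.mul_sum]
  refine Finset.sum_congr rfl fun s _ => ?_
  rw [map_mul, rename_C, ← overRat_rename_left, rename_left_lagrangePoly, lagrangeCoeff_comp,
    map_mul, mul_assoc, map_intCast]

theorem degreeOf_lagrangePoly (s : Fin ℓ → Fin n) (a : Fin ℓ) :
    degreeOf a (overRat n ℓ (lagrangePoly s)) ≤ n - 1 := by
  rw [lagrangePoly, map_prod]
  refine (degreeOf_prod_le _ _ _).trans ?_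
  have h : ∀ b : Fin ℓ, degreeOf a (overRat n ℓ (∏ j ∈ Finset.univ.erase (s b),
      (1 + X (Sum.inl b) * X (Sum.inr j)))) ≤ if b = a then n - 1 else 0 := by
    intro b
    rw [map_prod]
    refine (degreeOf_prod_le _ _ _).trans ?_
    have h1 : ∀ j, degreeOf a (overRat n ℓ (1 + X (Sum.inl b) * X (Sum.inr j))) ≤
        if b = a then 1 else 0 := by
      intro j
      rw [map_add, map_one, map_mul, overRat_inl, overRat_inr]
      refine (degreeOf_add_le _ _ _).trans ?_
      rw [degreeOf_one, max_eq_right (Nat.zero_le _)]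
      refine (degreeOf_mul_le _ _ _).trans ?_
      rw [degreeOf_C, add_zero, degreeOf_X]
      simp [eq_comm]
    refine (Finset.sum_le_sum fun j _ => h1 j).trans ?_
    rw [Finset.sum_const, Finset.card_erase_of_mem (Finset.mem_univ _), Finset.card_univ,
      Fintype.card_fin]
    split_ifs <;> simp
  refine (Finset.sum_le_sum fun b _ => h b).trans ?_
  simp

theorem coeff_overRat (Q : Poly n ℓ) (m : Fin ℓ →₀ ℕ) :
    ∃ p, coeff m (overRat n ℓ Q) = toRat _ p := by
  have h : overRat n ℓ Q = MvPolynomial.map (toRat (Fin n)) (sumAlgEquiv ℂ (Fin ℓ) (Fin n) Q) :=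
    congrArg (fun f => f Q) overRat_eq
  exact ⟨_, by rw [h, coeff_map]⟩

/-- Permutations of the x_j permute the summands, so each coefficient is an invariant sum of
functions with simple poles. -/
theorem coeff_lagrangeSum {g : Finset (Fin n) → MvPolynomial (Fin n) ℂ} (hg : IsFamily ℓ g)
    (m : Fin ℓ →₀ ℕ) : ∃ p, coeff m (lagrangeSum ℓ g) = toRat _ p := by
  have h1 : coeff m (lagrangeSum ℓ g) =
      ∑ s : Fin ℓ ↪ Fin n, lagrangeCoeff g s * coeff m (overRat n ℓ (lagrangePoly s)) := by
    rw [lagrangeSum, coeff_sum]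
    simp only [coeff_C_mul]
  rw [h1]
  refine exists_polynomial_of_simplePoles Finset.univ _ _ (fun s _ => ?_) fun a _ b _ _ => ?_
  · obtain ⟨p, hp⟩ := coeff_overRat (lagrangePoly s) m
    refine ⟨poleSet s, poleSet_subset s, fun i j => poleSet_asymm,
      g (Finset.univ.map s) * ((-1) ^ (ltPairs ℓ).card * sumProd (poleSet s)) * p, ?_⟩
    rw [mul_right_comm, lagrangeCoeff_mul_diffProd, hp, ← map_mul]
  · rw [← h1, ← coeff_map, map_permRat_lagrangeSum hg]

theorem eval_lagrangeSum (g : Finset (Fin n) → MvPolynomial (Fin n) ℂ) (s : Fin ℓ ↪ Fin n) :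
    eval (fun a => -(pt n (s a))⁻¹) (lagrangeSum ℓ g) =
      baseValue s * toRat _ (g (Finset.univ.map s)) := by
  rw [lagrangeSum, map_sum, Finset.sum_eq_single s]
  · rw [map_mul, eval_C, eval_overRat, lagrangePoly, map_prod, lagrangeCoeff, mul_assoc, mul_assoc,
      ← Finset.prod_mul_distrib, mul_comm, baseValue]
    congr 2
    refine Finset.prod_congr rfl fun a _ => ?_
    rw [map_prod, ← Finset.prod_mul_distrib]
    refine Finset.prod_congr rfl fun j hj => ?_
    rw [map_add, map_one, map_mul, evalAt_inl, evalAt_inr]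
    have e1 := (generic_pt n).sub_ne _ _ (Finset.ne_of_mem_erase hj).symm
    have e2 := pt_ne_zero (s a)
    field_simp
    ring
  · intro t _ hts
    -- Where t and s differ, the Lagrange polynomial of t contains the factor 1 + X_a x_{s(a)},
    -- which vanishes at X_a = -1/x_{s(a)}.
    obtain ⟨a, ha⟩ : ∃ a, t a ≠ s a := by
      by_contra h
      push Not at h
      exact hts (Function.Embedding.ext h)
    rw [map_mul, eval_overRat, lagrangePoly, map_prod]
    refine mul_eq_zero_of_right _ (Finset.prod_eq_zero (Finset.mem_univ a) ?_)
    rw [map_prod]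
    refine Finset.prod_eq_zero (Finset.mem_erase.2 ⟨ha.symm, Finset.mem_univ _⟩) ?_
    rw [map_add, map_one, map_mul, evalAt_inl, evalAt_inr, neg_mul, inv_mul_cancel₀ (pt_ne_zero _),
      add_neg_cancel]
  · simp

theorem diffProd_mul_eq_sum {g : Finset (Fin n) → MvPolynomial (Fin n) ℂ} {P : Poly n ℓ}
    (hP : overRat n ℓ P = lagrangeSum ℓ g) : ∃ p : (Fin ℓ ↪ Fin n) → MvPolynomial (Fin n) ℂ,
      (∀ s a j, j ≠ s a → X (s a) + X j ∣ p s) ∧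
      rename Sum.inr (diffProd Finset.univ.offDiag) * P =
        ∑ s, rename Sum.inr (p s) * lagrangePoly s := by
  choose p hp using fun s : Fin ℓ ↪ Fin n => exists_lagrangeCoeff_mul g s
  refine ⟨p, fun s => (hp s).2, ?_⟩
  apply overRat_injective
  rw [map_mul, hP, overRat_rename_inr, lagrangeSum, map_sum, Finset.mul_sum]
  refine Finset.sum_congr rfl fun s _ => ?_
  rw [map_mul, overRat_rename_inr, ← (hp s).1, map_mul]
  ring

/-- After multiplication by all differences, which φ does not kill, each summand vanishes. If s(a) =
i, its coefficient contains x_i + x_j. Otherwise its Lagrange polynomial contains 1 + X_a x_i. -/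
theorem hom_eq_zero_of_lagrange {L : Type*} [Field L] (φ : Poly n ℓ →+* L) {P : Poly n ℓ}
    {g : Finset (Fin n) → MvPolynomial (Fin n) ℂ} (hP : overRat n ℓ P = lagrangeSum ℓ g)
    (hφ : ∀ i j, i ≠ j → φ (X (Sum.inr i)) ≠ φ (X (Sum.inr j))) {a : Fin ℓ} {i j : Fin n}
    (hij : i ≠ j) (h1 : φ (X (Sum.inr i)) + φ (X (Sum.inr j)) = 0)
    (h2 : 1 + φ (X (Sum.inl a)) * φ (X (Sum.inr i)) = 0) : φ P = 0 := by
  obtain ⟨p, hp, h⟩ := diffProd_mul_eq_sum hP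
  have h3 : φ (rename Sum.inr (diffProd Finset.univ.offDiag)) * φ P = 0 := by
    rw [← map_mul, h, map_sum]
    refine Finset.sum_eq_zero fun s _ => ?_
    rw [map_mul]
    by_cases hs : s a = i
    · obtain ⟨r, hr⟩ := hp s a j (by rw [hs]; exact hij.symm)
      rw [hr, hs, map_mul, map_mul, map_add, map_add, rename_X, rename_X, h1, zero_mul, zero_mul]
    · refine mul_eq_zero_of_right _ ?_
      rw [lagrangePoly, map_prod]
      refine Finset.prod_eq_zero (Finset.mem_univ a) ?_
      rw [map_prod]
      refine Finset.prod_eq_zero (Finset.mem_erase.2 ⟨Ne.symm hs, Finset.mem_univ i⟩) ?_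
      rw [map_add, map_one, map_mul, h2]
  refine (mul_eq_zero.1 h3).resolve_left ?_
  rw [← ne_eq, diffProd, map_prod, map_prod, Finset.prod_ne_zero_iff]
  intro q hq
  rw [map_sub, map_sub, rename_X, rename_X, sub_ne_zero]
  exact hφ _ _ (Finset.mem_offDiag.1 hq).2.2

end Interpolation

/-! ### The isomorphism between families and solutions, and its degree. -/

section Solutions

variable {n ℓ : ℕ}

theorem nullResidue_of_lagrange {P : Poly n ℓ} {g : Finset (Fin n) → MvPolynomial (Fin n) ℂ}
    (hP : overRat n ℓ P = lagrangeSum ℓ g) : NullResidue P := by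
  rcases n with _ | _ | m
  · exact trivial
  · exact trivial
  rcases ℓ with _ | k
  · exact trivial
  let ι := algebraMap (Poly (m + 1) k) (FractionRing (Poly (m + 1) k))
  have hι : Function.Injective ι := IsFractionRing.injective _ _
  have e0 : ∀ (ε : ℂ) (j : Fin (m + 1)), (rho ε : Poly (m + 2) (k + 1) →ₐ[ℂ] _)
      (X (Sum.inr j.castSucc)) = ι (X (Sum.inr j)) := fun ε j => by
    simp only [rho, aeval_X, Sum.elim_inr, Fin.snoc_castSucc, ι]
  have e1 : ∀ ε : ℂ, (rho ε : Poly (m + 2) (k + 1) →ₐ[ℂ] _)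
      (X (Sum.inr (Fin.last (m + 1)))) = -ι (X (Sum.inr (Fin.last m))) := fun ε => by
    simp only [rho, aeval_X, Sum.elim_inr, Fin.snoc_last, ι]
  have e2 : ∀ ε : ℂ, (rho ε : Poly (m + 2) (k + 1) →ₐ[ℂ] _)
      (X (Sum.inl (Fin.last k))) = algebraMap ℂ _ ε * (ι (X (Sum.inr (Fin.last m))))⁻¹ :=
    fun ε => by simp only [rho, aeval_X, Sum.elim_inl, Fin.snoc_last, ι]
  have hx : ι (X (Sum.inr (Fin.last m))) ≠ 0 := by
    rw [map_ne_zero_iff _ hι]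
    exact X_ne_zero _
  have hsum : ∀ j : Fin (m + 1), ι (X (Sum.inr j)) ≠ -ι (X (Sum.inr (Fin.last m))) := by
    intro j h
    rw [← map_neg] at h
    have := congrArg (eval fun _ => (1 : ℂ)) (hι h)
    norm_num at this
  have hne : ∀ (ε : ℂ) (i j : Fin (m + 2)), i ≠ j →
      (rho ε : Poly (m + 2) (k + 1) →ₐ[ℂ] _) (X (Sum.inr i)) ≠ rho ε (X (Sum.inr j)) := by
    intro ε i j hij
    induction i using Fin.lastCases with
    | last =>
      induction j using Fin.lastCases with
      | last => exact absurd rfl hij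
      | cast j =>
        rw [e0, e1]
        exact (hsum j).symm
    | cast i =>
      induction j using Fin.lastCases with
      | last =>
        rw [e0, e1]
        exact hsum i
      | cast j =>
        rw [e0, e0]
        intro h
        have := Sum.inr_injective (X_injective (hι h))
        exact hij (by rw [this])
  have hlt := (Fin.castSucc_lt_last (Fin.last m)).ne
  -- For ε = 1 the point X = 1/x is -1/x_i with i the last index, where x_i = -x. For ε = -1 it is
  -- -1/x_i with i the last but one.
  constructor
  · refine hom_eq_zero_of_lagrange (n := m + 2) (ℓ := k + 1) (rho 1).toRingHom hP (hne 1)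
      (a := Fin.last k) hlt.symm ?_ ?_
    · change rho 1 _ + rho 1 _ = 0
      rw [e0, e1, neg_add_cancel]
    · change 1 + rho 1 _ * rho 1 _ = 0
      rw [e1, e2, map_one, one_mul, mul_neg, inv_mul_cancel₀ hx, add_neg_cancel]
  · refine hom_eq_zero_of_lagrange (n := m + 2) (ℓ := k + 1) (rho (-1)).toRingHom hP
      (hne (-1)) (a := Fin.last k) hlt ?_ ?_
    · change rho (-1) _ + rho (-1) _ = 0
      rw [e0, e1, add_neg_cancel]
    · change 1 + rho (-1) _ * rho (-1) _ = 0
      rw [e0, e2, map_neg, map_one, neg_mul, one_mul, neg_mul, inv_mul_cancel₀ hx,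
        add_neg_cancel]

theorem exists_mem_U {g : Finset (Fin n) → MvPolynomial (Fin n) ℂ} (hg : IsFamily ℓ g) :
    ∃ P ∈ U n ℓ, HasValues P g := by
  obtain ⟨P, hP, hdeg⟩ := exists_overRat_eq (lagrangeSum ℓ g) (coeff_lagrangeSum hg) (by
    intro m hm a
    rcases Nat.eq_zero_or_pos n with hn | hn
    · subst hn
      have : IsEmpty (Fin ℓ ↪ Fin 0) := ⟨fun s => (s a).elim0⟩
      rw [lagrangeSum, Finset.univ_eq_empty, Finset.sum_empty, support_zero] at hm
      simp at hm
    · refine lt_of_le_of_lt ((monomial_le_degreeOf a hm).trans (?_ : _ ≤ n - 1)) (by omega)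
      refine (degreeOf_sum_le _ _ _).trans (Finset.sup_le fun s _ => ?_)
      exact (degreeOf_C_mul_le _ _ _).trans (degreeOf_lagrangePoly s a))
  refine ⟨P, ⟨⟨hdeg, fun σ => ?_, fun τ => ?_⟩, nullResidue_of_lagrange hP⟩, fun s => ?_⟩
  · apply overRat_injective
    rw [overRat_rename_left, hP, rename_lagrangeSum, zsmul_eq_mul, map_mul, map_intCast, hP]
  · apply overRat_injective
    rw [overRat_rename_right, hP, map_permRat_lagrangeSum hg]
  · rw [evalPoint, ← eval_overRat, hP, eval_lagrangeSum]

/-- The substitution `X_a ↦ X_a / 2`, `x_j ↦ 2 x_j`. -/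
noncomputable def rescale (n ℓ : ℕ) : Poly n ℓ →ₐ[ℂ] Poly n ℓ :=
  scaleVar (Sum.elim (fun _ => 2⁻¹) fun _ => 2)

theorem rescale_mem_wedgePower {P : Poly n ℓ} (hP : P ∈ wedgePower n ℓ) :
    rescale n ℓ P ∈ wedgePower n ℓ := by
  refine ⟨fun m hm a => hP.1 m ?_ a, fun σ => ?_, fun τ => ?_⟩
  · rw [mem_support_iff, rescale, coeff_scaleVar] at hm
    exact mem_support_iff.2 (right_ne_zero_of_mul hm)
  · have h := scaleVar_rename (Sum.elim (fun _ => 2⁻¹) fun _ => 2 : Fin ℓ ⊕ Fin n → ℂ)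
      (Sum.map σ id) P
    have e : (Sum.elim (fun _ => 2⁻¹) fun _ => 2 : Fin ℓ ⊕ Fin n → ℂ) ∘ Sum.map σ id =
        Sum.elim (fun _ => 2⁻¹) fun _ => 2 := by ext (a | j) <;> rfl
    rw [e, hP.2.1, map_zsmul] at h
    exact h.symm
  · have h := scaleVar_rename (Sum.elim (fun _ => 2⁻¹) fun _ => 2 : Fin ℓ ⊕ Fin n → ℂ)
      (Sum.map id τ) P
    have e : (Sum.elim (fun _ => 2⁻¹) fun _ => 2 : Fin ℓ ⊕ Fin n → ℂ) ∘ Sum.map id τ =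
        Sum.elim (fun _ => 2⁻¹) fun _ => 2 := by ext (a | j) <;> rfl
    rw [e, hP.2.2] at h
    exact h.symm

theorem evalPoint_rescale (s : Fin ℓ → Fin n) (P : Poly n ℓ) :
    evalPoint s (rescale n ℓ P) = doubleRat n (evalPoint s P) := by
  have h : (evalPoint s : Poly n ℓ →+* RatFun (Fin n)).comp (rescale n ℓ : Poly n ℓ →+* Poly n ℓ) =
      (doubleRat n).comp (evalPoint s : Poly n ℓ →+* RatFun (Fin n)) := by
    have e1 : ∀ r : ℂ, evalPoint s (C r : Poly n ℓ) = toRat _ (C r) := fun r => aeval_C _ _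
    apply MvPolynomial.ringHom_ext
    · intro r
      have e2 : rescale n ℓ (C r) = C r := aeval_C _ _
      have e3 : scaleVar (fun _ : Fin n => (2 : ℂ)) (C r) = C r := aeval_C _ _
      simp only [RingHom.comp_apply, RingHom.coe_coe]
      rw [e1, e2, e1, doubleRat_toRat, e3]
    · rintro (a | j)
      · simp only [RingHom.comp_apply, RingHom.coe_coe]
        have e2 : toRat (Fin n) (C 2⁻¹) = (toRat (Fin n) (C 2))⁻¹ := by
          rw [← mul_eq_one_iff_eq_inv₀ (toRat_C_ne_zero two_ne_zero), ← map_mul, ← C_mul]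
          norm_num
        rw [rescale, scaleVar_X, map_mul, e1, Sum.elim_inl, evalPoint, evalAt_inl,
          map_neg (doubleRat n), map_inv₀ (doubleRat n), doubleRat_pt, mul_inv, mul_neg, e2]
        rfl
      · simp only [RingHom.comp_apply, RingHom.coe_coe]
        rw [rescale, scaleVar_X, map_mul, e1, Sum.elim_inr, evalPoint, evalAt_inr,
          doubleRat_pt]
        rfl
  exact congrArg (fun f => f P) h

theorem isFamily_of_mem {d : ℤ} {g : Finset (Fin n) → MvPolynomial (Fin n) ℂ}
    (hg : g ∈ EqFam n ℓ d) : IsFamily ℓ g :=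
  ⟨fun I hI => hg.1 I (by exact_mod_cast hI), hg.2.1⟩

theorem isWeightedHomogeneous_of_rescale {d : ℤ} {P : Poly n ℓ}
    (h : rescale n ℓ P = (2 : ℂ) ^ d • P) : IsWeightedHomogeneous deg1 P (d : ℚ) := by
  intro m hm
  have h1 := congrArg (coeff m) h
  rw [rescale, coeff_scaleVar, coeff_smul, smul_eq_mul] at h1
  have h2 := mul_right_cancel₀ hm h1
  rw [Finsupp.prod_fintype _ _ (by simp), Fintype.prod_sum_type] at h2
  simp only [Sum.elim_inl, Sum.elim_inr, Finset.prod_pow_eq_pow_sum] at h2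
  have h3 : (2 : ℂ) ^ (-((∑ a, m (Sum.inl a) : ℕ) : ℤ) + ((∑ j, m (Sum.inr j) : ℕ) : ℤ)) =
      2 ^ d := by
    rw [← h2, zpow_add₀ two_ne_zero, zpow_neg, zpow_natCast, zpow_natCast, inv_pow]
  have h4 : (2 : ℝ) ^ (-((∑ a, m (Sum.inl a) : ℕ) : ℤ) + ((∑ j, m (Sum.inr j) : ℕ) : ℤ)) =
      2 ^ d := by
    have := congrArg norm h3
    rwa [norm_zpow, norm_zpow, Complex.norm_ofNat] at this
  have h5 := zpow_right_injective₀ (by norm_num) (by norm_num) h4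
  rw [← h5, Finsupp.weight_apply, Finsupp.sum_fintype _ _ (by simp), Fintype.sum_sum_type]
  simp [deg1]

/-- The rescaling X_a ↦ X_a/2, x_j ↦ 2x_j is compatible with the evaluation points, and `baseValue`
is invariant under doubling. So the rescaled P and 2^d P have equal values and coincide. -/
theorem exists_homogeneous {d : ℤ} {g : Finset (Fin n) → MvPolynomial (Fin n) ℂ}
    (hg : g ∈ EqFam n ℓ d) :
    ∃ P ∈ U n ℓ, HasValues P g ∧ IsWeightedHomogeneous deg1 P (d : ℚ) := by
  obtain ⟨P, hP, h⟩ := exists_mem_U (isFamily_of_mem hg)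
  refine ⟨P, hP, h, isWeightedHomogeneous_of_rescale ?_⟩
  rw [← sub_eq_zero]
  refine eq_zero_of_evalPoint (sub_mem (rescale_mem_wedgePower hP.1)
    (Submodule.smul_mem _ _ hP.1)) fun s => ?_
  have h2 : ∀ i, doubleRat n (pt n i) = toRat _ (C 2) * pt n ((1 : Equiv.Perm (Fin n)) i) :=
    doubleRat_pt
  rw [map_sub, evalPoint_rescale, map_smul, h s, map_mul,
    map_baseValue (toRat_C_ne_zero two_ne_zero) h2, doubleRat_toRat, hg.2.2, sub_eq_zero,
    toRat_C_smul]
  have h3 : (2 : ℂ) ^ d • (baseValue s * toRat (Fin n) (g (Finset.univ.map s))) =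
      toRat _ (C ((2 : ℂ) ^ d)) * (baseValue s * toRat (Fin n) (g (Finset.univ.map s))) :=
    Algebra.smul_def _ _
  rw [h3]
  exact mul_left_comm _ _ _

/-- The solution with given values. -/
noncomputable def solution (n ℓ : ℕ) (d : ℤ) : EqFam n ℓ d →ₗ[ℂ] Poly n ℓ where
  toFun g := (exists_homogeneous g.2).choose
  map_add' g h := by
    have hg := (exists_homogeneous g.2).choose_spec
    have hh := (exists_homogeneous h.2).choose_spec
    have hgh := (exists_homogeneous (g + h).2).choose_spec
    refine HasValues.eq hgh.1.1 (add_mem hg.1.1 hh.1.1) hgh.2.1 fun s => ?_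
    rw [map_add, hg.2.1 s, hh.2.1 s, ← mul_add, ← map_add]
    rfl
  map_smul' c g := by
    have hg := (exists_homogeneous g.2).choose_spec
    have hcg := (exists_homogeneous (c • g).2).choose_spec
    refine HasValues.eq hcg.1.1 (Submodule.smul_mem _ c hg.1.1) hcg.2.1 fun s => ?_
    rw [RingHom.id_apply, map_smul, hg.2.1 s]
    refine (Algebra.smul_def _ _).trans ((mul_left_comm _ _ _).trans (congrArg _ ?_))
    exact (toRat_C_smul _ _).symm

theorem solution_mem_U {d : ℤ} (g : EqFam n ℓ d) : solution n ℓ d g ∈ U n ℓ :=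
  (exists_homogeneous g.2).choose_spec.1

theorem solution_hasValues {d : ℤ} (g : EqFam n ℓ d) : HasValues (solution n ℓ d g) g :=
  (exists_homogeneous g.2).choose_spec.2.1

theorem solution_homogeneous {d : ℤ} (g : EqFam n ℓ d) :
    IsWeightedHomogeneous deg1 (solution n ℓ d g) (d : ℚ) :=
  (exists_homogeneous g.2).choose_spec.2.2

theorem solution_injective (d : ℤ) : Function.Injective (solution n ℓ d) := fun g h e => by
  have h1 := solution_hasValues g
  rw [e] at h1
  exact Subtype.ext (HasValues.eq_family (isFamily_of_mem g.2) (isFamily_of_mem h.2) h1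
    (solution_hasValues h))

theorem homogeneousComponent_mem {g : Finset (Fin n) → MvPolynomial (Fin n) ℂ}
    (hg : IsFamily ℓ g) (d : ℕ) : (fun I => homogeneousComponent d (g I)) ∈ EqFam n ℓ d := by
  refine ⟨fun I hI => ?_, fun τ I => ?_, fun I => ?_⟩
  · have : g I = 0 := hg.1 I (by exact_mod_cast hI)
    simp only [this, map_zero]
  · simp only [← hg.2 τ I]
    ext m
    obtain ⟨k, rfl⟩ : ∃ k : Fin n →₀ ℕ, m = k.mapDomain τ :=
      ⟨m.mapDomain τ.symm, by rw [← Finsupp.mapDomain_comp]; simp⟩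
    rw [coeff_rename_mapDomain _ τ.injective, coeff_homogeneousComponent,
      coeff_homogeneousComponent, coeff_rename_mapDomain _ τ.injective, Finsupp.degree_mapDomain]
  · rw [scaleVar_two_iff]
    intro m hm
    rw [coeff_homogeneousComponent] at hm
    have h1 := (ite_ne_right_iff.1 hm).1
    rw [← h1, Finsupp.degree_eq_sum]
    push_cast
    rfl

/-- The homogeneous components of an equivariant family are equivariant, so a solution decomposes
along with its family. -/
theorem U_le_iSup_solution : U n ℓ ≤ ⨆ d, LinearMap.range (solution n ℓ d) := by
  intro P hP
  obtain ⟨g, hg, h⟩ := exists_hasValues hP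
  let N := Finset.univ.sup (fun I => (g I).totalDegree) + 1
  have hN : ∀ I, (g I).totalDegree + 1 ≤ N := fun I =>
    Nat.succ_le_succ (Finset.le_sup (f := fun I => (g I).totalDegree) (Finset.mem_univ I))
  have hsum : ∀ I, g I = ∑ d ∈ Finset.range N, homogeneousComponent d (g I) := by
    intro I
    nth_rw 1 [← sum_homogeneousComponent (g I)]
    refine Finset.sum_subset (Finset.range_subset_range.2 (hN I)) fun d _ hd => ?_
    exact homogeneousComponent_eq_zero _ _ (by simpa using hd)
  have e : P = ∑ d ∈ Finset.range N, solution n ℓ d ⟨_, homogeneousComponent_mem hg d⟩ := by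
    refine HasValues.eq hP.1 (sum_mem fun d _ => (solution_mem_U _).1) h fun s => ?_
    rw [map_sum, hsum, map_sum, Finset.mul_sum]
    exact Finset.sum_congr rfl fun d _ => solution_hasValues _ s
  rw [e]
  exact sum_mem fun d _ => Submodule.mem_iSup_of_mem (d : ℤ) (LinearMap.mem_range_self _ _)

end Solutions

/-! ### Exterior products stay in the exterior power. -/

section DegreeBound

/-- The polynomials of degree less than `n` in each `X_a`. -/
def degreeLT (n ℓ : ℕ) : Submodule ℂ (Poly n ℓ) where
  carrier := {P | ∀ m ∈ P.support, ∀ a : Fin ℓ, m (Sum.inl a) < n}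
  zero_mem' := by simp
  add_mem' {P Q} hP hQ m hm a := by
    classical
    rcases Finset.mem_union.1 (support_add hm) with h | h
    · exact hP m h a
    · exact hQ m h a
  smul_mem' c P hP m hm a := hP m (support_smul hm) a

variable {n ℓ : ℕ}

theorem mem_degreeLT (hn : 0 < n) {P : Poly n ℓ} :
    P ∈ degreeLT n ℓ ↔ ∀ a : Fin ℓ, degreeOf (Sum.inl a) P < n := by
  simp only [degreeOf_lt_iff hn]
  exact ⟨fun h a m hm => h m hm a, fun h m hm a => h a m hm⟩

theorem eq_zero_of_mem_degreeLT {P : Poly 0 ℓ} (h : P ∈ degreeLT 0 ℓ) (a : Fin ℓ) : P = 0 := by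
  by_contra h0
  obtain ⟨m, hm⟩ := Finset.nonempty_iff_ne_empty.2 (mt support_eq_empty.1 h0)
  exact absurd (h m hm a) (by simp)

theorem degreeOf_rename_of_notMem {σ τ : Type*} {f : σ → τ} {i : τ} (h : ∀ j, f j ≠ i)
    (p : MvPolynomial σ ℂ) : degreeOf i (rename f p) = 0 := by
  classical
  rw [degreeOf_def, Multiset.count_eq_zero]
  intro hi
  obtain ⟨j, _, hj⟩ := Multiset.mem_map.1 (degrees_rename _ _ hi)
  exact h j hj

theorem rename_map_mem_degreeLT {k : ℕ} {f : Fin k → Fin ℓ} (hf : Function.Injective f)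
    (a : Fin ℓ) (hn : 0 < n) {p : Poly n k} (hp : p ∈ degreeLT n k) :
    degreeOf (Sum.inl a) (rename (Sum.map f id) p) < n ∧
      ((∀ i, f i ≠ a) → degreeOf (Sum.inl a) (rename (Sum.map f id) p) = 0) := by
  have h0 : (∀ i, f i ≠ a) → degreeOf (Sum.inl a) (rename (Sum.map f id) p) = 0 := by
    intro h
    refine degreeOf_rename_of_notMem ?_ p
    rintro (i | j) e
    · exact h i (Sum.inl_injective e)
    · simp at e
  refine ⟨?_, h0⟩
  by_cases h : ∀ i, f i ≠ a
  · rw [h0 h]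
    exact hn
  · push Not at h
    obtain ⟨i, rfl⟩ := h
    have := degreeOf_rename_of_injective (p := p)
      (Sum.map_injective.2 ⟨hf, Function.injective_id⟩ : Function.Injective (Sum.map f (@id (Fin n))))
      (Sum.inl i)
    rw [Sum.map_inl] at this
    rw [this]
    exact (mem_degreeLT hn).1 hp i

theorem wedge_mem_wedgePower {a b : ℕ} {p : Poly n a} {r : Poly n b} (hp : p ∈ wedgePower n a)
    (hr : r ∈ wedgePower n b) : wedge p r ∈ wedgePower n (a + b) := by
  refine ⟨?_, fun τ => ?_, fun τ => ?_⟩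
  · change wedge p r ∈ degreeLT n (a + b)
    refine Submodule.smul_mem _ _ (sum_mem fun σ _ => zsmul_mem ?_ _)
    rcases Nat.eq_zero_or_pos n with hn | hn
    · subst hn
      intro m hm k
      exfalso
      rcases Nat.eq_zero_or_pos a with ha | ha
      · have := eq_zero_of_mem_degreeLT (show r ∈ degreeLT 0 b from hr.1) ⟨0, by
          have := k.2
          omega⟩
        rw [this, map_zero, mul_zero, map_zero] at hm
        simp at hm
      · have := eq_zero_of_mem_degreeLT (show p ∈ degreeLT 0 a from hp.1) ⟨0, ha⟩
        rw [this, map_zero, zero_mul, map_zero] at hm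
        simp at hm
    · rw [mem_degreeLT hn]
      intro k
      obtain ⟨k, rfl⟩ := σ.surjective k
      have h1 := degreeOf_rename_of_injective
        (p := rename (Sum.map (Fin.castAdd b) id) p * rename (Sum.map (Fin.natAdd a) id) r)
        (Sum.map_injective.2 ⟨σ.injective, Function.injective_id⟩ :
          Function.Injective (Sum.map σ (@id (Fin n)))) (Sum.inl k)
      rw [Sum.map_inl] at h1
      rw [h1]
      refine (degreeOf_mul_le _ _ _).trans_lt ?_
      have h2 := rename_map_mem_degreeLT (Fin.castAdd_injective a b) k hn hp.1
      have h3 := rename_map_mem_degreeLT (Fin.natAdd_injective b a) k hn hr.1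
      induction k using Fin.addCases with
      | left i =>
        rw [h3.2 fun j e => absurd (congrArg Fin.val e) (by simp; omega), add_zero]
        exact h2.1
      | right j =>
        rw [h2.2 fun i e => absurd (congrArg Fin.val e) (by simp; omega), zero_add]
        exact h3.1
  · rw [wedge, map_smul, map_sum, smul_comm]
    congr 1
    rw [Finset.smul_sum]
    refine Fintype.sum_equiv (Equiv.mulLeft τ) _ _ fun σ => ?_
    rw [map_zsmul, rename_rename, Sum.map_comp_map, smul_smul, Equiv.coe_mulLeft,
      Equiv.Perm.sign_mul, Units.val_mul, ← mul_assoc, ← Units.val_mul, Int.units_mul_self,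
      Units.val_one, one_mul]
    rfl
  · rw [wedge, map_smul, map_sum]
    congr 1
    refine Finset.sum_congr rfl fun σ _ => ?_
    rw [map_zsmul, rename_rename, Sum.map_comp_map]
    have h : (Sum.map (σ : Fin (a + b) → Fin (a + b)) (τ : Fin n → Fin n)) =
        Sum.map σ id ∘ Sum.map id τ := by rw [Sum.map_comp_map]; rfl
    rw [Function.id_comp, Function.comp_id, h, ← rename_rename, map_mul, rename_rename,
      rename_rename, Sum.map_comp_map, Sum.map_comp_map]
    have h2 : ∀ {k : ℕ} (f : Fin k → Fin (a + b)) (q : Poly n k), q ∈ wedgePower n k →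
        rename (Sum.map (id ∘ f) (τ ∘ id)) q = rename (Sum.map f id) q := by
      intro k f q hq
      have : Sum.map (id ∘ f) (τ ∘ id) = Sum.map f id ∘ Sum.map id τ := by
        rw [Sum.map_comp_map]; rfl
      rw [this, ← rename_rename, hq.2.2]
    rw [h2 _ _ hp, h2 _ _ hr]

end DegreeBound

/-! ### Ξ_1 and Ξ_2 lie in the exterior powers. -/

section Theta

variable {n ℓ : ℕ}

theorem rename_theta {k : ℕ} (f : Fin k → Fin ℓ) (τ : Equiv.Perm (Fin n)) (ε : ℂ) (a : Fin k) :
    rename (Sum.map f τ) (theta ε a : Poly n k) = theta ε (f a) := by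
  rw [theta, theta, map_prod, ← Equiv.prod_comp τ fun j =>
    (1 + C ε * X (Sum.inl (f a)) * X (Sum.inr j) : Poly n ℓ)]
  refine Finset.prod_congr rfl fun j _ => ?_
  simp

theorem theta_eq_sum (ε : ℂ) (a : Fin ℓ) : (theta ε a : Poly n ℓ) =
    ∑ t : Finset (Fin n), C (ε ^ t.card) * (X (Sum.inl a) ^ t.card * ∏ j ∈ t, X (Sum.inr j)) := by
  rw [theta, Finset.prod_one_add, Finset.powerset_univ]
  refine Finset.sum_congr rfl fun t _ => ?_
  rw [Finset.prod_mul_distrib, Finset.prod_const, mul_pow, map_pow, mul_assoc]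

theorem degreeOf_theta_term (t : Finset (Fin n)) (a b : Fin ℓ) :
    degreeOf (Sum.inl b) (X (Sum.inl a) ^ t.card * ∏ j ∈ t, X (Sum.inr j) : Poly n ℓ) ≤
      if a = b then t.card else 0 := by
  refine (degreeOf_mul_le _ _ _).trans ?_
  have h1 : degreeOf (Sum.inl b) (∏ j ∈ t, X (Sum.inr j) : Poly n ℓ) ≤ 0 := by
    refine (degreeOf_prod_le _ _ _).trans ?_
    simp [degreeOf_X]
  have h2 := degreeOf_pow_le (Sum.inl b) (X (Sum.inl a) : Poly n ℓ) t.card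
  rw [degreeOf_X] at h2
  simp only [Sum.inl.injEq, @eq_comm _ b a] at h2
  refine (add_le_add h2 h1).trans ?_
  split_ifs <;> simp

theorem degreeOf_theta (ε : ℂ) (a b : Fin ℓ) :
    degreeOf (Sum.inl b) (theta ε a : Poly n ℓ) ≤ if a = b then n else 0 := by
  rw [theta_eq_sum]
  refine (degreeOf_sum_le _ _ _).trans (Finset.sup_le fun t _ => ?_)
  refine (degreeOf_C_mul_le _ _ _).trans ((degreeOf_theta_term t a b).trans ?_)
  have := t.card_le_univ
  rw [Fintype.card_fin] at this
  split_ifs <;> omega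

/-- The coefficient of X^n in Θ_± is (±1)^n ∏ x_j, so the top terms cancel. -/
theorem degreeOf_theta_sub (hn : 0 < n) (a : Fin ℓ) :
    degreeOf (Sum.inl a) (theta 1 a - (-1) ^ n * theta (-1) a : Poly n ℓ) ≤ n - 1 := by
  have h : (theta 1 a - (-1) ^ n * theta (-1) a : Poly n ℓ) =
      ∑ t : Finset (Fin n), C (1 - (-1) ^ n * (-1) ^ t.card) *
        (X (Sum.inl a) ^ t.card * ∏ j ∈ t, X (Sum.inr j)) := by
    rw [theta_eq_sum, theta_eq_sum, Finset.mul_sum, ← Finset.sum_sub_distrib]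
    refine Finset.sum_congr rfl fun t _ => ?_
    simp only [map_sub, map_mul, map_pow, map_neg, map_one, one_pow]
    ring
  rw [h]
  refine (degreeOf_sum_le _ _ _).trans (Finset.sup_le fun t _ => ?_)
  by_cases ht : t = Finset.univ
  · rw [ht, Finset.card_univ, Fintype.card_fin, ← mul_pow]
    simp
  · refine (degreeOf_C_mul_le _ _ _).trans ((degreeOf_theta_term t a a).trans ?_)
    have := Finset.card_lt_univ_of_notMem (Classical.not_forall.1 fun h => ht
      (Finset.eq_univ_of_forall h)).choose_spec
    rw [Fintype.card_fin] at this
    rw [if_pos rfl]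
    omega

theorem Xi1_mem_wedgePower (n : ℕ) : Xi1 n ∈ wedgePower n 1 := by
  refine ⟨?_, fun σ => ?_, fun τ => ?_⟩
  · change Xi1 n ∈ degreeLT n 1
    rcases Nat.eq_zero_or_pos n with hn | hn
    · subst hn
      have : Xi1 0 = 0 := by simp [Xi1, theta]
      rw [this]
      exact zero_mem _
    · rw [mem_degreeLT hn]
      intro a
      obtain rfl : a = 0 := Subsingleton.elim _ _
      refine (degreeOf_C_mul_le _ _ _).trans_lt ?_
      have := degreeOf_theta_sub hn (0 : Fin 1)
      have e : (theta 1 0 + (-1) ^ (n + 1) * theta (-1) 0 : Poly n 1) =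
          theta 1 0 - (-1) ^ n * theta (-1) 0 := by ring
      rw [e]
      omega
  · obtain rfl : σ = 1 := Subsingleton.elim _ _
    simp
  · have h : ∀ ε, rename (Sum.map id τ) (theta ε 0 : Poly n 1) = theta ε 0 := fun ε =>
      rename_theta id τ ε 0
    rw [Xi1, map_mul, map_add, map_mul, h, h, rename_C, map_pow, map_neg, map_one]

theorem X_add_X_ne_zero : (X (Sum.inl 0) + X (Sum.inl 1) : Poly n 2) ≠ 0 := fun h => by
  have := congrArg (eval fun _ => (1 : ℂ)) h
  norm_num at this

theorem perm_fin_two : ∀ σ : Equiv.Perm (Fin 2), σ = 1 ∨ σ = Equiv.swap 0 1 := by decide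

theorem rename_thetaQuotient (σ : Equiv.Perm (Fin 2)) (τ : Equiv.Perm (Fin n)) :
    rename (Sum.map σ τ) (thetaQuotient n) = thetaQuotient n := by
  have h1 := congrArg (rename (Sum.map σ τ)) (thetaQuotient_spec n)
  simp only [map_mul, map_add, map_sub, rename_X, rename_theta, Sum.map_inl] at h1
  have h2 := perm_fin_two σ
  refine mul_left_cancel₀ X_add_X_ne_zero ?_
  rw [thetaQuotient_spec]
  rcases h2 with rfl | rfl
  · exact h1
  · simp only [Equiv.swap_apply_left, Equiv.swap_apply_right] at h1
    rw [add_comm, h1]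
    ring

theorem rename_Xi2 (σ : Equiv.Perm (Fin 2)) (τ : Equiv.Perm (Fin n)) :
    rename (Sum.map σ τ) (Xi2 n) = (Equiv.Perm.sign σ : ℤ) • Xi2 n := by
  have h2 := perm_fin_two σ
  simp only [Xi2, map_mul, map_add, map_sub, map_pow, map_neg, map_one, rename_C, rename_X,
    rename_thetaQuotient, rename_theta, Sum.map_inl]
  rcases h2 with rfl | rfl
  · simp
  · rw [Equiv.Perm.sign_swap (by decide)]
    simp only [Equiv.swap_apply_left, Equiv.swap_apply_right, Units.val_neg, Units.val_one,
      neg_smul, one_smul]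
    ring

/-- In this form the degree in X_1 is visibly at most n: Θ_+(X_1) appears with its top coefficient
cancelled in the term multiplied by X_1. Dividing by X_1 + X_2 leaves degree at most n - 1. -/
theorem X_add_X_mul_Xi2 (n : ℕ) : (X (Sum.inl 0) + X (Sum.inl 1)) * Xi2 n =
    C (1 / 2) * (X (Sum.inl 0) * ((theta 1 0 - (-1) ^ n * theta (-1) 0) *
        (theta 1 1 + (-1) ^ n * theta (-1) 1)) -
      X (Sum.inl 1) * ((theta 1 0 + (-1) ^ n * theta (-1) 0) *
        (theta 1 1 - (-1) ^ n * theta (-1) 1))) := by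
  have h1 := thetaQuotient_spec n
  have h2 : ((-1) ^ n * (-1) ^ n : Poly n 2) = 1 := by rw [← mul_pow]; simp
  rw [Xi2]
  linear_combination (C (1 / 2) * (X (Sum.inl 0) - X (Sum.inl 1))) * h1 +
    (C (1 / 2) * theta (-1) 0 * theta (-1) 1 * (X (Sum.inl 0) - X (Sum.inl 1))) * h2

theorem degreeOf_Xi2 (hn : 0 < n) : degreeOf (Sum.inl 0) (Xi2 n) < n := by
  by_cases h0 : Xi2 n = 0
  · rw [h0, degreeOf_zero]
    exact hn
  have h1 := congrArg (degreeOf (Sum.inl 0)) (X_add_X_mul_Xi2 n)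
  rw [degreeOf_mul_eq X_add_X_ne_zero h0] at h1
  have h2 : 1 ≤ degreeOf (Sum.inl 0) (X (Sum.inl 0) + X (Sum.inl 1) : Poly n 2) := by
    have : Finsupp.single (Sum.inl 0) 1 ∈
        (X (Sum.inl 0) + X (Sum.inl 1) : Poly n 2).support := by
      rw [mem_support_iff, coeff_add, coeff_X, coeff_X, if_pos rfl, if_neg]
      · simp
      · intro h
        have := Finsupp.single_left_injective one_ne_zero h
        simp at this
    simpa using monomial_le_degreeOf (Sum.inl 0) this
  have hs : ((-1) ^ n : Poly n 2) = C ((-1) ^ n) := by simp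
  have b1 : ∀ (a : Fin 2), degreeOf (Sum.inl 0)
      (theta 1 a + (-1) ^ n * theta (-1) a : Poly n 2) ≤ if a = 0 then n else 0 := fun a => by
    rw [hs]
    exact (degreeOf_add_le _ _ _).trans (max_le (degreeOf_theta _ _ _)
      ((degreeOf_C_mul_le _ _ _).trans (degreeOf_theta _ _ _)))
  have b2 : degreeOf (Sum.inl 0)
      (theta 1 1 - (-1) ^ n * theta (-1) 1 : Poly n 2) ≤ 0 := by
    rw [hs]
    exact (degreeOf_sub_le _ _ _).trans (max_le (degreeOf_theta _ 1 0)
      ((degreeOf_C_mul_le _ _ _).trans (degreeOf_theta _ 1 0)))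
  have b3 := degreeOf_theta_sub hn (0 : Fin 2)
  have e0 : degreeOf (Sum.inl 0) (X (Sum.inl 0) : Poly n 2) = 1 := by simp [degreeOf_X]
  have e1 : degreeOf (Sum.inl 0) (X (Sum.inl 1) : Poly n 2) = 0 := by simp [degreeOf_X]
  have b4 := b1 0
  have b5 := b1 1
  rw [if_pos rfl] at b4
  rw [if_neg (by decide)] at b5
  have h3 : degreeOf (Sum.inl 0) (X (Sum.inl 0) * ((theta 1 0 - (-1) ^ n * theta (-1) 0) *
        (theta 1 1 + (-1) ^ n * theta (-1) 1)) : Poly n 2) ≤ n := by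
    refine (degreeOf_mul_le _ _ _).trans ?_
    have := degreeOf_mul_le (Sum.inl 0) (theta 1 0 - (-1) ^ n * theta (-1) 0 : Poly n 2)
      (theta 1 1 + (-1) ^ n * theta (-1) 1)
    omega
  have h4 : degreeOf (Sum.inl 0) (X (Sum.inl 1) * ((theta 1 0 + (-1) ^ n * theta (-1) 0) *
        (theta 1 1 - (-1) ^ n * theta (-1) 1)) : Poly n 2) ≤ n := by
    refine (degreeOf_mul_le _ _ _).trans ?_
    have := degreeOf_mul_le (Sum.inl 0) (theta 1 0 + (-1) ^ n * theta (-1) 0 : Poly n 2)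
      (theta 1 1 - (-1) ^ n * theta (-1) 1)
    omega
  have h5 := (degreeOf_C_mul_le (X (Sum.inl 0) * ((theta 1 0 - (-1) ^ n * theta (-1) 0) *
        (theta 1 1 + (-1) ^ n * theta (-1) 1)) -
      X (Sum.inl 1) * ((theta 1 0 + (-1) ^ n * theta (-1) 0) *
        (theta 1 1 - (-1) ^ n * theta (-1) 1)) : Poly n 2) (Sum.inl 0) (1 / 2)).trans
    ((degreeOf_sub_le _ _ _).trans (max_le h3 h4))
  omega

theorem Xi2_mem_wedgePower (n : ℕ) : Xi2 n ∈ wedgePower n 2 := by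
  refine ⟨?_, fun σ => rename_Xi2 σ 1, fun τ => ?_⟩
  · change Xi2 n ∈ degreeLT n 2
    rcases Nat.eq_zero_or_pos n with hn | hn
    · subst hn
      have : Xi2 0 = 0 := by
        refine mul_left_cancel₀ X_add_X_ne_zero ?_
        rw [X_add_X_mul_Xi2]
        simp [theta]
      rw [this]
      exact zero_mem _
    · rw [mem_degreeLT hn]
      intro a
      have h : a = 0 ∨ a = 1 := by
        revert a
        decide
      rcases h with rfl | rfl
      · exact degreeOf_Xi2 hn
      · have h1 := degreeOf_rename_of_injective (p := Xi2 n) (Sum.map_injective.2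
          ⟨(Equiv.swap (0 : Fin 2) 1).injective, (1 : Equiv.Perm (Fin n)).injective⟩) (Sum.inl 0)
        rw [rename_Xi2, Equiv.Perm.sign_swap (by decide), Sum.map_inl, Equiv.swap_apply_left,
          Units.val_neg, Units.val_one, neg_smul, one_smul, degreeOf_neg] at h1
        rw [h1]
        exact degreeOf_Xi2 hn
  · have := rename_Xi2 1 τ
    rwa [Equiv.Perm.sign_one, Units.val_one, one_smul] at this

end Theta

/-! ### Exterior products in terms of values: the creation operators. -/

section WedgeValues

variable {n : ℕ}

theorem prod_ltPairs_add {M : Type*} [CommMonoid M] {a b : ℕ} (f : Fin (a + b) → Fin (a + b) → M) :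
    ∏ p ∈ ltPairs (a + b), f p.1 p.2 =
      (∏ p ∈ ltPairs a, f (Fin.castAdd b p.1) (Fin.castAdd b p.2)) *
        (∏ p ∈ ltPairs b, f (Fin.natAdd a p.1) (Fin.natAdd a p.2)) *
        ∏ j, ∏ i, f (Fin.castAdd b i) (Fin.natAdd a j) := by
  simp only [ltPairs, Finset.prod_filter, Fintype.prod_prod_type]
  rw [Fin.prod_univ_add]
  have h1 : ∀ i : Fin a, (∏ k : Fin (a + b), if Fin.castAdd b i < k then f (Fin.castAdd b i) k
      else 1) = (∏ j, if i < j then f (Fin.castAdd b i) (Fin.castAdd b j) else 1) *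
        ∏ j, f (Fin.castAdd b i) (Fin.natAdd a j) := by
    intro i
    rw [Fin.prod_univ_add]
    congr 1
    refine Finset.prod_congr rfl fun j _ => if_pos ?_
    rw [Fin.lt_def, Fin.val_castAdd, Fin.val_natAdd]
    omega
  have h2 : ∀ j : Fin b, (∏ k : Fin (a + b), if Fin.natAdd a j < k then f (Fin.natAdd a j) k
      else 1) = ∏ k, if j < k then f (Fin.natAdd a j) (Fin.natAdd a k) else 1 := by
    intro j
    rw [Fin.prod_univ_add, Finset.prod_eq_one, one_mul]
    · refine Finset.prod_congr rfl fun k _ => ?_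
      simp only [Fin.lt_def, Fin.val_natAdd, add_lt_add_iff_left]
    · intro i _
      refine if_neg ?_
      rw [Fin.lt_def, Fin.val_castAdd, Fin.val_natAdd]
      omega
  simp only [h1, h2, Finset.prod_mul_distrib]
  rw [mul_right_comm]
  congr 1
  exact Finset.prod_comm

/-- The mixed factor of two sets of points. -/
noncomputable def crossFactor {a b : ℕ} (t : Fin a → Fin n) (u : Fin b → Fin n) : RatFun (Fin n) :=
  ∏ j, ∏ i, (pt n (t i) - pt n (u j)) / (pt n (t i) + pt n (u j))

theorem baseValue_add {a b : ℕ} (s : Fin (a + b) → Fin n) :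
    baseValue s = baseValue (fun i => s (Fin.castAdd b i)) *
      baseValue (fun j => s (Fin.natAdd a j)) *
      crossFactor (fun i => s (Fin.castAdd b i)) fun j => s (Fin.natAdd a j) := by
  simp only [baseValue, signFactor, crossFactor]
  rw [prod_ltPairs_add fun i j => (pt n (s i) - pt n (s j)) / (pt n (s i) + pt n (s j)),
    Fin.prod_univ_add]
  ring

theorem evalPoint_wedge {a b : ℕ} (p : Poly n a) (r : Poly n b) (s : Fin (a + b) → Fin n) :
    evalPoint s (wedge p r) = toRat _ (C ((a.factorial * b.factorial : ℕ) : ℂ)⁻¹) *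
      ∑ σ : Equiv.Perm (Fin (a + b)), ((Equiv.Perm.sign σ : ℤ) : RatFun (Fin n)) *
        (evalPoint (fun i => s (σ (Fin.castAdd b i))) p *
          evalPoint (fun j => s (σ (Fin.natAdd a j))) r) := by
  have h : ∀ {k l : ℕ} (u : Fin l → Fin n) (f : Fin k → Fin l) (Q : Poly n k),
      evalPoint u (rename (Sum.map f id) Q) = evalPoint (fun i => u (f i)) Q := fun u f Q =>
    evalAt_rename _ _ f id Q
  rw [wedge, map_smul, map_sum]
  refine (Algebra.smul_def _ _).trans ?_
  congr 1
  refine Finset.sum_congr rfl fun σ _ => ?_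
  rw [map_zsmul, zsmul_eq_mul, h, map_mul, h, h]

theorem crossFactor_ne_zero {a b : ℕ} (s : Fin (a + b) ↪ Fin n) :
    crossFactor (fun i => s (Fin.castAdd b i)) (fun j => s (Fin.natAdd a j)) ≠ 0 := by
  refine Finset.prod_ne_zero_iff.2 fun j _ => Finset.prod_ne_zero_iff.2 fun i _ => ?_
  have h : s (Fin.castAdd b i) ≠ s (Fin.natAdd a j) := fun e => by
    have := congrArg Fin.val (s.injective e)
    simp only [Fin.val_castAdd, Fin.val_natAdd] at this
    omega
  exact div_ne_zero ((generic_pt n).sub_ne _ _ h) ((generic_pt n).add_ne _ _ h)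

/-- The inverse of the mixed factor in terms of weights. -/
theorem inv_crossFactor {a b : ℕ} (t : Fin a ↪ Fin n) (u : Fin b → Fin n) :
    (crossFactor t u)⁻¹ = (-1) ^ (a * b) * ∏ j, wt (pt n) (u j) (Finset.univ.map t) := by
  rw [crossFactor, ← Finset.prod_inv_distrib, pow_mul, ← Fin.prod_const, ← Finset.prod_mul_distrib]
  refine Finset.prod_congr rfl fun j _ => ?_
  rw [← Finset.prod_inv_distrib, wt, Finset.prod_map, ← Fin.prod_const, ← Finset.prod_mul_distrib]
  refine Finset.prod_congr rfl fun i _ => ?_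
  rw [inv_div, neg_one_mul, ← div_neg, neg_sub, add_comm]

/-- A permutation σ splits the points of s into two blocks, and `baseValue (s ∘ σ)` is the product
of the values of the blocks and a mixed factor. The sign in the exterior product cancels that of
`baseValue (s ∘ σ)`, and the inverse mixed factor is a product of weights `wt`. -/
theorem evalPoint_wedge_of_hasValues {a b : ℕ} {p : Poly n a} {r : Poly n b}
    {g : Finset (Fin n) → MvPolynomial (Fin n) ℂ} {c : ℂ} (hp : HasValues p g)
    (hr : HasValues r fun _ => C c) (s : Fin (a + b) ↪ Fin n) :
    evalPoint s (wedge p r) = baseValue s *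
      (toRat _ (C (((a.factorial * b.factorial : ℕ) : ℂ)⁻¹ * c * (-1) ^ (a * b))) *
        ∑ σ : Equiv.Perm (Fin (a + b)),
          (∏ j, wt (pt n) (s (σ (Fin.natAdd a j)))
            (Finset.univ.map s \ Finset.univ.image fun j => s (σ (Fin.natAdd a j)))) *
          famRat g (Finset.univ.map s \ Finset.univ.image fun j => s (σ (Fin.natAdd a j)))) := by
  rw [evalPoint_wedge, Finset.mul_sum, Finset.mul_sum, Finset.mul_sum]
  refine Finset.sum_congr rfl fun σ _ => ?_
  let t : Fin a ↪ Fin n := (Fin.castAddEmb b).trans (σ.toEmbedding.trans s)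
  let u : Fin b ↪ Fin n := (Fin.natAddEmb a).trans (σ.toEmbedding.trans s)
  have hI : Finset.univ.map s \ Finset.univ.image (fun j => s (σ (Fin.natAdd a j))) =
      Finset.univ.map t := by
    ext i
    simp only [Finset.mem_sdiff, Finset.mem_map, Finset.mem_univ, true_and, Finset.mem_image,
      not_exists]
    constructor
    · rintro ⟨⟨k, rfl⟩, h⟩
      obtain ⟨k, rfl⟩ := σ.surjective k
      induction k using Fin.addCases with
      | left i => exact ⟨i, rfl⟩
      | right j => exact absurd rfl (h j)
    · rintro ⟨k, rfl⟩
      refine ⟨⟨σ (Fin.castAdd b k), rfl⟩, fun j e => ?_⟩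
      have := congrArg Fin.val
        (σ.injective (s.injective e) : Fin.natAdd a j = Fin.castAdd b k)
      simp only [Fin.val_castAdd, Fin.val_natAdd] at this
      omega
  have h1 := hp t
  have h2 := hr u
  have h3 : baseValue (s ∘ σ) = baseValue t * baseValue u * crossFactor t u :=
    baseValue_add (s ∘ σ)
  have h4 : crossFactor t u ≠ 0 := crossFactor_ne_zero (σ.toEmbedding.trans s)
  have h5 : baseValue t * baseValue u =
      ((Equiv.Perm.sign σ : ℤ) : RatFun (Fin n)) * baseValue s * (crossFactor t u)⁻¹ := by
    rw [← baseValue_comp, h3, mul_inv_cancel_right₀ h4]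
  have h6 : ((Equiv.Perm.sign σ : ℤ) : RatFun (Fin n)) * ((Equiv.Perm.sign σ : ℤ) : RatFun (Fin n)) =
      1 := by
    rw [← Int.cast_mul, ← Units.val_mul, Int.units_mul_self, Units.val_one, Int.cast_one]
  have h7 := inv_crossFactor t u
  rw [hI]
  change _ * (_ * (evalPoint t p * evalPoint u r)) =
    _ * (_ * ((∏ j, wt (pt n) (u j) (Finset.univ.map t)) * toRat _ (g (Finset.univ.map t))))
  rw [h1, h2, C_mul, C_mul, map_mul, map_mul, C_pow, C_neg, C_1, map_pow, map_neg, map_one]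
  generalize toRat (Fin n) (C ((a.factorial * b.factorial : ℕ) : ℂ)⁻¹) = A at *
  generalize ((Equiv.Perm.sign σ : ℤ) : RatFun (Fin n)) = e at *
  generalize (∏ j, wt (pt n) (u j) (Finset.univ.map t)) = W at *
  generalize crossFactor t u = K at *
  generalize toRat (Fin n) (C c) = c' at *
  generalize toRat (Fin n) (g (Finset.univ.map t)) = G at *
  generalize baseValue t = T at *
  generalize baseValue u = V at *
  generalize baseValue s = S at *
  rw [h7] at h5
  linear_combination (A * e * G * c') * h5 + (A * G * c' * S * (-1) ^ (a * b) * W) * h6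

/-- The fibres of φ over the points of S are translates of one fibre and so have the same size. -/
theorem sum_comp_eq_card_mul {G X L : Type*} [Group G] [Fintype G] [DecidableEq X] [Field L]
    (φ : G → X) (S : Finset X) (hφ : ∀ g, φ g ∈ S) (x₀ : X)
    (hS : ∀ x ∈ S, ∃ h : G, ∀ g, φ (h * g) = x ↔ φ g = x₀) (f : X → L) :
    ∑ g, f (φ g) = ((Finset.univ.filter fun g => φ g = x₀).card : L) * ∑ x ∈ S, f x := by
  rw [← Finset.sum_fiberwise_of_maps_to (fun g _ => hφ g), Finset.mul_sum]
  refine Finset.sum_congr rfl fun x hx => ?_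
  rw [Finset.sum_congr rfl fun g hg => by rw [(Finset.mem_filter.1 hg).2], Finset.sum_const,
    nsmul_eq_mul]
  congr 2
  obtain ⟨h, hh⟩ := hS x hx
  refine (Finset.card_bij (fun g _ => h * g) (fun g hg => ?_) (fun g _ g' _ e => mul_left_cancel e)
    fun g hg => ⟨h⁻¹ * g, ?_, mul_inv_cancel_left _ _⟩).symm
  · simpa [hh] using hg
  · have := hh (h⁻¹ * g)
    rw [mul_inv_cancel_left] at this
    simpa [← this] using hg

theorem exists_sum_perm_eq (N : ℕ) (k₀ : Fin N) : ∃ c : ℕ, c ≠ 0 ∧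
    ∀ {L : Type} [Field L] (f : Fin N → L),
      ∑ σ : Equiv.Perm (Fin N), f (σ k₀) = (c : L) * ∑ k, f k := by
  refine ⟨(Finset.univ.filter fun σ : Equiv.Perm (Fin N) => σ k₀ = k₀).card,
    (Finset.card_pos.2 ⟨1, by simp⟩).ne', fun f => ?_⟩
  refine sum_comp_eq_card_mul (fun σ : Equiv.Perm (Fin N) => σ k₀) Finset.univ
    (fun _ => Finset.mem_univ _) k₀ (fun x _ => ⟨Equiv.swap k₀ x, fun σ => ?_⟩) f
  rw [Equiv.Perm.mul_apply, Equiv.swap_apply_eq_iff, Equiv.swap_apply_right]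

theorem exists_sum_perm_pair_eq (N : ℕ) (k₀ k₁ : Fin N) (hk : k₀ ≠ k₁) : ∃ c : ℕ, c ≠ 0 ∧
    ∀ {L : Type} [Field L] (f : Fin N × Fin N → L),
      ∑ σ : Equiv.Perm (Fin N), f (σ k₀, σ k₁) = (c : L) * ∑ k ∈ Finset.univ.offDiag, f k := by
  refine ⟨(Finset.univ.filter fun σ : Equiv.Perm (Fin N) => (σ k₀, σ k₁) = (k₀, k₁)).card,
    (Finset.card_pos.2 ⟨1, by simp⟩).ne', fun f => ?_⟩
  refine sum_comp_eq_card_mul (fun σ : Equiv.Perm (Fin N) => (σ k₀, σ k₁)) Finset.univ.offDiag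
    (fun σ => by simpa using hk) (k₀, k₁) (fun x hx => ?_) f
  obtain ⟨τ, h1, h2⟩ := exists_perm_pair hk (Finset.mem_offDiag.1 hx).2.2
  refine ⟨τ, fun σ => ?_⟩
  rw [Prod.mk.injEq, Equiv.Perm.mul_apply, Equiv.Perm.mul_apply, Prod.ext_iff, ← h1, ← h2,
    τ.injective.eq_iff, τ.injective.eq_iff]

theorem toRat_C_mul_natCast (c : ℂ) (m : ℕ) : toRat (Fin n) (C (c * m)) =
    toRat (Fin n) (C c) * m := by
  rw [C_mul, map_mul, map_natCast C, map_natCast]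

/-- Only the entry σ sends to the last slot matters, so the sum over permutations collapses to the
sum over I defining ψ. The constant κ collects the normalization, the sign and the fibre size, and
does not depend on p. -/
theorem exists_wedge_single (n a : ℕ) {r : Poly n 1} {c : ℂ} (hc : c ≠ 0)
    (hr : HasValues r fun _ => C c) : ∃ κ : ℂ, κ ≠ 0 ∧
      ∀ {p : Poly n a} {g : Finset (Fin n) → MvPolynomial (Fin n) ℂ}, HasValues p g →
        ∀ s : Fin (a + 1) ↪ Fin n, evalPoint s (wedge p r) =
          baseValue s * (toRat _ (C κ) * crVec (pt n) 1 (famRat g) (Finset.univ.map s)) := by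
  obtain ⟨m, hm, hsum⟩ := exists_sum_perm_eq (a + 1) (Fin.natAdd a 0)
  refine ⟨((a.factorial * Nat.factorial 1 : ℕ) : ℂ)⁻¹ * c * (-1) ^ (a * 1) * m, ?_,
    fun {p g} hp s => ?_⟩
  · have : ((a.factorial * Nat.factorial 1 : ℕ) : ℂ) ≠ 0 := by
      exact_mod_cast mul_ne_zero (Nat.factorial_ne_zero _) (Nat.factorial_ne_zero _)
    have hm' : (m : ℂ) ≠ 0 := by exact_mod_cast hm
    exact mul_ne_zero (mul_ne_zero (mul_ne_zero (inv_ne_zero this) hc) (by simp)) hm'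
  · rw [evalPoint_wedge_of_hasValues hp hr]
    have h1 := hsum fun k => wt (pt n) (s k) ((Finset.univ.map s).erase (s k)) *
      famRat g ((Finset.univ.map s).erase (s k))
    simp only [Finset.univ_unique, Fin.default_eq_zero, Finset.prod_singleton,
      Finset.image_singleton, Finset.sdiff_singleton_eq_erase]
    rw [h1, toRat_C_mul_natCast, crVec_apply, Finset.sum_map, mul_assoc (toRat _ _)]
    simp only [Pi.one_apply, one_mul]

theorem exists_wedge_pair (n a : ℕ) {r : Poly n 2} {c : ℂ} (hc : c ≠ 0)
    (hr : HasValues r fun _ => C c) : ∃ κ : ℂ, κ ≠ 0 ∧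
      ∀ {p : Poly n a} {g : Finset (Fin n) → MvPolynomial (Fin n) ℂ}, HasValues p g →
        ∀ s : Fin (a + 2) ↪ Fin n, evalPoint s (wedge p r) =
          baseValue s * (toRat _ (C κ) * crPair (pt n) (famRat g) (Finset.univ.map s)) := by
  have hne : (Fin.natAdd a (0 : Fin 2)) ≠ Fin.natAdd a 1 := fun e => by
    have := congrArg Fin.val e
    simp at this
  obtain ⟨m, hm, hsum⟩ := exists_sum_perm_pair_eq (a + 2) (Fin.natAdd a 0) (Fin.natAdd a 1) hne
  -- The last factor 2 compensates the 1/2 in `crPair`, as the sum runs over ordered pairs.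
  refine ⟨((a.factorial * Nat.factorial 2 : ℕ) : ℂ)⁻¹ * c * (-1) ^ (a * 2) * m * 2, ?_,
    fun {p g} hp s => ?_⟩
  · have : ((a.factorial * Nat.factorial 2 : ℕ) : ℂ) ≠ 0 := by
      exact_mod_cast mul_ne_zero (Nat.factorial_ne_zero _) (Nat.factorial_ne_zero _)
    have hm' : (m : ℂ) ≠ 0 := by exact_mod_cast hm
    exact mul_ne_zero (mul_ne_zero (mul_ne_zero (mul_ne_zero (inv_ne_zero this) hc) (by simp)) hm')
      two_ne_zero
  · rw [evalPoint_wedge_of_hasValues hp hr]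
    let f : Fin n → Fin n → RatFun (Fin n) := fun i j =>
      wt (pt n) i (((Finset.univ.map s).erase i).erase j) *
        wt (pt n) j (((Finset.univ.map s).erase i).erase j) *
        famRat g (((Finset.univ.map s).erase i).erase j)
    have h1 := hsum fun k => f (s k.1) (s k.2)
    have h2 : ∀ i j, (Finset.univ.map s) \ {i, j} = ((Finset.univ.map s).erase i).erase j := by
      intro i j
      ext k
      simp only [Finset.mem_sdiff, Finset.mem_insert, Finset.mem_singleton, Finset.mem_erase]
      tauto
    have h3 : ∀ σ : Equiv.Perm (Fin (a + 2)), (Finset.univ.image fun j : Fin 2 =>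
        s (σ (Fin.natAdd a j))) = {s (σ (Fin.natAdd a 0)), s (σ (Fin.natAdd a 1))} := by
      intro σ
      ext k
      simp [Fin.exists_fin_two, eq_comm]
    have h4 : ∑ k ∈ (Finset.univ : Finset (Fin (a + 2))).offDiag, f (s k.1) (s k.2) =
        ∑ i ∈ Finset.univ.map s, ∑ j ∈ (Finset.univ.map s).erase i, f i j := by
      rw [Finset.sum_map]
      refine (Finset.sum_finset_product' (f := fun k l => f (s k) (s l))
        (Finset.univ : Finset (Fin (a + 2))).offDiag Finset.univ (fun k => Finset.univ.erase k)
        (by simp [eq_comm])).trans (Finset.sum_congr rfl fun k _ => ?_)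
      rw [← Finset.map_erase, Finset.sum_map]
    -- The pair coefficient cancels the factor at j of the weight of i, so both weights are taken
    -- over I \ {i, j}.
    have h5 : crPair (pt n) (famRat g) (Finset.univ.map s) =
        1 / 2 * ∑ i ∈ Finset.univ.map s, ∑ j ∈ (Finset.univ.map s).erase i, f i j := by
      rw [crPair_apply]
      refine congrArg _ (Finset.sum_congr rfl fun i _ => Finset.sum_congr rfl fun j hj => ?_)
      have hij := (Finset.ne_of_mem_erase hj).symm
      have e1 := (generic_pt n).sub_ne _ _ hij
      have e2 := (generic_pt n).add_ne _ _ hij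
      have e3 : wt (pt n) i ((Finset.univ.map s).erase i) = (pt n i + pt n j) / (pt n i - pt n j) *
          wt (pt n) i (((Finset.univ.map s).erase i).erase j) := wt_erase _ hj
      simp only [f]
      rw [e3]
      generalize wt (pt n) i (((Finset.univ.map s).erase i).erase j) = A
      generalize wt (pt n) j (((Finset.univ.map s).erase i).erase j) = B
      generalize famRat g (((Finset.univ.map s).erase i).erase j) = G
      generalize pt n i = u at *
      generalize pt n j = v at *
      field_simp
    simp only [Fin.prod_univ_two, h3, h2]
    have h6 : ∀ A : ℂ, toRat (Fin n) (C (A * m * 2)) =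
        toRat (Fin n) (C A) * m * 2 := fun A => by
      rw [C_mul, map_mul, toRat_C_mul_natCast, map_ofNat C, map_ofNat]
    rw [h1, h4, h5, h6]
    congr 1
    ring

end WedgeValues

/-! ### The families of Ξ_1 and Ξ_2 are nonzero constants. -/

section XiValues

variable {n ℓ : ℕ}

theorem evalPoint_theta_one (t : Fin ℓ → Fin n) (a : Fin ℓ) :
    evalPoint t (theta 1 a : Poly n ℓ) = 0 := by
  rw [theta, map_prod]
  refine Finset.prod_eq_zero (Finset.mem_univ (t a)) ?_
  rw [map_add, map_one, map_mul, map_mul, evalPoint, evalAt_inl, evalAt_inr, C_1, map_one, one_mul,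
    neg_mul, inv_mul_cancel₀ (pt_ne_zero _), add_neg_cancel]

theorem evalPoint_theta_neg_one (t : Fin ℓ → Fin n) (a : Fin ℓ) :
    evalPoint t (theta (-1) a : Poly n ℓ) =
      2 * ∏ j ∈ Finset.univ.erase (t a), (pt n (t a) + pt n j) / pt n (t a) := by
  have h : ∀ j, evalPoint t (1 + C (-1) * X (Sum.inl a) * X (Sum.inr j) : Poly n ℓ) =
      (pt n (t a) + pt n j) / pt n (t a) := by
    intro j
    rw [map_add, map_one, map_mul, map_mul, evalPoint, evalAt_inl, evalAt_inr, C_neg, C_1, map_neg,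
      map_one, neg_one_mul, neg_neg, add_div, div_self (pt_ne_zero _), inv_mul_eq_div]
  rw [theta, map_prod, ← Finset.mul_prod_erase _ _ (Finset.mem_univ (t a))]
  simp only [h]
  rw [← two_mul, mul_div_assoc, div_self (pt_ne_zero _), mul_one]

theorem evalPoint_C (t : Fin ℓ → Fin n) (c : ℂ) : evalPoint t (C c : Poly n ℓ) = toRat _ (C c) :=
  aeval_C _ _

/-- At X = -1/x_t the product Θ_+ vanishes, while Θ_- equals 2 ∏_{j ≠ t} (x_t + x_j)/x_t, twice the
common factor for ℓ = 1. -/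
theorem Xi1_hasValues (n : ℕ) : HasValues (Xi1 n) fun _ => C ((-1) ^ (n + 1)) := by
  intro t
  have e : toRat (Fin n) (C (1 / 2)) * 2 = 1 := by
    have : (2 : RatFun (Fin n)) = toRat _ (C 2) := by rw [map_ofNat, map_ofNat]
    rw [this, ← map_mul, ← C_mul]
    norm_num
  rw [Xi1, map_mul, evalPoint_C, map_add, evalPoint_theta_one, zero_add, map_mul,
    evalPoint_theta_neg_one, map_pow, map_neg, map_one, C_pow, C_neg, C_1, map_pow, map_neg, map_one,
    baseValue, signFactor]
  have h : ltPairs 1 = ∅ := by decide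
  rw [h, Finset.prod_empty, one_mul, Fin.prod_univ_one]
  linear_combination ((-1) ^ (n + 1) *
    ∏ j ∈ Finset.univ.erase (t 0), (pt n (t 0) + pt n j) / pt n (t 0)) * e

/-- Only the product Θ_-(X_1) Θ_-(X_2) survives, and -(X_1 - X_2)/(X_1 + X_2) becomes the factor (u
- v)/(u + v) of `signFactor`, where u and v are the two points. -/
theorem Xi2_hasValues (n : ℕ) : HasValues (Xi2 n) fun _ => C 2 := by
  intro t
  have e2 : (2 : RatFun (Fin n)) = toRat _ (C 2) := by rw [map_ofNat, map_ofNat]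
  have e : toRat (Fin n) (C (1 / 2)) * 2 = 1 := by
    rw [e2, ← map_mul, ← C_mul]
    norm_num
  have hne : t 0 ≠ t 1 := fun h => by simpa using t.injective h
  have h1 := congrArg (evalPoint t) (thetaQuotient_spec n)
  have h0 : ∀ a : Fin 2, evalPoint t (X (Sum.inl a) : Poly n 2) = -(pt n (t a))⁻¹ := fun a => by
    rw [evalPoint, evalAt_inl]
  simp only [map_mul, map_add, map_sub, evalPoint_theta_one, evalPoint_theta_neg_one, h0, zero_mul,
    zero_sub] at h1
  rw [Xi2]
  simp only [map_mul, map_add, map_sub, evalPoint_theta_one, evalPoint_theta_neg_one, h0, zero_mul,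
    evalPoint_C, sub_zero, mul_zero, add_zero]
  rw [baseValue, signFactor, Fin.prod_univ_two]
  have h : ltPairs 2 = {(0, 1)} := by decide
  rw [h, Finset.prod_singleton, ← e2]
  generalize (∏ j ∈ Finset.univ.erase (t 0), (pt n (t 0) + pt n j) / pt n (t 0)) = A at *
  generalize (∏ j ∈ Finset.univ.erase (t 1), (pt n (t 1) + pt n j) / pt n (t 1)) = B at *
  generalize evalPoint t (thetaQuotient n) = Q at *
  generalize toRat (Fin n) (C (1 / 2)) = c at *
  have n1 := pt_ne_zero (t 0)
  have n2 := pt_ne_zero (t 1)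
  have n3 := (generic_pt n).add_ne _ _ hne
  generalize pt n (t 0) = u at *
  generalize pt n (t 1) = v at *
  have h3 : Q * (u + v) = 4 * A * B * (u * v) := by
    field_simp at h1
    linear_combination -h1
  have h4 : Q = 4 * A * B * (u * v) / (u + v) := by
    rw [eq_div_iff n3, h3]
  rw [h4]
  field_simp
  linear_combination (2 * A * B * (u - v)) * e

end XiValues

/-! ### The denominators in terms of families. -/

section TrivialPart

variable {n : ℕ}

theorem map_wedgeRight_eq {a b : ℕ} {l d : ℤ} {r : Poly n b} (hr : r ∈ wedgePower n b)
    (T : Module.End (RatFun (Fin n)) (Finset (Fin n) → RatFun (Fin n))) {κ : ℂ} (hκ : κ ≠ 0)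
    (hT : ∀ {p : Poly n a} {g : Finset (Fin n) → MvPolynomial (Fin n) ℂ}, HasValues p g →
      ∀ s : Fin (a + b) ↪ Fin n, evalPoint s (wedge p r) =
        baseValue s * (toRat _ (C κ) * T (famRat g) (Finset.univ.map s)))
    (hl : l = a) (F : EqFam n l d →ₗ[ℂ] EqFam n (a + b : ℕ) d)
    (hF : ∀ u, famRat (F u : Finset (Fin n) → MvPolynomial (Fin n) ℂ) = T (famRat u)) :
    (LinearMap.range (solution n a d)).map (wedgeRight a r) =
      (LinearMap.range F).map (solution n (a + b) d) := by
  subst hl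
  have key : ∀ g, wedgeRight a r (solution n a d g) = κ • solution n (a + b) d (F g) := by
    intro g
    have h1 := solution_mem_U (F g)
    refine HasValues.eq (g := κ • (F g : Finset (Fin n) → MvPolynomial (Fin n) ℂ))
      (wedge_mem_wedgePower (solution_mem_U g).1 hr)
      (Submodule.smul_mem _ _ h1.1) (fun s => ?_) fun s => ?_
    · refine (hT (solution_hasValues g) s).trans ?_
      rw [← hF, Pi.smul_apply, toRat_C_smul]
      rfl
    · rw [map_smul, solution_hasValues (F g) s, Pi.smul_apply]
      refine (Algebra.smul_def _ _).trans ((mul_left_comm _ _ _).trans (congrArg _ ?_))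
      exact (toRat_C_smul _ _).symm
  apply le_antisymm
  · rintro _ ⟨_, ⟨g, rfl⟩, rfl⟩
    rw [key]
    exact Submodule.smul_mem _ _ (Submodule.mem_map_of_mem (LinearMap.mem_range_self _ _))
  · rintro _ ⟨_, ⟨g, rfl⟩, rfl⟩
    have h : solution n (a + b) d (F g) = κ⁻¹ • wedgeRight a r (solution n a d g) := by
      rw [key, smul_smul, inv_mul_cancel₀ hκ, one_smul]
    rw [h]
    exact Submodule.smul_mem _ _ (Submodule.mem_map_of_mem (LinearMap.mem_range_self _ _))

theorem map_wedge_Xi1 (a : ℕ) (d : ℤ) :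
    (LinearMap.range (solution n a d)).map (wedgeRight a (Xi1 n)) =
      (LinearMap.range (raise n (a + 1 : ℕ) d)).map (solution n (a + 1) d) := by
  obtain ⟨κ, hκ, h⟩ := exists_wedge_single n a (by simp) (Xi1_hasValues n)
  exact map_wedgeRight_eq (Xi1_mem_wedgePower n) _ hκ h (by push_cast; ring) _ famRat_raise

theorem map_wedge_Xi2 (a : ℕ) (d : ℤ) :
    (LinearMap.range (solution n a d)).map (wedgeRight a (Xi2 n)) =
      (LinearMap.range (raisePair n (a + 2 : ℕ) d)).map (solution n (a + 2) d) := by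
  obtain ⟨κ, hκ, h⟩ := exists_wedge_pair n a two_ne_zero (Xi2_hasValues n)
  exact map_wedgeRight_eq (Xi2_mem_wedgePower n) _ hκ h (by push_cast; ring) _ famRat_raisePair

/-- The families corresponding to the trivial solutions. -/
noncomputable def nullFam (n : ℕ) (l d : ℤ) : Submodule ℂ (EqFam n l d) :=
  LinearMap.range ((raise n l d).coprod (raisePair n l d))

theorem range_eq_bot_of_neg {l d l' d' : ℤ} (hl : l < 0) (f : EqFam n l d →ₗ[ℂ] EqFam n l' d') :
    LinearMap.range f = ⊥ := by
  rw [LinearMap.range_eq_bot]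
  ext1 u
  have : u = 0 := Subtype.ext ((Submodule.mem_bot ℂ).1
    ((eqFam_eq_bot_of_card n d (Or.inl hl)).le u.2))
  rw [this, map_zero, map_zero]

theorem U_eq_iSup (n ℓ : ℕ) : U n ℓ = ⨆ d, LinearMap.range (solution n ℓ d) := by
  refine le_antisymm U_le_iSup_solution (iSup_le fun d => ?_)
  rintro _ ⟨g, rfl⟩
  exact solution_mem_U g

theorem trivialPart_eq_iSup (n ℓ : ℕ) :
    trivialPart n ℓ = ⨆ d, (nullFam n ℓ d).map (solution n ℓ d) := by
  simp only [nullFam, LinearMap.range_coprod, Submodule.map_sup]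
  -- The summands missing from `trivialPart` for ℓ = 0 and ℓ = 1 correspond to families of negative
  -- cardinality, which are zero.
  rcases ℓ with _ | _ | a
  · simp only [range_eq_bot_of_neg (show ((0 : ℕ) : ℤ) - 1 < 0 by norm_num),
      range_eq_bot_of_neg (show ((0 : ℕ) : ℤ) - 1 - 1 < 0 by norm_num), Submodule.map_bot, sup_bot_eq,
      iSup_bot]
    rfl
  · change (U n 0).map (wedgeRight 0 (Xi1 n)) = _
    rw [U_eq_iSup, Submodule.map_iSup]
    refine iSup_congr fun d => ?_
    rw [range_eq_bot_of_neg (show ((0 + 1 : ℕ) : ℤ) - 1 - 1 < 0 by norm_num), Submodule.map_bot,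
      sup_bot_eq]
    exact map_wedge_Xi1 0 d
  · change (U n (a + 1)).map (wedgeRight (a + 1) (Xi1 n)) ⊔ (U n a).map (wedgeRight a (Xi2 n)) = _
    rw [U_eq_iSup, U_eq_iSup, Submodule.map_iSup, Submodule.map_iSup, ← iSup_sup_eq]
    refine iSup_congr fun d => ?_
    rw [map_wedge_Xi2]
    congr 1
    exact map_wedge_Xi1 (a + 1) d

end TrivialPart

/-! ### The grading of M_{n,ℓ} and the dimensions of its pieces. -/

section Grading

variable {n ℓ : ℕ}

theorem component_mem_of_mem_iSup {A : ℤ → Submodule ℂ (Poly n ℓ)}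
    (hA : ∀ d, A d ≤ weightedHomogeneousSubmodule ℂ deg1 (d : ℚ)) {P : Poly n ℓ}
    (hP : P ∈ ⨆ d, A d) (e : ℚ) :
    weightedHomogeneousComponent deg1 e P ∈ ⨆ d, A d ∧
      (∀ d : ℤ, e = d → weightedHomogeneousComponent deg1 e P ∈ A d) ∧
      ((∀ d : ℤ, e ≠ d) → weightedHomogeneousComponent deg1 e P = 0) := by
  refine Submodule.iSup_induction A (motive := fun P =>
    weightedHomogeneousComponent deg1 e P ∈ ⨆ d, A d ∧
      (∀ d : ℤ, e = d → weightedHomogeneousComponent deg1 e P ∈ A d) ∧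
      ((∀ d : ℤ, e ≠ d) → weightedHomogeneousComponent deg1 e P = 0)) hP ?_ ?_ ?_
  · intro c P hP
    have h1 : IsWeightedHomogeneous deg1 P (c : ℚ) := hA c hP
    by_cases he : e = c
    · rw [he, h1.weightedHomogeneousComponent_same]
      exact ⟨Submodule.mem_iSup_of_mem c hP, fun d hd => by
        rw [← Int.cast_injective hd]
        exact hP, fun h => absurd rfl (h c)⟩
    · rw [h1.weightedHomogeneousComponent_ne _ he]
      exact ⟨zero_mem _, fun d _ => zero_mem _, fun _ => rfl⟩
  · rw [map_zero]
    exact ⟨zero_mem _, fun d _ => zero_mem _, fun _ => rfl⟩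
  · rintro P Q ⟨h1, h2, h3⟩ ⟨h1', h2', h3'⟩
    rw [map_add]
    exact ⟨add_mem h1 h1', fun d hd => add_mem (h2 d hd) (h2' d hd), fun h => by
      rw [h3 h, h3' h, add_zero]⟩

theorem range_solution_le (d : ℤ) :
    LinearMap.range (solution n ℓ d) ≤ weightedHomogeneousSubmodule ℂ deg1 (d : ℚ) := by
  rintro _ ⟨g, rfl⟩
  exact solution_homogeneous g

theorem map_solution_le (d : ℤ) (N : Submodule ℂ (EqFam n ℓ d)) :
    N.map (solution n ℓ d) ≤ weightedHomogeneousSubmodule ℂ deg1 (d : ℚ) :=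
  (LinearMap.map_le_range).trans (range_solution_le d)

/-- The map from families to the classes of the corresponding solutions. -/
noncomputable def toClass (n ℓ : ℕ) (d : ℤ) : EqFam n ℓ d →ₗ[ℂ] M n ℓ :=
  ((trivialPart n ℓ).submoduleOf (U n ℓ)).mkQ ∘ₗ
    (solution n ℓ d).codRestrict (U n ℓ) solution_mem_U

/-- The denominator is a graded subspace, so a homogeneous solution in it comes from the part of
degree d, and `solution` is injective. -/
theorem ker_toClass (d : ℤ) : LinearMap.ker (toClass n ℓ d) = nullFam n ℓ d := by
  ext g
  rw [LinearMap.mem_ker, toClass, LinearMap.comp_apply, Submodule.mkQ_apply,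
    Submodule.Quotient.mk_eq_zero, Submodule.submoduleOf, Submodule.mem_comap]
  change solution n ℓ d g ∈ trivialPart n ℓ ↔ _
  rw [trivialPart_eq_iSup]
  constructor
  · intro h
    have h1 := (component_mem_of_mem_iSup (fun d => map_solution_le d _) h d).2.1 d rfl
    rw [(solution_homogeneous g).weightedHomogeneousComponent_same] at h1
    obtain ⟨g', hg', e⟩ := h1
    rwa [← solution_injective d e]
  · intro h
    exact Submodule.mem_iSup_of_mem d (Submodule.mem_map_of_mem h)

theorem gradedPiece_eq_range {k : ℚ} {d : ℤ} (hk : k - (n : ℚ) ^ 2 / 4 = d) :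
    gradedPiece n ℓ k = LinearMap.range (toClass n ℓ d) := by
  apply le_antisymm
  · rintro _ ⟨P, hP, rfl⟩
    have h1 : IsWeightedHomogeneous deg1 (P : Poly n ℓ) (d : ℚ) := by
      rw [← hk]
      exact hP
    have h2 := (U_eq_iSup n ℓ).le P.2
    have h3 := (component_mem_of_mem_iSup range_solution_le h2 d).2.1 d rfl
    rw [h1.weightedHomogeneousComponent_same] at h3
    obtain ⟨g, hg⟩ := h3
    refine ⟨g, ?_⟩
    rw [toClass, LinearMap.comp_apply]
    congr 1
    exact Subtype.ext hg
  · rintro _ ⟨g, rfl⟩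
    refine ⟨(solution n ℓ d).codRestrict (U n ℓ) solution_mem_U g, ?_, rfl⟩
    change solution n ℓ d g ∈ weightedHomogeneousSubmodule ℂ deg1 (k - (n : ℚ) ^ 2 / 4)
    rw [hk]
    exact solution_homogeneous g

theorem exists_of_gradedPiece_ne_bot {k : ℚ} (h : gradedPiece n ℓ k ≠ ⊥) :
    ∃ d : ℕ, k - (n : ℚ) ^ 2 / 4 = d := by
  by_cases hd : ∃ d : ℤ, k - (n : ℚ) ^ 2 / 4 = d
  · obtain ⟨d, hd⟩ := hd
    rcases lt_or_ge d 0 with h0 | h0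
    · refine absurd ?_ h
      rw [gradedPiece_eq_range hd, LinearMap.range_eq_bot]
      ext1 u
      have : u = 0 := Subtype.ext ((Submodule.mem_bot ℂ).1
        ((eqFam_eq_bot_of_neg n ℓ h0).le u.2))
      rw [this, map_zero, map_zero]
    · lift d to ℕ using h0
      exact ⟨d, by simpa using hd⟩
  · push Not at hd
    refine absurd (eq_bot_iff.2 ?_) h
    rintro _ ⟨P, hP, rfl⟩
    have h1 : IsWeightedHomogeneous deg1 (P : Poly n ℓ) (k - (n : ℚ) ^ 2 / 4) := hP
    have h2 := (U_eq_iSup n ℓ).le P.2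
    have h3 := (component_mem_of_mem_iSup range_solution_le h2 _).2.2 hd
    rw [h1.weightedHomogeneousComponent_same] at h3
    have : P = 0 := Subtype.ext h3
    rw [this, map_zero]
    exact zero_mem _

instance gradedPiece_finite (n ℓ : ℕ) (k : ℚ) : Module.Finite ℂ (gradedPiece n ℓ k) := by
  by_cases h : gradedPiece n ℓ k = ⊥
  · rw [h]
    infer_instance
  · obtain ⟨d, hd⟩ := exists_of_gradedPiece_ne_bot h
    rw [gradedPiece_eq_range (d := d) (by simpa using hd)]
    infer_instance

theorem finrank_gradedPiece (hl : 2 * ℓ ≤ n) {k : ℚ} {d : ℤ} (hk : k - (n : ℚ) ^ 2 / 4 = d) :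
    Module.finrank ℂ (gradedPiece n ℓ k) + eqDim n (ℓ - 1) d = eqDim n ℓ d := by
  have h1 := LinearMap.finrank_range_add_finrank_ker (toClass n ℓ d)
  rw [ker_toClass, ← gradedPiece_eq_range hk, nullFam, range_coprod_finrank (by exact_mod_cast hl)]
    at h1
  exact h1

theorem iSup_gradedPiece (n ℓ : ℕ) : ⨆ k, gradedPiece n ℓ k = ⊤ := by
  rw [eq_top_iff]
  rintro x -
  obtain ⟨P, rfl⟩ := Submodule.mkQ_surjective _ x
  have h : (U n ℓ).subtype P ∈ ⨆ d, LinearMap.range (solution n ℓ d) := by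
    rw [← U_eq_iSup]
    exact P.2
  have h2 : ⨆ d, LinearMap.range ((solution n ℓ d).codRestrict (U n ℓ) solution_mem_U) = ⊤ := by
    apply Submodule.map_injective_of_injective (U n ℓ).injective_subtype
    rw [Submodule.map_iSup, Submodule.map_top, Submodule.range_subtype]
    refine Eq.trans (iSup_congr fun d => ?_) (U_eq_iSup n ℓ).symm
    rw [← LinearMap.range_comp, LinearMap.subtype_comp_codRestrict]
  have h3 : P ∈ ⨆ d, LinearMap.range ((solution n ℓ d).codRestrict (U n ℓ) solution_mem_U) := by
    rw [h2]
    trivial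
  have h4 := Submodule.mem_map_of_mem (f := ((trivialPart n ℓ).submoduleOf (U n ℓ)).mkQ) h3
  rw [Submodule.map_iSup] at h4
  revert h4
  generalize ((trivialPart n ℓ).submoduleOf (U n ℓ)).mkQ P = y
  refine fun h4 => iSup_le (a := ⨆ k, gradedPiece n ℓ k) (fun d => ?_) h4
  rw [← LinearMap.range_comp]
  change LinearMap.range (toClass n ℓ d) ≤ _
  rw [← gradedPiece_eq_range (k := d + (n : ℚ) ^ 2 / 4) (add_sub_cancel_right _ _)]
  exact le_iSup (gradedPiece n ℓ) _

theorem component_mem_U {P : Poly n ℓ} (hP : P ∈ U n ℓ) (e : ℚ) :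
    weightedHomogeneousComponent deg1 e P ∈ U n ℓ := by
  rw [U_eq_iSup] at hP ⊢
  exact (component_mem_of_mem_iSup range_solution_le hP e).1

theorem component_mem_trivialPart {P : Poly n ℓ} (hP : P ∈ trivialPart n ℓ) (e : ℚ) :
    weightedHomogeneousComponent deg1 e P ∈ trivialPart n ℓ := by
  rw [trivialPart_eq_iSup] at hP ⊢
  exact (component_mem_of_mem_iSup (fun d => map_solution_le d _) hP e).1

/-- The projection onto the subspace of degree `k`. -/
noncomputable def gradedProj (n ℓ : ℕ) (k : ℚ) : M n ℓ →ₗ[ℂ] M n ℓ :=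
  Submodule.mapQ _ _ ((weightedHomogeneousComponent deg1 (k - (n : ℚ) ^ 2 / 4)).restrict
    fun _ hP => component_mem_U hP _) fun P hP => by
      rw [Submodule.mem_comap]
      exact component_mem_trivialPart hP _

theorem gradedProj_same {k : ℚ} {x : M n ℓ} (hx : x ∈ gradedPiece n ℓ k) :
    gradedProj n ℓ k x = x := by
  obtain ⟨P, hP, rfl⟩ := hx
  have h1 : IsWeightedHomogeneous deg1 (P : Poly n ℓ) (k - (n : ℚ) ^ 2 / 4) := hP
  rw [gradedProj, Submodule.mkQ_apply, Submodule.mapQ_apply]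
  congr 1
  exact Subtype.ext h1.weightedHomogeneousComponent_same

theorem gradedProj_ne {j k : ℚ} (hjk : j ≠ k) {x : M n ℓ} (hx : x ∈ gradedPiece n ℓ j) :
    gradedProj n ℓ k x = 0 := by
  obtain ⟨P, hP, rfl⟩ := hx
  have h1 : IsWeightedHomogeneous deg1 (P : Poly n ℓ) (j - (n : ℚ) ^ 2 / 4) := hP
  have h2 : (weightedHomogeneousComponent deg1 (k - (n : ℚ) ^ 2 / 4)).restrict
      (fun _ hP => component_mem_U hP _) P = (0 : U n ℓ) :=
    Subtype.ext (h1.weightedHomogeneousComponent_ne _ fun h => hjk (by linarith))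
  rw [gradedProj, Submodule.mkQ_apply, Submodule.mapQ_apply, h2, Submodule.Quotient.mk_zero]

end Grading

/-! ### Graded pieces of a direct sum. -/

section DirectSum

variable {ι : Type*} [DecidableEq ι] {V : ι → Type*} [∀ p, AddCommMonoid (V p)]
  [∀ p, Module ℂ (V p)] {E : ι → Type*} [∀ p, AddCommGroup (E p)] [∀ p, Module ℂ (E p)]
  {N : ∀ p, Submodule ℂ (E p)}

/-- The subspace of the direct sum whose components lie in given subspaces. -/
noncomputable def sumPiece (W : ∀ p, Submodule ℂ (V p)) : Submodule ℂ (DirectSum ι V) :=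
  ⨅ p, (W p).comap (DirectSum.component ℂ ι V p)

theorem mem_sumPiece {W : ∀ p, Submodule ℂ (V p)} {x : DirectSum ι V} :
    x ∈ sumPiece W ↔ ∀ p, x p ∈ W p := by
  simp only [sumPiece, Submodule.mem_iInf, Submodule.mem_comap]
  rfl

theorem lof_mem_sumPiece {W : ∀ p, Submodule ℂ (V p)} (p : ι) {x : V p} (hx : x ∈ W p) :
    DirectSum.lof ℂ ι V p x ∈ sumPiece W := by
  rw [mem_sumPiece]
  intro r
  by_cases h : p = r
  · subst h
    rw [DirectSum.lof_apply]
    exact hx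
  · rw [DirectSum.lof_eq_of, DirectSum.of_eq_of_ne _ _ _ (Ne.symm h)]
    exact zero_mem _

theorem iSup_sumPiece {κ : Type*} {W : κ → ∀ p, Submodule ℂ (V p)} (hW : ∀ p, ⨆ k, W k p = ⊤) :
    ⨆ k, sumPiece (W k) = ⊤ := by
  rw [eq_top_iff]
  rintro x -
  induction x using DirectSum.induction_on with
  | zero => exact zero_mem _
  | of p x =>
    have h : x ∈ ⨆ k, W k p := by
      rw [hW]
      trivial
    have h2 := Submodule.mem_map_of_mem (f := DirectSum.lof ℂ ι V p) h
    rw [Submodule.map_iSup] at h2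
    refine iSup_mono (g := fun k => sumPiece (W k)) (fun k => ?_) h2
    rintro _ ⟨y, hy, rfl⟩
    exact lof_mem_sumPiece p hy
  | add x y hx hy => exact add_mem hx hy

/-- Independence comes from π: it is the identity on the piece of index k and kills the others, so
an element of both the k-th piece and the span of the rest equals its zero projection. -/
theorem isInternal_sumPiece {κ : Type*} [DecidableEq κ] {W : κ → ∀ p, Submodule ℂ (E p ⧸ N p)}
    (hW : ∀ p, ⨆ k, W k p = ⊤) (π : κ → ∀ p, (E p ⧸ N p) →ₗ[ℂ] E p ⧸ N p)
    (hπ : ∀ k p, ∀ x ∈ W k p, π k p x = x)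
    (hπ' : ∀ j k, j ≠ k → ∀ p, ∀ x ∈ W j p, π k p x = 0) :
    DirectSum.IsInternal fun k => sumPiece (W k) := by
  rw [DirectSum.isInternal_submodule_iff_iSupIndep_and_iSup_eq_top]
  refine ⟨fun k => ?_, iSup_sumPiece hW⟩
  rw [Submodule.disjoint_def]
  intro x hx hx'
  have h : ⨆ j, ⨆ (_ : j ≠ k), sumPiece (W j) ≤ ⨅ p,
      (LinearMap.ker (π k p)).comap (DirectSum.component ℂ ι (fun p => E p ⧸ N p) p) := by
    refine iSup_le fun j => iSup_le fun hj => le_iInf fun p => ?_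
    intro y hy
    rw [Submodule.mem_comap, LinearMap.mem_ker]
    exact hπ' j k hj p _ (mem_sumPiece.1 hy p)
  have h2 := h hx'
  rw [Submodule.mem_iInf] at h2
  refine DFinsupp.ext fun p => ?_
  have h3 := h2 p
  rw [Submodule.mem_comap, LinearMap.mem_ker] at h3
  exact (hπ k p _ (mem_sumPiece.1 hx p)).symm.trans h3

/-- A subspace of a direct sum with finitely many nonzero components is a finite product. -/
noncomputable def sumPieceEquiv (W : ∀ p, Submodule ℂ (V p)) (S : Finset ι)
    (hS : ∀ p ∉ S, W p = ⊥) : sumPiece W ≃ₗ[ℂ] ((p : S) → W p) :=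
  LinearEquiv.ofBijective
    { toFun := fun x p => ⟨(x : DirectSum ι V) p.1, mem_sumPiece.1 x.2 p.1⟩
      map_add' := fun _ _ => rfl
      map_smul' := fun _ _ => rfl } (by
    constructor
    · intro x y h
      apply Subtype.ext
      refine DFinsupp.ext fun p => ?_
      by_cases hp : p ∈ S
      · exact congrArg Subtype.val (congrFun h ⟨p, hp⟩)
      · have h1 := mem_sumPiece.1 x.2 p
        have h2 := mem_sumPiece.1 y.2 p
        rw [hS p hp, Submodule.mem_bot] at h1 h2
        rw [h1, h2]
    · intro y
      refine ⟨⟨∑ p : S, DirectSum.lof ℂ ι V p.1 (y p).1,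
        sum_mem fun p _ => lof_mem_sumPiece p.1 (y p).2⟩, ?_⟩
      funext p
      apply Subtype.ext
      refine (map_sum (DirectSum.component ℂ ι V p.1)
        (fun r : S => DirectSum.lof ℂ ι V r.1 (y r).1) Finset.univ).trans ?_
      rw [Finset.sum_eq_single p]
      · exact DirectSum.lof_apply (R := ℂ) (M := V) p.1 (y p).1
      · intro r _ hr
        exact DirectSum.of_eq_of_ne _ _ _ fun h => hr (Subtype.ext h.symm)
      · exact fun h => absurd (Finset.mem_univ p) h)

theorem sumPiece_finite_and_finrank (W : ∀ p, Submodule ℂ (E p ⧸ N p)) (S : Finset ι)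
    (hS : ∀ p ∉ S, W p = ⊥) [∀ p, Module.Finite ℂ (W p)] :
    Module.Finite ℂ (sumPiece W) ∧
      Module.finrank ℂ (sumPiece W) = ∑ p ∈ S, Module.finrank ℂ (W p) := by
  refine ⟨Module.Finite.equiv (sumPieceEquiv W S hS).symm, ?_⟩
  rw [(sumPieceEquiv W S hS).finrank_eq, Module.finrank_pi_fintype]
  exact Finset.sum_coe_sort S fun p => Module.finrank ℂ (W p)

end DirectSum

/-! ### The graded pieces of M^{(i)}_λ. -/

section Total

variable {i lam : ℕ}

theorem index_two_mul_le (p : Index i lam) : 2 * p.1.2 ≤ p.1.1 := by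
  have := p.2.2
  omega

theorem mem_totalPiece {k : ℚ} {x : MTotal i lam} :
    x ∈ totalPiece i lam k ↔ ∀ p, x p ∈ gradedPiece p.1.1 p.1.2 k :=
  mem_sumPiece (W := fun p : Index i lam => gradedPiece p.1.1 p.1.2 k)

theorem isInternal_totalPiece (i lam : ℕ) : DirectSum.IsInternal (totalPiece i lam) :=
  isInternal_sumPiece (W := fun k (p : Index i lam) => gradedPiece p.1.1 p.1.2 k)
    (fun _ => iSup_gradedPiece _ _) (fun k p => gradedProj p.1.1 p.1.2 k)
    (fun _ _ _ hx => gradedProj_same hx) (fun _ _ h _ _ hx => gradedProj_ne h hx)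

theorem exists_of_totalPiece_ne_bot {k : ℚ} (h : totalPiece i lam k ≠ ⊥) :
    ∃ m : ℕ, k = (m : ℚ) / 4 := by
  obtain ⟨x, hx, h0⟩ := Submodule.exists_mem_ne_zero_of_ne_bot h
  obtain ⟨p, hp⟩ : ∃ p, x p ≠ 0 := by
    by_contra hcon
    push Not at hcon
    exact h0 (DFinsupp.ext hcon)
  have h1 : gradedPiece p.1.1 p.1.2 k ≠ ⊥ := fun e => by
    have := mem_totalPiece.1 hx p
    rw [e, Submodule.mem_bot] at this
    exact hp this
  obtain ⟨d, hd⟩ := exists_of_gradedPiece_ne_bot h1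
  refine ⟨p.1.1 ^ 2 + 4 * d, ?_⟩
  push_cast
  linarith

/-- A nonzero piece has 4k = n² + 4d ≥ n for some d ≥ 0. So only finitely many n contribute to a
given degree. -/
theorem gradedPiece_eq_bot_of_lt {n ℓ N : ℕ} {k : ℚ} (hN : 4 * k < N) (h : N ≤ n) :
    gradedPiece n ℓ k = ⊥ := by
  by_contra hne
  obtain ⟨d, hd⟩ := exists_of_gradedPiece_ne_bot hne
  have h1 : (N : ℚ) ≤ n := by exact_mod_cast h
  have h2 : (n : ℚ) ≤ n ^ 2 := by exact_mod_cast Nat.le_self_pow two_ne_zero n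
  have h3 : (0 : ℚ) ≤ d := Nat.cast_nonneg d
  linarith

theorem totalPiece_finite_and_finrank (i lam : ℕ) (k : ℚ) (S : Finset (Index i lam))
    (hS : ∀ p ∉ S, gradedPiece p.1.1 p.1.2 k = ⊥) :
    Module.Finite ℂ (totalPiece i lam k) ∧ Module.finrank ℂ (totalPiece i lam k) =
      ∑ p ∈ S, Module.finrank ℂ (gradedPiece p.1.1 p.1.2 k) :=
  sumPiece_finite_and_finrank (fun p : Index i lam => gradedPiece p.1.1 p.1.2 k) S hS

end Total

/-! ### Generating series of the dimensions. -/

section Series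

theorem q_pow (a : ℕ) : q ^ a = PowerSeries.X ^ (4 * a) := by
  rw [q, ← pow_mul]

theorem constantCoeff_qPoch (n : ℕ) : PowerSeries.constantCoeff (qPoch n) = 1 := by
  rw [qPoch, map_prod]
  refine Finset.prod_eq_one fun j hj => ?_
  have : 4 * j ≠ 0 := by
    have := (Finset.mem_Icc.1 hj).1
    omega
  rw [q_pow, map_sub, map_one, map_pow, PowerSeries.constantCoeff_X, zero_pow this, sub_zero]

theorem qPoch_ne (n : ℕ) : PowerSeries.constantCoeff (qPoch n) ≠ 0 := by
  rw [constantCoeff_qPoch]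
  exact one_ne_zero

theorem qPoch_succ (n : ℕ) : qPoch (n + 1) = qPoch n * (1 - q ^ (n + 1)) :=
  Finset.prod_Icc_succ_top (by omega) _

/-- The generating series of the dimensions of the spaces of families. -/
noncomputable def dimSeries (n : ℕ) (l : ℤ) : PowerSeries ℚ :=
  PowerSeries.mk fun m => if 4 ∣ m then (eqDim n l (m / 4 : ℕ) : ℚ) else 0

theorem eqDim_eq_zero_of_neg (n : ℕ) (l : ℤ) {d : ℤ} (hd : d < 0) : eqDim n l d = 0 := by
  rw [eqDim, eqFam_eq_bot_of_neg n l hd]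
  exact finrank_bot ℂ _

theorem dimSeries_neg_one (n : ℕ) : dimSeries n (-1) = 0 := by
  ext m
  rw [dimSeries, PowerSeries.coeff_mk, map_zero, eqDim,
    eqFam_eq_bot_of_card n _ (Or.inl (by norm_num)), finrank_bot]
  simp

theorem dimSeries_flip (n : ℕ) (l : ℤ) : dimSeries n (n - l) = dimSeries n l := by
  simp only [dimSeries, eqDim_flip]

/-- The recursion `eqDim_succ` in terms of series. The variable is q^{1/4}, so only exponents
divisible by 4 occur. -/
theorem dimSeries_succ {n l : ℕ} (hl : l ≤ n) :
    dimSeries (n + 1) l * (1 - q ^ (n + 1 - l)) = dimSeries n l := by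
  ext m
  rw [mul_sub, mul_one, q_pow, map_sub, PowerSeries.coeff_mul_X_pow']
  simp only [dimSeries, PowerSeries.coeff_mk]
  by_cases h4 : 4 ∣ m
  · obtain ⟨d, rfl⟩ := h4
    have h1 : (4 ∣ 4 * d) := Dvd.intro _ rfl
    rw [if_pos h1, if_pos h1, Nat.mul_div_cancel_left _ (by norm_num : 0 < 4)]
    have h2 := eqDim_succ (n := n) (l := l) (d := d)
    by_cases h : 4 * (n + 1 - l) ≤ 4 * d
    · have h3 : 4 * d - 4 * (n + 1 - l) = 4 * (d - (n + 1 - l)) := (Nat.mul_sub ..).symm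
      rw [if_pos h, h3, if_pos (Dvd.intro _ rfl), Nat.mul_div_cancel_left _ (by norm_num : 0 < 4),
        h2]
      have h5 : ((d - (n + 1 - l) : ℕ) : ℤ) = (d : ℤ) - (((n + 1 : ℕ) : ℤ) - l) := by omega
      rw [h5]
      push_cast
      ring
    · rw [if_neg h, h2, eqDim_eq_zero_of_neg (d := (d : ℤ) - (((n + 1 : ℕ) : ℤ) - l)) _ _ (by omega)]
      simp
  · rw [if_neg h4, if_neg h4, zero_sub, neg_eq_zero]
    split_ifs with h1 h2
    · exact absurd (by omega) h4
    · rfl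
    · rfl

theorem eqDim_zero_zero (d : ℕ) : eqDim 0 0 d = if d = 0 then 1 else 0 := by
  split_ifs with hd
  · subst hd
    have hmem : (fun _ => 1 : Finset (Fin 0) → MvPolynomial (Fin 0) ℂ) ∈ EqFam 0 0 (0 : ℕ) := by
      refine ⟨fun I hI => ?_, fun τ I => map_one _, fun I => ?_⟩
      · exact absurd (by rw [Finset.eq_empty_of_isEmpty I]; rfl) hI
      · rw [map_one, Nat.cast_zero, zpow_zero, one_smul]
    rw [eqDim, finrank_eq_one_iff_of_nonzero' ⟨_, hmem⟩
      fun h => one_ne_zero (congrFun (congrArg Subtype.val h) ∅)]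
    intro w
    refine ⟨coeff 0 (w.1 ∅), Subtype.ext (funext fun I => ?_)⟩
    rw [Finset.eq_empty_of_isEmpty I]
    ext m
    rw [Subsingleton.elim m 0]
    simp
  · rw [eqDim, (eq_bot_iff.2 fun g hg => (Submodule.mem_bot ℂ).2 (funext fun I => ?_) :
      EqFam 0 0 d = ⊥), finrank_bot]
    ext m
    by_contra h
    have h1 := (scaleVar_two_iff _ _).1 (hg.2.2 I) m h
    rw [Subsingleton.elim m 0] at h1
    simp at h1
    omega

theorem dimSeries_zero : dimSeries 0 0 = 1 := by
  ext m
  rw [dimSeries, PowerSeries.coeff_mk, PowerSeries.coeff_one, eqDim_zero_zero]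
  split_ifs <;> first | omega | simp

theorem dimSeries_mul {n l : ℕ} (hl : l ≤ n) :
    dimSeries n l * (qPoch l * qPoch (n - l)) = 1 := by
  induction n generalizing l with
  | zero =>
    obtain rfl : l = 0 := by omega
    have : qPoch 0 = 1 := by simp [qPoch]
    rw [Nat.cast_zero, dimSeries_zero, Nat.sub_zero, this, mul_one, mul_one]
  | succ n ih =>
    have key : ∀ l ≤ n, dimSeries (n + 1) l * (qPoch l * qPoch (n + 1 - l)) = 1 := by
      intro l hl
      have h1 : n + 1 - l = n - l + 1 := by omega
      rw [h1, qPoch_succ, ← h1]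
      have h2 : dimSeries (n + 1) l * (qPoch l * (qPoch (n - l) * (1 - q ^ (n + 1 - l)))) =
          dimSeries (n + 1) l * (1 - q ^ (n + 1 - l)) * (qPoch l * qPoch (n - l)) := by ring
      rw [h2, dimSeries_succ hl, ih hl]
    rcases Nat.lt_or_ge n l with h | h
    -- For l = n + 1 the recursion would involve the factor 1 - q^0 = 0. The symmetry l ↔ n + 1 - l
    -- reduces to l = 0.
    · obtain rfl : l = n + 1 := by omega
      have h1 := key 0 (Nat.zero_le n)
      rw [← dimSeries_flip, Nat.cast_zero, sub_zero, Nat.sub_zero] at h1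
      rw [Nat.sub_self, mul_comm (qPoch (n + 1))]
      exact h1
    · exact key l h

theorem dimSeries_eq_inv {n l : ℕ} (hl : l ≤ n) :
    dimSeries n l = (qPoch l * qPoch (n - l))⁻¹ := by
  rw [PowerSeries.eq_inv_iff_mul_eq_one, dimSeries_mul hl]
  rw [map_mul, constantCoeff_qPoch, constantCoeff_qPoch, mul_one]
  exact one_ne_zero

theorem inv_mul_qBinom {n l : ℕ} (hl : l ≤ n) : (qPoch n)⁻¹ * qBinom n l = dimSeries n l := by
  rw [qBinom, if_pos ⟨by positivity, by exact_mod_cast hl⟩, Int.toNat_natCast, ← mul_assoc,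
    PowerSeries.inv_mul_cancel _ (qPoch_ne n), one_mul, dimSeries_eq_inv hl]

theorem inv_mul_qBinom_sub_one {n l : ℕ} (hl : l ≤ n) :
    (qPoch n)⁻¹ * qBinom n ((l : ℤ) - 1) = dimSeries n ((l : ℤ) - 1) := by
  rcases l with _ | l
  · rw [Nat.cast_zero, zero_sub, dimSeries_neg_one, qBinom, if_neg (by simp), mul_zero]
  · have : ((l + 1 : ℕ) : ℤ) - 1 = l := by push_cast; ring
    rw [this, inv_mul_qBinom (by omega)]

theorem coeff_qSquare_mul_dimSeries (n : ℕ) (l : ℤ) (d : ℕ) :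
    PowerSeries.coeff (n ^ 2 + 4 * d) (qSquare n * dimSeries n l) = eqDim n l d := by
  rw [qSquare, add_comm, PowerSeries.coeff_X_pow_mul, dimSeries, PowerSeries.coeff_mk,
    if_pos (Dvd.intro _ rfl), Nat.mul_div_cancel_left _ (by norm_num : 0 < 4)]

theorem coeff_qSquare_mul_dimSeries_eq_zero {n : ℕ} (l : ℤ) {m : ℕ}
    (h : ¬ ∃ d, m = n ^ 2 + 4 * d) : PowerSeries.coeff m (qSquare n * dimSeries n l) = 0 := by
  rw [qSquare, PowerSeries.coeff_X_pow_mul']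
  split_ifs with h1
  · rw [dimSeries, PowerSeries.coeff_mk, if_neg]
    rintro ⟨d, hd⟩
    exact h ⟨d, by omega⟩
  · rfl

theorem finrank_gradedPiece_eq_coeff {n l : ℕ} (hl : 2 * l ≤ n) (m : ℕ) :
    (Module.finrank ℂ (gradedPiece n l ((m : ℚ) / 4)) : ℚ) =
      PowerSeries.coeff m (qSquare n * dimSeries n l) -
        PowerSeries.coeff m (qSquare n * dimSeries n ((l : ℤ) - 1)) := by
  by_cases h : ∃ d, m = n ^ 2 + 4 * d
  · obtain ⟨d, rfl⟩ := h
    rw [coeff_qSquare_mul_dimSeries, coeff_qSquare_mul_dimSeries, eq_sub_iff_add_eq]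
    exact_mod_cast finrank_gradedPiece hl (d := d) (by push_cast; ring)
  · rw [coeff_qSquare_mul_dimSeries_eq_zero _ h, coeff_qSquare_mul_dimSeries_eq_zero _ h]
    have : gradedPiece n l ((m : ℚ) / 4) = ⊥ := by
      by_contra hne
      obtain ⟨d, hd⟩ := exists_of_gradedPiece_ne_bot hne
      refine h ⟨d, ?_⟩
      have : (m : ℚ) = n ^ 2 + 4 * d := by linarith
      exact_mod_cast this
    rw [this, finrank_bot]
    simp

theorem coeff_term_eq_finrank {i lam : ℕ} (p : Index i lam) (m : ℕ) :
    PowerSeries.coeff m (qSquare p.1.1 * (qPoch p.1.1)⁻¹ *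
      (qBinom p.1.1 p.1.2 - qBinom p.1.1 ((p.1.2 : ℤ) - 1))) =
      Module.finrank ℂ (gradedPiece p.1.1 p.1.2 ((m : ℚ) / 4)) := by
  have h1 := index_two_mul_le p
  have h2 : p.1.2 ≤ p.1.1 := by omega
  rw [finrank_gradedPiece_eq_coeff h1, mul_assoc, mul_sub, inv_mul_qBinom h2,
    inv_mul_qBinom_sub_one h2, mul_sub, map_sub]

/-- The indices `(n, ℓ)` with `n ≤ m`. -/
def smallIndex (i lam m : ℕ) : Finset (Index i lam) :=
  Finset.subtype _ (Finset.range (m + 1) ×ˢ Finset.range (m + 1))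

theorem gradedPiece_eq_bot_of_notMem {i lam m : ℕ} {p : Index i lam}
    (hp : p ∉ smallIndex i lam m) : gradedPiece p.1.1 p.1.2 ((m : ℚ) / 4) = ⊥ := by
  have h1 := index_two_mul_le p
  refine gradedPiece_eq_bot_of_lt (N := m + 1) (by push_cast; linarith) ?_
  by_contra hlt
  refine hp (Finset.mem_subtype.2 (Finset.mem_product.2 ⟨?_, ?_⟩)) <;>
  · rw [Finset.mem_range]
    omega

theorem finite_totalPiece (i lam : ℕ) (k : ℚ) : Module.Finite ℂ (totalPiece i lam k) := by
  by_cases h : totalPiece i lam k = ⊥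
  · rw [h]
    infer_instance
  · obtain ⟨m, rfl⟩ := exists_of_totalPiece_ne_bot h
    exact (totalPiece_finite_and_finrank i lam _ (smallIndex i lam m)
      fun _ => gradedPiece_eq_bot_of_notMem).1

theorem coeff_ch (i lam m : ℕ) : PowerSeries.coeff m (ch (totalPiece i lam)) =
    ∑ p ∈ smallIndex i lam m, (Module.finrank ℂ (gradedPiece p.1.1 p.1.2 ((m : ℚ) / 4)) : ℚ) := by
  rw [ch, PowerSeries.coeff_mk, (totalPiece_finite_and_finrank i lam _ (smallIndex i lam m)
      fun _ => gradedPiece_eq_bot_of_notMem).2, Nat.cast_sum]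

theorem isFormalSum_of_finset {ι R : Type*} [Semiring R] {F : ι → PowerSeries R}
    {f : PowerSeries R} (S : ℕ → Finset ι) (h0 : ∀ m, ∀ s ∉ S m, PowerSeries.coeff m (F s) = 0)
    (h : ∀ m, PowerSeries.coeff m f = ∑ s ∈ S m, PowerSeries.coeff m (F s)) : IsFormalSum F f := by
  intro m
  have hS : {s | PowerSeries.coeff m (F s) ≠ 0} ⊆ (S m : Set ι) := fun s hs => by
    by_contra hcon
    exact hs (h0 m s hcon)
  exact ⟨(S m).finite_toSet.subset hS, by rw [h, finsum_eq_sum_of_support_subset _ hS]⟩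

theorem isFormalSum_ch (i lam : ℕ) : IsFormalSum
    (fun p : Index i lam => qSquare p.1.1 * (qPoch p.1.1)⁻¹ *
      (qBinom p.1.1 p.1.2 - qBinom p.1.1 ((p.1.2 : ℤ) - 1))) (ch (totalPiece i lam)) := by
  refine isFormalSum_of_finset (smallIndex i lam) (fun m p hp => ?_) fun m => ?_
  · rw [coeff_term_eq_finrank, gradedPiece_eq_bot_of_notMem hp, finrank_bot, Nat.cast_zero]
  · rw [coeff_ch]
    exact Finset.sum_congr rfl fun p _ => (coeff_term_eq_finrank p m).symm

end Series

/-! ### Summation by parts with sl₂ characters. -/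

section Characters

open LaurentPolynomial in
theorem chi_add_two (n : ℕ) : chi (n + 2) = T ((n : ℤ) + 2) + T (-((n : ℤ) + 2)) + chi n := by
  rw [chi, Finset.sum_range_succ, Finset.sum_range_succ', chi]
  have h : ∀ j : ℕ, ((n + 2 : ℕ) : ℤ) - 2 * (j + 1 : ℕ) = n - 2 * j := fun j => by
    push_cast
    ring
  simp only [h]
  have h1 : ((n + 2 : ℕ) : ℤ) - 2 * (0 : ℕ) = n + 2 := by push_cast; ring
  have h2 : (n : ℤ) - 2 * (n + 1 : ℕ) = -((n : ℤ) + 2) := by push_cast; ring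
  rw [h1, h2]
  ring

open LaurentPolynomial in
-- Passing from n to n + 2, the shifted function l ↦ h(l + 1) has the symmetry required for n. Its
-- value at -1 is h(0), generally not zero, hence the correction term. In the application h(-1) = 0.
theorem sum_chi_mul_sub (n : ℕ) (h : ℤ → ℚ) (hsymm : ∀ l, h (n - l) = h l) :
    ∑ l ∈ Finset.range (n / 2 + 1), chi (n - 2 * l) * LaurentPolynomial.C (h l - h ((l : ℤ) - 1)) =
      ∑ l ∈ Finset.range (n + 1), T ((n : ℤ) - 2 * l) * LaurentPolynomial.C (h l) - chi n * LaurentPolynomial.C (h (-1)) := by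
  induction n using Nat.twoStepInduction generalizing h with
  | zero => simp [chi]
  | one =>
    have h1 := hsymm 0
    simp only [Nat.cast_one, sub_zero] at h1
    simp [chi, Finset.sum_range_succ, h1]
    ring_nf
  | more n ih _ =>
    have h1 := ih (fun l => h (l + 1)) fun l => by
      rw [← hsymm (l + 1)]
      congr 1
      push_cast
      ring
    have h2 : (n + 2) / 2 + 1 = n / 2 + 1 + 1 := by omega
    have h3 := hsymm 0
    rw [sub_zero] at h3
    rw [h2, Finset.sum_range_succ' _ (n / 2 + 1), Finset.sum_range_succ _ (n + 2),
      Finset.sum_range_succ' _ (n + 1)]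
    have e1 : ∀ l : ℕ, n + 2 - 2 * (l + 1) = n - 2 * l := fun l => by omega
    have e2 : ∀ j : ℕ, ((n + 2 : ℕ) : ℤ) - 2 * (j + 1 : ℕ) = n - 2 * j := fun j => by
      push_cast
      ring
    have e3 : ∀ l : ℕ, ((l + 1 : ℕ) : ℤ) - 1 = l - 1 + 1 := fun l => by push_cast; ring
    have e4 : (n : ℤ) - 2 * ((n : ℤ) + 1) = -((n : ℤ) + 2) := by ring
    have e5 : ((n + 2 : ℕ) : ℤ) - 2 * (0 : ℕ) = n + 2 := by push_cast; ring
    have e6 : ∀ l : ℕ, ((l + 1 : ℕ) : ℤ) = l + 1 := fun l => by push_cast; rfl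
    simp only [e1, e2, e3, e5, h3]
    simp only [e6, e4]
    rw [h1]
    simp only [mul_zero, Nat.sub_zero, Nat.cast_zero, chi_add_two, zero_sub, neg_add_cancel,
      map_sub]
    ring

end Characters

/-! ### The fermionic formula. -/

section Fermionic

theorem coeff_zq (a : LaurentPolynomial ℚ) (f : PowerSeries ℚ) (m : ℕ) :
    PowerSeries.coeff m (zq a f) = a * LaurentPolynomial.C (PowerSeries.coeff m f) := by
  rw [zq, PowerSeries.coeff_C_mul, PowerSeries.coeff_map]

/-- The fermionic expression for the character of the level-one module. -/
noncomputable def fermionicTerm (n : ℕ) : PowerSeries (LaurentPolynomial ℚ) :=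
  ∑ l ∈ Finset.range (n + 1),
    zq (LaurentPolynomial.T ((n : ℤ) - 2 * l)) (qSquare n * (qPoch l * qPoch (n - l))⁻¹)

theorem coeff_fermionicTerm (n m : ℕ) : PowerSeries.coeff m (fermionicTerm n) =
    ∑ l ∈ Finset.range (n / 2 + 1), chi (n - 2 * l) *
      LaurentPolynomial.C (Module.finrank ℂ (gradedPiece n l ((m : ℚ) / 4)) : ℚ) := by
  have h1 := sum_chi_mul_sub n (fun l => PowerSeries.coeff m (qSquare n * dimSeries n l))
    fun l => by rw [dimSeries_flip]
  simp only [dimSeries_neg_one, mul_zero, map_zero, sub_zero] at h1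
  rw [fermionicTerm, map_sum]
  refine Eq.trans (Finset.sum_congr rfl fun l hl => ?_) (h1.symm.trans
    (Finset.sum_congr rfl fun l hl => ?_))
  · rw [coeff_zq, dimSeries_eq_inv (Nat.lt_succ_iff.1 (Finset.mem_range.1 hl))]
  · have := Finset.mem_range.1 hl
    rw [finrank_gradedPiece_eq_coeff (by omega)]

theorem coeff_fermionicTerm_eq_zero {n m : ℕ} (h : m < n) :
    PowerSeries.coeff m (fermionicTerm n) = 0 := by
  rw [coeff_fermionicTerm]
  refine Finset.sum_eq_zero fun l _ => ?_
  rw [gradedPiece_eq_bot_of_lt (N := m + 1) (by push_cast; linarith) h, finrank_bot]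
  simp

theorem coeff_zq_chi_ch (i lam m : ℕ) :
    PowerSeries.coeff m (zq (chi lam) (ch (totalPiece i lam))) =
      ∑ p ∈ Finset.range (m + 1) ×ˢ Finset.range (m + 1) with
        p.1 ≡ i [MOD 2] ∧ (p.1 : ℤ) - 2 * p.2 = lam, chi (p.1 - 2 * p.2) *
          LaurentPolynomial.C (Module.finrank ℂ (gradedPiece p.1 p.2 ((m : ℚ) / 4)) : ℚ) := by
  rw [coeff_zq, coeff_ch, map_sum, Finset.mul_sum, ← Finset.sum_subtype_eq_sum_filter]
  refine Finset.sum_congr rfl fun p _ => ?_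
  have h : p.1.1 - 2 * p.1.2 = lam := by
    have := p.2.2
    omega
  rw [h]

theorem coeff_zq_chi_ch_eq_zero {i lam m : ℕ} (h : m < lam) :
    PowerSeries.coeff m (zq (chi lam) (ch (totalPiece i lam))) = 0 := by
  rw [coeff_zq_chi_ch]
  refine Finset.sum_eq_zero fun p hp => ?_
  simp only [Finset.mem_filter, Finset.mem_product, Finset.mem_range] at hp
  omega

/-- The coefficients of the fermionic sum. -/
noncomputable def fermionicSum (i : ℕ) : PowerSeries (LaurentPolynomial ℚ) :=
  PowerSeries.mk fun m => ∑ n ∈ Finset.range (m + 1) with n ≡ i [MOD 2],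
    PowerSeries.coeff m (fermionicTerm n)

theorem isFormalSum_fermionicTerm (i : ℕ) :
    IsFormalSum (fun n : {n : ℕ // n ≡ i [MOD 2]} => fermionicTerm n) (fermionicSum i) := by
  refine isFormalSum_of_finset (fun m => Finset.subtype _ (Finset.range (m + 1)))
    (fun m n hn => coeff_fermionicTerm_eq_zero ?_) fun m => ?_
  · rw [Finset.mem_subtype, Finset.mem_range] at hn
    omega
  · rw [fermionicSum, PowerSeries.coeff_mk]
    exact (Finset.sum_subtype_eq_sum_filter
      (fun n => PowerSeries.coeff m (fermionicTerm n))).symm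

/-- The same finite sum over pairs (n, ℓ) with 2ℓ ≤ n ≤ m and n ≡ i mod 2, grouped once by n and
once by λ = n - 2ℓ. -/
theorem coeff_fermionicSum (i m : ℕ) : PowerSeries.coeff m (fermionicSum i) =
    ∑ lam ∈ Finset.range (m + 1) with lam ≡ i [MOD 2],
      PowerSeries.coeff m (zq (chi lam) (ch (totalPiece i lam))) := by
  let g : ℕ × ℕ → LaurentPolynomial ℚ := fun p => chi (p.1 - 2 * p.2) *
    LaurentPolynomial.C (Module.finrank ℂ (gradedPiece p.1 p.2 ((m : ℚ) / 4)) : ℚ)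
  let A : Finset (ℕ × ℕ) := {p ∈ Finset.range (m + 1) ×ˢ Finset.range (m + 1) |
    p.1 ≡ i [MOD 2] ∧ 2 * p.2 ≤ p.1}
  have hA : ∀ p, p ∈ A ↔ (p.1 < m + 1 ∧ p.2 < m + 1) ∧ p.1 ≡ i [MOD 2] ∧ 2 * p.2 ≤ p.1 :=
    fun p => by simp only [A, Finset.mem_filter, Finset.mem_product, Finset.mem_range]
  have h1 : PowerSeries.coeff m (fermionicSum i) = ∑ p ∈ A, g p := by
    rw [fermionicSum, PowerSeries.coeff_mk,
      ← Finset.sum_fiberwise_of_maps_to (g := Prod.fst)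
        (t := {n ∈ Finset.range (m + 1) | n ≡ i [MOD 2]})]
    · refine Finset.sum_congr rfl fun n hn => ?_
      rw [Finset.mem_filter, Finset.mem_range] at hn
      rw [coeff_fermionicTerm]
      refine Finset.sum_bij (fun l _ => (n, l)) (fun l hl => ?_) (fun l _ l' _ h => ?_)
        (fun p hp => ?_) fun l _ => rfl
      · rw [Finset.mem_range] at hl
        rw [Finset.mem_filter, hA]
        exact ⟨⟨⟨hn.1, by dsimp only; omega⟩, hn.2, by dsimp only; omega⟩, rfl⟩
      · exact congrArg Prod.snd h
      · rw [Finset.mem_filter, hA] at hp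
        obtain ⟨hp, rfl⟩ := hp
        exact ⟨p.2, Finset.mem_range.2 (by omega), rfl⟩
    · intro p hp
      rw [hA] at hp
      exact Finset.mem_filter.2 ⟨Finset.mem_range.2 hp.1.1, hp.2.1⟩
  rw [h1, ← Finset.sum_fiberwise_of_maps_to (g := fun p : ℕ × ℕ => p.1 - 2 * p.2)
    (t := {lam ∈ Finset.range (m + 1) | lam ≡ i [MOD 2]})]
  · refine Finset.sum_congr rfl fun lam hlam => ?_
    rw [coeff_zq_chi_ch]
    refine Finset.sum_congr (Finset.ext fun p => ?_) fun p _ => rfl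
    rw [Finset.mem_filter, hA]
    simp only [Finset.mem_filter, Finset.mem_product, Finset.mem_range]
    constructor
    · rintro ⟨⟨h1, h2, h3⟩, h4⟩
      exact ⟨h1, h2, by omega⟩
    · rintro ⟨h1, h2, h3⟩
      exact ⟨⟨h1, h2, by omega⟩, by omega⟩
  · intro p hp
    rw [hA] at hp
    obtain ⟨⟨h1, h2⟩, h3, h4⟩ := hp
    rw [Finset.mem_filter, Finset.mem_range]
    refine ⟨by omega, ?_⟩
    unfold Nat.ModEq at h3 ⊢
    omega

theorem isFormalSum_chi_ch (i : ℕ) :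
    IsFormalSum (fun lam : {lam : ℕ // lam ≡ i [MOD 2]} =>
      zq (chi lam) (ch (totalPiece i lam))) (fermionicSum i) := by
  refine isFormalSum_of_finset (fun m => Finset.subtype _ (Finset.range (m + 1)))
    (fun m n hn => coeff_zq_chi_ch_eq_zero ?_) fun m => ?_
  · rw [Finset.mem_subtype, Finset.mem_range] at hn
    omega
  · rw [coeff_fermionicSum]
    exact (Finset.sum_subtype_eq_sum_filter
      (fun lam => PowerSeries.coeff m (zq (chi lam) (ch (totalPiece i lam))))).symm

end Fermionic

end QKZ

theorem theorem1 (i : Fin 2) :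
    (∀ lam : ℕ,
      DirectSum.IsInternal (totalPiece i lam) ∧
      (∀ k : ℚ, Module.Finite ℂ (totalPiece i lam k)) ∧
      (∀ k : ℚ, totalPiece i lam k ≠ ⊥ → ∃ m : ℕ, k = (m : ℚ) / 4) ∧
      IsFormalSum
        (fun p : Index i lam => qSquare p.1.1 * (qPoch p.1.1)⁻¹ *
          (qBinom p.1.1 p.1.2 - qBinom p.1.1 ((p.1.2 : ℤ) - 1)))
        (ch (totalPiece i lam))) ∧
    ∃ F : PowerSeries (LaurentPolynomial ℚ),
      IsFormalSum
        (fun lam : {lam : ℕ // lam ≡ i [MOD 2]} =>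
          zq (chi lam) (ch (totalPiece i lam))) F ∧
      IsFormalSum
        (fun n : {n : ℕ // n ≡ i [MOD 2]} =>
          ∑ l ∈ Finset.range (n + 1),
            zq (LaurentPolynomial.T ((n : ℤ) - 2 * l))
              (qSquare n * (qPoch l * qPoch (n - l))⁻¹)) F :=
  ⟨fun lam => ⟨isInternal_totalPiece i lam, finite_totalPiece i lam,
    fun _ => exists_of_totalPiece_ne_bot, isFormalSum_ch i lam⟩,
    fermionicSum i, isFormalSum_chi_ch i, isFormalSum_fermionicTerm i⟩
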